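/- **Setting.** Let $D\subset\mathbb R^2$ be a bounded, connected, open polygonal domain, $T>0$, $r\ge 1$, and let $\Gamma=\prod_{n=1}^r\Gamma_n$ with intervals $\Gamma_n\subset\mathbb R$ (bounded or unbounded). Let $\rho:\Gamma\to[0,\infty)$ be a probability density with $\rho(\mathbf y)\le C_M e^{-\sum_n(\delta_n y_n)^2}$ on $\Gamma$, where $C_M>0$, $\delta_n>0$ if $\Gamma_n$ is unbounded and $\delta_n=0$ if $\Gamma_n$ is bounded. Put $\sigma(\mathbf y)=\prod_n\sigma_n(y_n)$ with $\sigma_n=1$ if $\Gamma_n$ is bounded and $\sigma_n(y_n)=e^{-\alpha_n|y_n|}$, $\alpha_n>0$, if $\Gamma_n$ is unbounded. Let $f:\Gamma\to C([0,T];L^2(D))$ be continuous with $\sup_{\mathbf y\in\Gamma}\sigma(\mathbf y)\|f(\mathbf y)\|_{C([0,T];L^2(D))}<\infty$, infinitely differentiable in each variable $y_n\in\Gamma_n$, and suppose that there are $\gamma_n\in[0,\infty)$ with $$\frac{\|\partial_{y_n}^j f(\mathbf y)\|_{C([0,T];L^2(D))}}{1+\|f(\mathbf y)\|_{C([0,T];L^2(D))}}\le\gamma_n^j\,j!\qquad\text{for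 all }\mathbf y\in\Gamma,\ j\ge 0,\ n=1,\dots,r.$$ Let $0<\tau_n<1/\gamma_n$ (any $\tau_n>0$ if $\gamma_n=0$). *The POD–Galerkin solution.* For a conforming triangulation $\mathfrak T_h$ of $\overline D$ and an integer $s\ge1$ let $H_h(D)=\{v\in H^1_0(D)\cap C^0(D): v|_K\in P_s(K)\ \forall K\in\mathfrak T_h\}$, where $P_s(K)$ is the set of polynomials of degree at most $s$ on $K$. For $N\ge1$ and $k=T/N$, and a subspace $X\subset H^1_0(D)$, the backward Euler Galerkin solution in $X$ with forcing $g$ is the sequence $w^0=0$, $w^1,\dots,w^N\in X$ with $$(w^m,v)+k(\nabla w^m,\nabla v)=k(g(mk),v)+(w^{m-1},v)\qquad\forall v\in X,\ m=1,\dots,N,$$ where $(\cdot,\cdot)$ is the $L^2(D)$ inner product. Fix a reference parameter $\mathbf y'\in\Gamma$, let $w_h^m$ be this solution for $X=H_h(D)$ and $g=f(\mathbf y')$, and take snapshots $U_i=w_h^{m_i}$, $1\le m_1<\dots<m_\ell\le N$, not all zero. A POD basis of rank $d\ge1$ is a family $\psi_1,\dots,\psi_d\in\operatorname{span}\{U_i\}$,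 orthonormal in $H^1_0(D)$ for $(u,v)_{H_0^1}=(\nabla u,\nabla v)$, which minimises $\frac1\ell\sum_{i=1}^\ell\|U_i-\sum_{j=1}^d(U_i,\psi_j)_{H^1_0}\psi_j\|_{H^1_0}^2$ among all such families. Put $X^d=\operatorname{span}\{\psi_1,\dots,\psi_d\}$ (one space, used for all $\mathbf y$), and for $\mathbf y\in\Gamma$ let $u_d^m(\mathbf y)$ be the backward Euler Galerkin solution in $X^d$ with forcing $f(\mathbf y)$. *Collocation.* For each $n$ let $\hat\rho_n$ be a measurable weight on $\Gamma_n$ with $c_n e^{-(\delta_n t)^2}\le\hat\rho_n(t)\le c_n' e^{-(\delta_n t)^2}$ for constants $c_n,c_n'>0$. For $\mathbf p=(p_1,\dots,p_r)\in\mathbb N_0^r$, in direction $n$ the collocation points are the $p_n+1$ zeros of the orthogonal polynomial of degree $p_n+1$ for $\hat\rho_n\,dt$ on $\Gamma_n$, and $\mathcal I_{\mathbf p}$ is the tensor product Lagrange interpolation operator at these points. Put $u_{d,\mathbf p}^m=\mathcal I_{\mathbf p}u_d^m$. **Theorem.** There exist positive constants $b_n$ ($n=1,\dots,r$) and $C$,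 exponents $\theta_n$ and functions $\beta_n:\mathbb N_0\to\mathbb R$, none of them depending on $\mathbf p$, $d$, the triangulation $\mathfrak T_h$ (in particular on $h$), $s$, $N$, $m$, $\mathbf y'$ or the choice of snapshots and POD basis, such that, for all such data and all $m=1,\dots,N$, the error $u_d^m-u_{d,\mathbf p}^m$ belongs to $L^2(D)\otimes L^2_\rho(\Gamma)$ and $$\|u_d^m-u_{d,\mathbf p}^m\|_{L^2(D)\otimes L^2_\rho(\Gamma)}\le C\sum_{n=1}^r\beta_n(p_n)\exp(-b_np_n^{\theta_n}),$$ where, if $\Gamma_n$ is bounded, with length $|\Gamma_n|$, $$\theta_n=1,\qquad\beta_n\equiv1,\qquad b_n=\log\Big[\frac{2\tau_n}{|\Gamma_n|}\Big(1+\sqrt{1+\frac{|\Gamma_n|^2}{4\tau_n^2}}\Big)\Big],$$ and, if $\Gamma_n$ is unbounded, $$\theta_n=\tfrac12,\qquad\beta_n(p_n)=O(\sqrt{p_n})\ \text{ as }p_n\to\infty,\qquad b_n=\tau_n\delta_n.$$ -/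

import Mathlib

open MeasureTheory Set

noncomputable section

/-- The plane with its Euclidean norm. -/
abbrev Plane : Type := EuclideanSpace ℝ (Fin 2)

/-- Bounded, connected, open set whose boundary is a finite union of line segments. -/
def IsPolygonalDomain (D : Set Plane) : Prop :=
  IsOpen D ∧ IsConnected D ∧ Bornology.IsBounded D ∧
    ∃ S : Finset (Plane × Plane), frontier D = ⋃ e ∈ S, segment ℝ e.1 e.2

/-- `L²(D)`. -/
abbrev L2 (D : Set Plane) : Type := Lp ℝ 2 (volume.restrict D)

/-- Pairs (function, gradient) in `L²(D) × L²(D; ℝ²)`. The space `H¹₀(D)` is realised inside it. -/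
abbrev L2Pair (D : Set Plane) : Type := L2 D × Lp Plane 2 (volume.restrict D)

/-- The pairs `(φ, ∇φ)` with `φ` a smooth function compactly supported in `D`. -/
def testPairs (D : Set Plane) : Submodule ℝ (L2Pair D) where
  carrier := {w | ∃ φ : Plane → ℝ, ContDiff ℝ ((⊤ : ℕ∞) : WithTop ℕ∞) φ ∧ HasCompactSupport φ ∧
    tsupport φ ⊆ D ∧ w.1 =ᵐ[volume.restrict D] φ ∧ w.2 =ᵐ[volume.restrict D] gradient φ}
  add_mem' := by
    rintro a b ⟨φ, h1, h2, h3, h4, h5⟩ ⟨ψ, k1, k2, k3, k4, k5⟩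
    refine ⟨φ + ψ, h1.add k1, h2.add k2, (tsupport_add φ ψ).trans (union_subset h3 k3), ?_, ?_⟩
    · exact (Lp.coeFn_add a.1 b.1).trans (h4.add k4)
    · refine (Lp.coeFn_add a.2 b.2).trans ((h5.add k5).trans (.of_forall fun x => ?_))
      have hφ : DifferentiableAt ℝ φ x := (h1.differentiable (by simp)) x
      have hψ : DifferentiableAt ℝ ψ x := (k1.differentiable (by simp)) x
      simp [gradient, fderiv_add hφ hψ]
  zero_mem' := by
    refine ⟨0, contDiff_const, HasCompactSupport.zero, by simp [tsupport], Lp.coeFn_zero _ _ _,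
      (Lp.coeFn_zero _ _ _).trans (.of_forall fun x => ?_)⟩
    simp [gradient]
  smul_mem' := by
    rintro c a ⟨φ, h1, h2, h3, h4, h5⟩
    refine ⟨c • φ, contDiff_const.smul h1, h2.smul_left (f := fun _ => c), ?_, ?_, ?_⟩
    · exact (closure_mono (Function.support_const_smul_subset c φ)).trans h3
    · exact (Lp.coeFn_smul c a.1).trans (h4.const_smul c)
    · refine (Lp.coeFn_smul c a.2).trans ((h5.const_smul c).trans (.of_forall fun x => ?_))
      have hφ : DifferentiableAt ℝ φ x := (h1.differentiable (by simp)) x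
      simp [gradient, fderiv_const_smul hφ c]

/-- `H¹₀(D)`, the closure of the test functions in the `H¹` topology; an element `w` carries the
function `w.1` and its weak gradient `w.2`. -/
def H01 (D : Set Plane) : Submodule ℝ (L2Pair D) := (testPairs D).topologicalClosure

/-- A conforming triangulation of the closure of `D`. -/
structure Triangulation (D : Set Plane) where
  complex : Geometry.SimplicialComplex ℝ Plane
  finite_faces : complex.faces.Finite
  space_eq : complex.space = closure D

/-- The finite element space: functions of `H¹₀(D)`, continuous on `D`, which are polynomials of
degree at most `s` on every (closed) triangle. -/
def feSpace (D : Set Plane) (𝒯 : Triangulation D) (s : ℕ) : Submodule ℝ (L2Pair D) where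
  carrier := {w | w ∈ H01 D ∧ ∃ g : Plane → ℝ, ContinuousOn g D ∧ w.1 =ᵐ[volume.restrict D] g ∧
    ∀ K ∈ 𝒯.complex.faces, K.card = 3 → ∃ P : MvPolynomial (Fin 2) ℝ, P.totalDegree ≤ s ∧
      ∀ x ∈ convexHull ℝ (K : Set Plane), g x = MvPolynomial.eval (fun i => x i) P}
  add_mem' := by
    rintro a b ⟨ha, g, g1, g2, g3⟩ ⟨hb, h, h1, h2, h3⟩
    refine ⟨add_mem ha hb, g + h, g1.add h1, (Lp.coeFn_add a.1 b.1).trans (g2.add h2), ?_⟩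
    intro K hK hc
    obtain ⟨P, hP, hP'⟩ := g3 K hK hc
    obtain ⟨Q, hQ, hQ'⟩ := h3 K hK hc
    refine ⟨P + Q, (MvPolynomial.totalDegree_add P Q).trans (max_le hP hQ), fun x hx => ?_⟩
    simp [hP' x hx, hQ' x hx]
  zero_mem' := by
    refine ⟨zero_mem _, 0, continuousOn_const, Lp.coeFn_zero _ _ _, fun K _ _ => ⟨0, by simp, ?_⟩⟩
    simp
  smul_mem' := by
    rintro c a ⟨ha, g, g1, g2, g3⟩
    refine ⟨Submodule.smul_mem _ c ha, c • g, g1.const_smul c,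
      (Lp.coeFn_smul c a.1).trans (g2.const_smul c), ?_⟩
    intro K hK hc
    obtain ⟨P, hP, hP'⟩ := g3 K hK hc
    refine ⟨c • P, (MvPolynomial.totalDegree_smul_le c P).trans hP, fun x hx => ?_⟩
    simp [hP' x hx, MvPolynomial.smul_eval]

/-- `C([0,T]; L²(D))` with the maximum norm. -/
abbrev CTL2 (D : Set Plane) (T : ℝ) : Type := C(Icc (0 : ℝ) T, L2 D)

/-- `w⁰, …, wᴺ` is the backward Euler Galerkin solution in the space `X`, with time step `k = T/N`,
zero initial value and forcing `g`:
`(wᵐ, v) + k (∇wᵐ, ∇v) = k (g(mk), v) + (wᵐ⁻¹, v)` for all `v ∈ X`. -/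
def IsBackwardEuler {D : Set Plane} {T : ℝ} (hT : 0 ≤ T) (N : ℕ) (X : Submodule ℝ (L2Pair D))
    (g : CTL2 D T) (w : ℕ → L2Pair D) : Prop :=
  w 0 = 0 ∧ ∀ m, m + 1 ≤ N → w (m + 1) ∈ X ∧ ∀ v ∈ X,
    inner ℝ (w (m + 1)).1 v.1 + (T / N) * inner ℝ (w (m + 1)).2 v.2
      = (T / N) * inner ℝ (g (projIcc 0 T hT (((m + 1 : ℕ) : ℝ) * (T / N)))) v.1
        + inner ℝ (w m).1 v.1

/-- A family of `d` elements of the span of the snapshots, orthonormal for the inner product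
`(∇·, ∇·)` of `H¹₀(D)`. -/
def IsOrthonormalInSpan {D : Set Plane} {l d : ℕ} (U : Fin l → L2Pair D)
    (ψ : Fin d → L2Pair D) : Prop :=
  (∀ i, ψ i ∈ Submodule.span ℝ (range U)) ∧ Orthonormal ℝ (fun i => (ψ i).2)

/-- `(1/l) ∑ᵢ ‖Uᵢ - ∑ⱼ (Uᵢ, ψⱼ) ψⱼ‖²`, inner product and norm being those of `H¹₀(D)`. -/
def podError {D : Set Plane} {l d : ℕ} (U : Fin l → L2Pair D) (ψ : Fin d → L2Pair D) : ℝ :=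
  (1 / (l : ℝ)) * ∑ i, ‖(U i - ∑ j, (inner ℝ (U i).2 (ψ j).2 : ℝ) • ψ j).2‖ ^ 2

/-- `ψ` is a POD basis of rank `d` for the snapshots `U`. -/
def IsPODBasis {D : Set Plane} {l d : ℕ} (U : Fin l → L2Pair D) (ψ : Fin d → L2Pair D) : Prop :=
  IsOrthonormalInSpan U ψ ∧
    ∀ φ : Fin d → L2Pair D, IsOrthonormalInSpan U φ → podError U ψ ≤ podError U φ

/-- `X` is a POD space of dimension `d` built, at the reference forcing `g`, from the backward Euler
finite element solution `w` at the snapshot times `m₁ < ⋯ < m_l` in `{1, …, N}`. -/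
def IsPODSpace {D : Set Plane} {T : ℝ} (hT : 0 ≤ T) (N : ℕ) (𝒯 : Triangulation D) (s : ℕ)
    (g : CTL2 D T) (d : ℕ) (X : Submodule ℝ (L2Pair D)) : Prop :=
  ∃ w : ℕ → L2Pair D, IsBackwardEuler hT N (feSpace D 𝒯 s) g w ∧
  ∃ (l : ℕ) (ms : Fin l → ℕ), StrictMono ms ∧ (∀ i, 1 ≤ ms i ∧ ms i ≤ N) ∧
    (∃ i, w (ms i) ≠ 0) ∧
  ∃ ψ : Fin d → L2Pair D, IsPODBasis (fun i => w (ms i)) ψ ∧ X = Submodule.span ℝ (range ψ)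

open Classical in
/-- The weight `σₙ`: `1` on a bounded set `S`, and `exp (-a |t|)` on an unbounded one. -/
def growthWeight (S : Set ℝ) (a t : ℝ) : ℝ :=
  if Bornology.IsBounded S then 1 else Real.exp (-(a * |t|))

/-- The space `C⁰_σ(Γ; V)` for `Γ = ∏ₙ Γₙ` and `σ = ∏ₙ σₙ`. -/
def MemCSigma {r : ℕ} {V : Type*} [NormedAddCommGroup V] (Γ : Fin r → Set ℝ) (α : Fin r → ℝ)
    (v : (Fin r → ℝ) → V) : Prop :=
  ContinuousOn v (Set.pi univ Γ) ∧
    ∃ M : ℝ, ∀ y ∈ Set.pi univ Γ, (∏ n, growthWeight (Γ n) (α n) (y n)) * ‖v y‖ ≤ M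

/-- `x₀, …, x_p` are the `p + 1` zeros of the orthogonal polynomial of degree `p + 1` on `S` for the
weight `w`. -/
def IsOrthogonalZeros (S : Set ℝ) (w : ℝ → ℝ) (p : ℕ) (x : Fin (p + 1) → ℝ) : Prop :=
  Function.Injective x ∧ ∃ q : Polynomial ℝ, q.Monic ∧ q.natDegree = p + 1 ∧
    (∀ g : Polynomial ℝ, g.natDegree ≤ p → ∫ t in S, q.eval t * g.eval t * w t = 0) ∧
    ∀ j, q.IsRoot (x j)

/-- Tensor product Lagrange interpolation
`∑_j v(x_{1,j₁}, …, x_{r,j_r}) ℓ_{1,j₁}(y₁) ⋯ ℓ_{r,j_r}(y_r)`. -/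
def tensorInterp {r : ℕ} {V : Type*} [AddCommGroup V] [Module ℝ V] (p : Fin r → ℕ)
    (x : ∀ n, Fin (p n + 1) → ℝ) (v : (Fin r → ℝ) → V) (y : Fin r → ℝ) : V :=
  ∑ j : (∀ n, Fin (p n + 1)),
    (∏ n, (Lagrange.basis Finset.univ (x n) (j n)).eval (y n)) • v (fun n => x n (j n))

/-- The measure `ρ dy` on `Γ = ∏ₙ Γₙ`. -/
def densityMeasure {r : ℕ} (Γ : Fin r → Set ℝ) (ρ : (Fin r → ℝ) → ℝ) : Measure (Fin r → ℝ) :=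
  (volume.restrict (Set.pi univ Γ)).withDensity (fun y => ENNReal.ofReal (ρ y))

end

/-! The L² part of the backward Euler solution in a POD space depends on the forcing through a
linear operator `S`, and testing the scheme with the solution itself gives `‖S‖ ≤ T` whatever the
space, the mesh or the time step (`exists_backwardEuler_operator`). Hence u_d^m(y) = S f(y) inherits
the derivative bounds of f up to the factor T. What remains is an interpolation estimate for
Hilbert-valued functions in which no discretisation parameter occurs.

In one variable the interpolation error is (g - P) - I(g - P) for every polynomial P of admissible
degree. The operator I is stable because the weighted norm of I g is a Gauss sum ∑ λ_j ‖g(x_j)‖²,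
and Gauss sums of exp(c t²) never exceed the integral
(`IsOrthogonalZeros.sum_gaussWeight_mul_exp_le`). So it is enough to bound g - P pointwise by the
rate times exp(0.495 (δt)²), whose square is still integrable against exp(-(δt)²).

To find P, the derivative bounds extend g analytically to a τ'-neighbourhood of Γ with τ' > τ and
γτ' < 1. On a bounded interval the truncated Chebyshev series converges like ϱ^(-p), where ϱ belongs
to the confocal ellipse with semi-minor axis τ; this is the stated b_n. On an unbounded interval
exp(-ηt²) g is expanded on an interval of half-length R ≈ 0.97 √p / δ, and the truncated series is
multiplied by a Taylor polynomial of exp(ηt²). With ϱ = 1 + τ/R the series error inside is about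
exp(-τδ√p / 0.97); outside, the Chebyshev polynomials grow at most like exp(0.4894 (δt)²), which the
weight tolerates. The inner exponent beats τδ√p by a margin that absorbs every power of p, so β_n =
1 works in both cases.

Several variables are treated one at a time through v - I_(s ∪ i) v = (v - I_i v) + I_i (v - I_s v),
with Tonelli for the product Gaussian measure that dominates ρ dy (`lmarginal_partialInterp_le`). -/

noncomputable section

/-! ### Uniform stability and linearity of the fully discrete scheme -/

section Galerkin

variable {D : Set Plane} {T : ℝ}

/-- Stability of the backward Euler scheme in the `L²` component. -/
theorem IsBackwardEuler.norm_le (hT : 0 < T) {N : ℕ} (hN : 0 < N) {X : Submodule ℝ (L2Pair D)}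
    {g : CTL2 D T} {w : ℕ → L2Pair D} (h : IsBackwardEuler hT.le N X g w) :
    ∀ m, m ≤ N → ‖(w m).1‖ ≤ m * (T / N) * ‖g‖ := by
  have hk : 0 < T / N := by positivity
  intro m
  induction m with
  | zero => intro _; simp [h.1]
  | succ m ih =>
    intro hm
    obtain ⟨hX, hv⟩ := h.2 m hm
    -- The test function is the solution itself. The gradient term is nonnegative and gets dropped,
    -- so no Poincaré constant and no property of `X` enters the bound.
    have e := hv _ hX
    have ih' := ih (by omega)
    rw [real_inner_self_eq_norm_sq, real_inner_self_eq_norm_sq] at e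
    set a := ‖(w (m + 1)).1‖
    have h1 := real_inner_le_norm (g (projIcc 0 T hT.le (((m + 1 : ℕ) : ℝ) * (T / N))))
      (w (m + 1)).1
    have h2 := real_inner_le_norm (w m).1 (w (m + 1)).1
    have h3 := g.norm_coe_le_norm (projIcc 0 T hT.le (((m + 1 : ℕ) : ℝ) * (T / N)))
    have ha : 0 ≤ a := norm_nonneg _
    have h4 : a * a ≤ (T / N * ‖g‖ + ‖(w m).1‖) * a := by
      have h5 : 0 ≤ (T / N) * ‖(w (m + 1)).2‖ ^ 2 := by positivity
      have h6 := mul_le_mul_of_nonneg_left (h1.trans (mul_le_mul_of_nonneg_right h3 ha)) hk.le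
      nlinarith
    have h7 : a ≤ T / N * ‖g‖ + ‖(w m).1‖ := by
      rcases ha.eq_or_lt with h0 | h0
      · rw [← h0]; positivity
      · exact le_of_mul_le_mul_right h4 h0
    push_cast
    linarith

theorem IsBackwardEuler.sub (hT : 0 < T) {N : ℕ} {X : Submodule ℝ (L2Pair D)}
    {g g' : CTL2 D T} {w w' : ℕ → L2Pair D} (h : IsBackwardEuler hT.le N X g w)
    (h' : IsBackwardEuler hT.le N X g' w') :
    IsBackwardEuler hT.le N X (g - g') (fun m => w m - w' m) := by
  refine ⟨by simp [h.1, h'.1], fun m hm => ?_⟩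
  obtain ⟨h1, h2⟩ := h.2 m hm
  obtain ⟨h1', h2'⟩ := h'.2 m hm
  refine ⟨X.sub_mem h1 h1', fun v hv => ?_⟩
  have e := h2 v hv
  have e' := h2' v hv
  simp only [Prod.fst_sub, Prod.snd_sub, inner_sub_left, ContinuousMap.sub_apply]
  linarith

/-- On a finite-dimensional space on which the gradient seminorm is definite, every bounded
functional of the first component is represented through the form `(·,·) + k (∇·, ∇·)`. -/
theorem exists_solution_map {X : Submodule ℝ (L2Pair D)} [FiniteDimensional ℝ X] {k : ℝ}
    (hk : 0 < k) (hX : ∀ v ∈ X, v.2 = 0 → v = 0) :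
    ∃ R : L2 D →ₗ[ℝ] X, ∀ z, ∀ v ∈ X,
      inner ℝ (R z : L2Pair D).1 v.1 + k * inner ℝ (R z : L2Pair D).2 v.2 = inner ℝ z v.1 := by
  let B : X →ₗ[ℝ] Module.Dual ℝ X := LinearMap.mk₂ ℝ
    (fun u v : X => (inner ℝ (u : L2Pair D).1 (v : L2Pair D).1 : ℝ)
      + k * inner ℝ (u : L2Pair D).2 (v : L2Pair D).2)
    (fun a b c => by simp [inner_add_left]; ring)
    (fun a b c => by simp [inner_smul_left]; ring)
    (fun a b c => by simp [inner_add_right]; ring)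
    (fun a b c => by simp [inner_smul_right]; ring)
  have hB : Function.Injective B := by
    rw [← LinearMap.ker_eq_bot, LinearMap.ker_eq_bot']
    intro u hu
    have e : B u u = 0 := by rw [hu]; rfl
    simp only [B, LinearMap.mk₂_apply, real_inner_self_eq_norm_sq] at e
    have h1 : ‖(u : L2Pair D).2‖ ^ 2 = 0 := by
      have := sq_nonneg ‖(u : L2Pair D).1‖
      have h2 := sq_nonneg ‖(u : L2Pair D).2‖
      nlinarith
    exact Subtype.ext (hX _ u.2 (by simpa using h1))
  -- In finite dimension definiteness alone makes the form an isomorphism onto the dual; no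
  -- coercivity constant is required.
  let e := LinearMap.linearEquivOfInjective B hB Subspace.dual_finrank_eq.symm
  let Φ : L2 D →ₗ[ℝ] Module.Dual ℝ X := LinearMap.mk₂ ℝ
    (fun (z : L2 D) (v : X) => (inner ℝ z (v : L2Pair D).1 : ℝ))
    (fun a b c => by simp [inner_add_left])
    (fun a b c => by simp [inner_smul_left])
    (fun a b c => by simp [inner_add_right])
    (fun a b c => by simp [inner_smul_right])
  refine ⟨e.symm.toLinearMap ∘ₗ Φ, fun z v hv => ?_⟩
  have h1 : B (e.symm (Φ z)) = Φ z := e.apply_symm_apply (Φ z)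
  exact congrArg (fun F : Module.Dual ℝ X => F ⟨v, hv⟩) h1

/-- The first component of the fully discrete solution depends on the forcing through one bounded
linear operator of norm at most `T`. -/
theorem exists_backwardEuler_operator (hT : 0 < T) {N : ℕ} (hN : 0 < N)
    {X : Submodule ℝ (L2Pair D)} [FiniteDimensional ℝ X] (hX : ∀ v ∈ X, v.2 = 0 → v = 0)
    {m : ℕ} (hm : m ≤ N) :
    ∃ S : CTL2 D T →L[ℝ] L2 D, ‖S‖ ≤ T ∧
      ∀ (g : CTL2 D T) (w : ℕ → L2Pair D), IsBackwardEuler hT.le N X g w → (w m).1 = S g := by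
  have hk : 0 < T / N := by positivity
  obtain ⟨R, hR⟩ := exists_solution_map hk hX
  let ev : ℕ → CTL2 D T →ₗ[ℝ] L2 D := fun m =>
    { toFun := fun g => (T / N) • g (projIcc 0 T hT.le ((m : ℝ) * (T / N)))
      map_add' := fun a b => by simp
      map_smul' := fun c a => by
        rw [ContinuousMap.smul_apply, smul_comm, RingHom.id_apply] }
  let P : X →ₗ[ℝ] L2 D := LinearMap.fst ℝ _ _ ∘ₗ X.subtype
  let S : ℕ → CTL2 D T →ₗ[ℝ] X := fun m =>
    Nat.rec 0 (fun m S => R ∘ₗ (ev (m + 1) + P ∘ₗ S)) m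
  have hS : ∀ g, IsBackwardEuler hT.le N X g (fun m => (S m g : L2Pair D)) := by
    intro g
    refine ⟨by simp [S], fun m _ => ⟨(S (m + 1) g).2, fun v hv => ?_⟩⟩
    have := hR (ev (m + 1) g + P (S m g)) v hv
    rw [inner_add_left] at this
    refine this.trans ?_
    simp [ev, P, inner_smul_left]
  have hb : ∀ g, ‖(P ∘ₗ S m) g‖ ≤ T * ‖g‖ := by
    intro g
    refine ((hS g).norm_le hT hN m hm).trans ?_
    gcongr
    have : (m : ℝ) ≤ N := by exact_mod_cast hm
    have hN' : (0 : ℝ) < N := by exact_mod_cast hN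
    calc (m : ℝ) * (T / N) ≤ N * (T / N) := by gcongr
      _ = T := by field_simp
  refine ⟨(P ∘ₗ S m).mkContinuous T hb, LinearMap.mkContinuous_norm_le _ hT.le _,
    fun g w hw => ?_⟩
  -- Uniqueness: the difference of two solutions with equal forcing solves the scheme with zero
  -- forcing, so its L² part vanishes by stability.
  have := (hw.sub hT (hS g)).norm_le hT hN m hm
  simp only [sub_self, norm_zero, mul_zero] at this
  have h0 := norm_le_zero_iff.1 this
  rw [Prod.fst_sub, sub_eq_zero] at h0
  exact h0

theorem IsPODSpace.finiteDimensional {hT : 0 ≤ T} {N : ℕ} {𝒯 : Triangulation D} {s : ℕ}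
    {g : CTL2 D T} {d : ℕ} {X : Submodule ℝ (L2Pair D)} (h : IsPODSpace hT N 𝒯 s g d X) :
    FiniteDimensional ℝ X := by
  obtain ⟨w, -, l, ms, -, -, -, ψ, -, rfl⟩ := h
  exact FiniteDimensional.span_of_finite ℝ (finite_range ψ)

/-- The gradient seminorm is definite on a POD space. -/
theorem IsPODSpace.eq_zero_of_snd_eq_zero {hT : 0 ≤ T} {N : ℕ} {𝒯 : Triangulation D} {s : ℕ}
    {g : CTL2 D T} {d : ℕ} {X : Submodule ℝ (L2Pair D)} (h : IsPODSpace hT N 𝒯 s g d X) :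
    ∀ v ∈ X, v.2 = 0 → v = 0 := by
  obtain ⟨w, -, l, ms, -, -, -, ψ, hψ, rfl⟩ := h
  intro v hv h0
  obtain ⟨c, rfl⟩ := (Submodule.mem_span_range_iff_exists_fun ℝ).1 hv
  -- The gradients of the basis are orthonormal, hence independent, which replaces Poincaré's
  -- inequality here.
  have hli := hψ.1.2.linearIndependent
  rw [Fintype.linearIndependent_iff] at hli
  have := hli c (by simpa [Prod.snd_sum] using h0)
  simp [this]

end Galerkin

end

noncomputable section

/-! ### Analytic continuation from derivative bounds -/

section Extension

/-- Derivative bounds of a function that is real analytic on `Γ`, with radius of convergence `1/γ` at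
every point and growth at most exponential at infinity. -/
structure HasAnalyticBound {V : Type*} [NormedAddCommGroup V] [NormedSpace ℝ V] (Γ : Set ℝ)
    (g : ℝ → V) (M α γ : ℝ) : Prop where
  contDiffOn : ContDiffOn ℝ ((⊤ : ℕ∞) : WithTop ℕ∞) g Γ
  norm_le : ∀ t ∈ Γ, ∀ j : ℕ, ‖iteratedDerivWithin j g Γ t‖ ≤
    M * Real.exp (α * |t|) * (γ ^ j * (j.factorial : ℝ))

variable {V W : Type*} [NormedAddCommGroup V] [NormedSpace ℝ V] [NormedAddCommGroup W]
  [NormedSpace ℝ W] {Γ : Set ℝ} {M α γ : ℝ}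

theorem HasAnalyticBound.norm_apply_le {g : ℝ → V} (h : HasAnalyticBound Γ g M α γ) {t : ℝ}
    (ht : t ∈ Γ) : ‖g t‖ ≤ M * Real.exp (α * |t|) := by
  simpa using h.norm_le t ht 0

theorem HasAnalyticBound.comp_clm {g : ℝ → V} (h : HasAnalyticBound Γ g M α γ)
    (hΓ : UniqueDiffOn ℝ Γ) (L : V →L[ℝ] W) :
    HasAnalyticBound Γ (fun t => L (g t)) (‖L‖ * M) α γ := by
  refine ⟨L.contDiff.comp_contDiffOn h.contDiffOn, fun t ht j => ?_⟩
  have h1 := L.norm_iteratedFDerivWithin_comp_left (f := g) (x := t) (N := ((⊤ : ℕ∞) : WithTop ℕ∞))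
    (n := j) (h.contDiffOn t ht) hΓ ht (by exact_mod_cast le_top)
  rw [norm_iteratedFDerivWithin_eq_norm_iteratedDerivWithin,
    norm_iteratedFDerivWithin_eq_norm_iteratedDerivWithin] at h1
  refine h1.trans ?_
  have := mul_le_mul_of_nonneg_left (h.norm_le t ht j) (norm_nonneg L)
  calc _ ≤ _ := this
    _ = _ := by ring

/-- Differentiating the Taylor polynomial with respect to its centre leaves a single term, to which
the mean value inequality applies. This treats both sides of the centre at once; the lost factor `n
+ 1` is harmless against a geometric decay. -/
theorem norm_sub_taylorWithinEval_le (hΓ : UniqueDiffOn ℝ Γ) {f : ℝ → V}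
    (hf : ContDiffOn ℝ ((⊤ : ℕ∞) : WithTop ℕ∞) f Γ) {a x C : ℝ} {n : ℕ} (hax : uIcc a x ⊆ Γ)
    (hC : ∀ t ∈ uIcc a x, ‖iteratedDerivWithin (n + 1) f Γ t‖ ≤ C * ((n + 1).factorial : ℝ)) :
    ‖f x - taylorWithinEval f n Γ a x‖ ≤ C * (n + 1) * |x - a| ^ (n + 1) := by
  have hd : ∀ t ∈ uIcc a x, HasDerivWithinAt (fun t => taylorWithinEval f n Γ t x)
      (((n.factorial : ℝ)⁻¹ * (x - t) ^ n) • iteratedDerivWithin (n + 1) f Γ t) (uIcc a x) t := by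
    intro t ht
    refine (hasDerivWithinAt_taylorWithinEval hΓ self_mem_nhdsWithin (hax ht) subset_rfl
      (hf.of_le (by exact_mod_cast le_top)) ?_).mono hax
    exact hf.differentiableOn_iteratedDerivWithin (by exact_mod_cast ENat.natCast_lt_top n) hΓ t (hax ht)
  have hb : ∀ t ∈ uIcc a x, ‖((n.factorial : ℝ)⁻¹ * (x - t) ^ n) •
      iteratedDerivWithin (n + 1) f Γ t‖ ≤ C * (n + 1) * |x - a| ^ n := by
    intro t ht
    have h1 : |x - t| ≤ |x - a| := abs_sub_right_of_mem_uIcc ht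
    have h2 := hC t ht
    have hn : (0 : ℝ) < n.factorial := by positivity
    rw [norm_smul, norm_mul, norm_inv, norm_pow, Real.norm_eq_abs, Real.norm_eq_abs, abs_of_pos hn]
    calc (n.factorial : ℝ)⁻¹ * |x - t| ^ n * ‖iteratedDerivWithin (n + 1) f Γ t‖
        ≤ (n.factorial : ℝ)⁻¹ * |x - a| ^ n * (C * ((n + 1).factorial : ℝ)) := by gcongr
      _ = C * (n + 1) * |x - a| ^ n := by
        rw [Nat.factorial_succ]; push_cast; field_simp
  have := (convex_uIcc a x).norm_image_sub_le_of_norm_hasDerivWithin_le hd hb left_mem_uIcc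
    right_mem_uIcc
  simp only [taylorWithinEval_self] at this
  rw [pow_succ, ← mul_assoc, ← Real.norm_eq_abs (x - a)]
  simpa using this

/-- The Taylor series of `g` at `x`, evaluated at a complex point. -/
def taylorSum (Γ : Set ℝ) (g : ℝ → ℂ) (x : ℝ) (z : ℂ) : ℂ :=
  ∑' j : ℕ, (((j.factorial : ℂ)⁻¹ * (z - x) ^ j) * iteratedDerivWithin j g Γ x)

variable {g : ℝ → ℂ} {τ : ℝ}

theorem HasAnalyticBound.norm_taylor_term_le (h : HasAnalyticBound Γ g M α γ) {x : ℝ} (hx : x ∈ Γ)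
    {z : ℂ} (hz : z ∈ Metric.ball (x : ℂ) τ) (j : ℕ) :
    ‖((j.factorial : ℂ)⁻¹ * (z - x) ^ j) * iteratedDerivWithin j g Γ x‖ ≤
      M * Real.exp (α * |x|) * (γ * τ) ^ j := by
  have h1 : ‖z - x‖ ≤ τ := (mem_ball_iff_norm.1 hz).le
  have hτ : 0 ≤ τ := (norm_nonneg _).trans h1
  have hn : (0 : ℝ) < j.factorial := by positivity
  rw [norm_mul, norm_mul, norm_inv, norm_pow, Complex.norm_natCast]
  calc (j.factorial : ℝ)⁻¹ * ‖z - x‖ ^ j * ‖iteratedDerivWithin j g Γ x‖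
      ≤ (j.factorial : ℝ)⁻¹ * τ ^ j * (M * Real.exp (α * |x|) * (γ ^ j * (j.factorial : ℝ))) := by
        gcongr
        exact h.norm_le x hx j
    _ = _ := by rw [mul_pow]; field_simp

theorem HasAnalyticBound.differentiableOn_taylorSum (h : HasAnalyticBound Γ g M α γ) {x : ℝ}
    (hx : x ∈ Γ) (h0 : 0 ≤ γ * τ) (h1 : γ * τ < 1) :
    DifferentiableOn ℂ (taylorSum Γ g x) (Metric.ball (x : ℂ) τ) := by
  refine Complex.differentiableOn_tsum_of_summable_norm
    (u := fun j => M * Real.exp (α * |x|) * (γ * τ) ^ j)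
    ((summable_geometric_of_lt_one h0 h1).mul_left _) (fun j => ?_) Metric.isOpen_ball
    (fun j z hz => h.norm_taylor_term_le hx hz j)
  fun_prop

theorem HasAnalyticBound.norm_taylorSum_le (h : HasAnalyticBound Γ g M α γ) {x : ℝ}
    (hx : x ∈ Γ) (h0 : 0 ≤ γ * τ) (h1 : γ * τ < 1) {z : ℂ} (hz : z ∈ Metric.ball (x : ℂ) τ) :
    ‖taylorSum Γ g x z‖ ≤ M * Real.exp (α * |x|) * (1 - γ * τ)⁻¹ :=
  tsum_of_norm_bounded ((hasSum_geometric_of_lt_one h0 h1).mul_left _)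
    (fun j => h.norm_taylor_term_le hx hz j)

/-- The Taylor remainder is at most a constant times (n + 1) q^(n + 1) with q = γ|t - x| < 1, and so
tends to zero. The constant is uniform because the whole segment from x to t lies in Γ. -/
theorem HasAnalyticBound.taylorSum_eq (h : HasAnalyticBound Γ g M α γ) (hM : 0 ≤ M) (hα : 0 ≤ α)
    (hγ : 0 ≤ γ) (hΓ : UniqueDiffOn ℝ Γ) (hΓ' : Γ.OrdConnected) {x t : ℝ}
    (hx : x ∈ Γ) (ht : t ∈ Γ) (h1 : γ * τ < 1) (hxt : |t - x| < τ) :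
    taylorSum Γ g x t = g t := by
  have hτ : 0 < τ := (abs_nonneg _).trans_lt hxt
  have h0 : 0 ≤ γ * τ := by positivity
  have hz : (t : ℂ) ∈ Metric.ball (x : ℂ) τ := by
    rw [mem_ball_iff_norm, ← Complex.ofReal_sub, Complex.norm_real]; exact hxt
  have hs : Summable fun j : ℕ =>
      (((j.factorial : ℂ)⁻¹ * ((t : ℂ) - x) ^ j) * iteratedDerivWithin j g Γ x) :=
    Summable.of_norm_bounded ((summable_geometric_of_lt_one h0 h1).mul_left _)
      (fun j => h.norm_taylor_term_le hx hz j)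
  have hlim := (hs.hasSum.tendsto_sum_nat).comp (Filter.tendsto_add_atTop_nat 1)
  refine tendsto_nhds_unique hlim ?_
  set q := γ * |t - x|
  have hq0 : 0 ≤ q := by positivity
  have hq : q < 1 := (mul_le_mul_of_nonneg_left hxt.le hγ).trans_lt h1
  have hseg := hΓ'.uIcc_subset hx ht
  have hbound : ∀ n : ℕ, ‖g t - taylorWithinEval g n Γ x t‖ ≤
      M * Real.exp (α * (|x| + |t|)) * (((n + 1 : ℕ) : ℝ) * q ^ (n + 1)) := by
    intro n
    have := norm_sub_taylorWithinEval_le hΓ h.contDiffOn (a := x) (x := t) (n := n)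
      (C := M * Real.exp (α * (|x| + |t|)) * γ ^ (n + 1)) hseg ?_
    · refine this.trans_eq ?_
      rw [mul_pow]; push_cast; ring
    · intro u hu
      have hu' : |u| ≤ |x| + |t| := by
        refine (abs_le_max_abs_abs hu.1 hu.2).trans (max_le ?_ ?_)
        · rcases min_choice x t with h | h <;> rw [h] <;> simp
        · rcases max_choice x t with h | h <;> rw [h] <;> simp
      refine (h.norm_le u (hseg hu) (n + 1)).trans ?_
      rw [← mul_assoc]
      gcongr
  have hz0 : Filter.Tendsto (fun n : ℕ => M * Real.exp (α * (|x| + |t|)) *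
      (((n + 1 : ℕ) : ℝ) * q ^ (n + 1))) Filter.atTop (nhds 0) := by
    have := ((tendsto_self_mul_const_pow_of_lt_one hq0 hq).comp
      (Filter.tendsto_add_atTop_nat 1)).const_mul (M * Real.exp (α * (|x| + |t|)))
    simpa using this
  have := squeeze_zero_norm hbound hz0
  have h2 := (tendsto_const_nhds (x := g t)).sub this
  simp only [sub_sub_cancel, sub_zero] at h2
  refine h2.congr fun n => ?_
  simp only [taylor_within_apply, Function.comp]
  refine Finset.sum_congr rfl fun k _ => ?_
  rw [Complex.real_smul]
  push_cast
  rfl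

/-- Identity theorem on the convex intersection of the two discs. If they meet, the midpoint of x
and y lies in both and in the interior of Γ, and near it both series equal g on the real axis. -/
theorem HasAnalyticBound.taylorSum_eqOn (h : HasAnalyticBound Γ g M α γ) (hM : 0 ≤ M)
    (hα : 0 ≤ α) (hγ : 0 ≤ γ) (hΓ : UniqueDiffOn ℝ Γ) (hΓ' : Γ.OrdConnected) (hτ : 0 < τ)
    (h1 : γ * τ < 1) {x y : ℝ} (hx : x ∈ Γ) (hy : y ∈ Γ) :
    EqOn (taylorSum Γ g x) (taylorSum Γ g y) (Metric.ball (x : ℂ) τ ∩ Metric.ball (y : ℂ) τ) := by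
  have h0 : 0 ≤ γ * τ := by positivity
  rcases eq_or_ne x y with rfl | hxy
  · exact fun _ _ => rfl
  intro z hz
  have hlt : |x - y| < 2 * τ := by
    have h2 := dist_triangle_left (x : ℂ) y z
    rw [dist_eq_norm (x : ℂ) y, ← Complex.ofReal_sub, Complex.norm_real, Real.norm_eq_abs] at h2
    have := Metric.mem_ball.1 hz.1
    have := Metric.mem_ball.1 hz.2
    linarith
  set m := (x + y) / 2
  have hmx : |m - x| < τ := by
    rw [show m - x = -((x - y) / 2) by simp only [m]; ring, abs_neg, abs_div, abs_two]; linarith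
  have hmy : |m - y| < τ := by
    rw [show m - y = (x - y) / 2 by simp only [m]; ring, abs_div, abs_two]; linarith
  have hopen : IsOpen (Metric.ball (x : ℂ) τ ∩ Metric.ball (y : ℂ) τ) :=
    Metric.isOpen_ball.inter Metric.isOpen_ball
  have hmem : ∀ t : ℝ, |t - x| < τ → |t - y| < τ →
      (t : ℂ) ∈ Metric.ball (x : ℂ) τ ∩ Metric.ball (y : ℂ) τ := fun t h1 h2 => by
    constructor <;> rw [mem_ball_iff_norm, ← Complex.ofReal_sub, Complex.norm_real] <;> assumption
  refine AnalyticOnNhd.eqOn_of_preconnected_of_frequently_eq (z₀ := (m : ℂ))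
    (((h.differentiableOn_taylorSum hx h0 h1).mono inter_subset_left).analyticOnNhd hopen)
    (((h.differentiableOn_taylorSum hy h0 h1).mono inter_subset_right).analyticOnNhd hopen)
    ((convex_ball _ _).inter (convex_ball _ _)).isPreconnected (hmem m hmx hmy) ?_ hz
  have htend : Filter.Tendsto (fun t : ℝ => (t : ℂ)) (nhdsWithin m {m}ᶜ)
      (nhdsWithin (m : ℂ) {(m : ℂ)}ᶜ) := by
    refine Complex.continuous_ofReal.continuousWithinAt.tendsto_nhdsWithin fun t ht => ?_
    simpa using ht
  refine htend.frequently (Filter.Eventually.frequently (Filter.Eventually.filter_mono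
    nhdsWithin_le_nhds ?_))
  have e1 : ∀ᶠ t in nhds m, |t - x| < τ :=
    (by fun_prop : Continuous fun t : ℝ => |t - x|).continuousAt.eventually_lt
      continuousAt_const hmx
  have e2 : ∀ᶠ t in nhds m, |t - y| < τ :=
    (by fun_prop : Continuous fun t : ℝ => |t - y|).continuousAt.eventually_lt
      continuousAt_const hmy
  have e3 : ∀ᶠ t in nhds m, t ∈ Γ := by
    refine Filter.mem_of_superset ?_ (hΓ'.uIcc_subset hx hy)
    rcases lt_or_gt_of_ne hxy with hl | hl
    · rw [uIcc_of_le hl.le]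
      exact Icc_mem_nhds (by simp only [m]; linarith) (by simp only [m]; linarith)
    · rw [uIcc_of_ge hl.le]
      exact Icc_mem_nhds (by simp only [m]; linarith) (by simp only [m]; linarith)
  filter_upwards [e1, e2, e3] with t h2 h3 h4
  rw [h.taylorSum_eq hM hα hγ hΓ hΓ' hx h4 h1 h2, h.taylorSum_eq hM hα hγ hΓ hΓ' hy h4 h1 h3]

/-- Analytic continuation to the `τ`-neighbourhood of `Γ`. -/
theorem HasAnalyticBound.exists_extension (h : HasAnalyticBound Γ g M α γ) (hM : 0 ≤ M)
    (hα : 0 ≤ α) (hγ : 0 ≤ γ) (hΓ : UniqueDiffOn ℝ Γ) (hΓ' : Γ.OrdConnected) (hτ : 0 < τ)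
    (h1 : γ * τ < 1) :
    ∃ G : ℂ → ℂ, (∀ t ∈ Γ, G t = g t) ∧ ∀ x ∈ Γ,
      DifferentiableOn ℂ G (Metric.ball (x : ℂ) τ) ∧
      ∀ z ∈ Metric.ball (x : ℂ) τ, ‖G z‖ ≤ M * Real.exp (α * |x|) * (1 - γ * τ)⁻¹ := by
  classical
  have h0 : 0 ≤ γ * τ := by positivity
  -- An arbitrary admissible centre is chosen at each point; agreement on overlaps makes the choice
  -- immaterial.
  let G : ℂ → ℂ := fun z =>
    if hz : ∃ x ∈ Γ, z ∈ Metric.ball (x : ℂ) τ then taylorSum Γ g hz.choose z else 0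
  have hG : ∀ x ∈ Γ, EqOn G (taylorSum Γ g x) (Metric.ball (x : ℂ) τ) := by
    intro x hx z hz
    have hex : ∃ x ∈ Γ, z ∈ Metric.ball (x : ℂ) τ := ⟨x, hx, hz⟩
    simp only [G, dif_pos hex]
    exact h.taylorSum_eqOn hM hα hγ hΓ hΓ' hτ h1 hex.choose_spec.1 hx ⟨hex.choose_spec.2, hz⟩
  refine ⟨G, fun t ht => ?_, fun x hx => ⟨?_, fun z hz => ?_⟩⟩
  · rw [hG t ht (Metric.mem_ball_self hτ)]
    exact h.taylorSum_eq hM hα hγ hΓ hΓ' ht ht h1 (by simpa using hτ)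
  · exact (h.differentiableOn_taylorSum hx h0 h1).congr (hG x hx)
  · rw [hG x hx hz]
    exact h.norm_taylorSum_le hx h0 h1 hz

end Extension

end

noncomputable section

/-! ### Chebyshev coefficients of a scalar function analytic in an ellipse -/

section ChebyshevScalar

/-- The Joukowski parametrisation of the confocal ellipses with foci `c ± h`. -/
def joukowski (c h : ℝ) (w : ℂ) : ℂ := c + h * ((w + w⁻¹) / 2)

theorem joukowski_exp (c h θ : ℝ) :
    joukowski c h (Complex.exp (θ * Complex.I)) = ((c + h * Real.cos θ : ℝ) : ℂ) := by
  rw [joukowski, ← Complex.exp_neg, Complex.ofReal_add, Complex.ofReal_mul, Complex.ofReal_cos,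
    Complex.cos, neg_mul]

theorem differentiableAt_joukowski (c h : ℝ) {w : ℂ} (hw : w ≠ 0) :
    DifferentiableAt ℂ (joukowski c h) w := by
  unfold joukowski
  fun_prop (disch := assumption)

variable {G : ℂ → ℂ} {c h ϱ M : ℝ}

theorem continuous_comp_cos (hϱ : 1 < ϱ)
    (hd : ∀ w : ℂ, 1 ≤ ‖w‖ → ‖w‖ ≤ ϱ → DifferentiableAt ℂ G (joukowski c h w)) :
    Continuous fun θ : ℝ => G ((c + h * Real.cos θ : ℝ) : ℂ) := by
  refine continuous_iff_continuousAt.2 fun θ => ?_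
  have h1 : ‖Complex.exp (θ * Complex.I)‖ = 1 := Complex.norm_exp_ofReal_mul_I θ
  have := hd (Complex.exp (θ * Complex.I)) h1.ge (h1.le.trans hϱ.le)
  rw [joukowski_exp] at this
  exact ContinuousAt.comp (f := fun θ : ℝ => ((c + h * Real.cos θ : ℝ) : ℂ)) this.continuousAt
    (by fun_prop)

/-- The `k`-th cosine coefficient of `θ ↦ G (c + h cos θ)`. -/
def cosCoeff (G : ℂ → ℂ) (c h : ℝ) (k : ℤ) : ℂ :=
  (1 / Real.pi : ℝ) • ∫ θ in (0 : ℝ)..Real.pi,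
    (Real.cos (k * θ) : ℂ) * G ((c + h * Real.cos θ : ℝ) : ℂ)

/-- The reflection θ ↦ 2π - θ folds the second half period onto the first and turns the exponential
into twice a cosine. Cosine coefficients thereby become Fourier coefficients and integrals over the
unit circle. -/
theorem integral_exp_mul_eq (hϱ : 1 < ϱ)
    (hd : ∀ w : ℂ, 1 ≤ ‖w‖ → ‖w‖ ≤ ϱ → DifferentiableAt ℂ G (joukowski c h w)) (k : ℤ) :
    ∫ θ in (0 : ℝ)..2 * Real.pi,
      Complex.exp (-(k * θ * Complex.I)) * G ((c + h * Real.cos θ : ℝ) : ℂ) =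
    (2 * Real.pi : ℝ) • cosCoeff G c h k := by
  have hc := continuous_comp_cos hϱ hd
  have hc2 : Continuous fun θ : ℝ =>
      Complex.exp (-(k * θ * Complex.I)) * G ((c + h * Real.cos θ : ℝ) : ℂ) :=
    (by fun_prop : Continuous fun θ : ℝ => Complex.exp (-(k * θ * Complex.I))).mul hc
  have hc3 : Continuous fun θ : ℝ =>
      Complex.exp (k * θ * Complex.I) * G ((c + h * Real.cos θ : ℝ) : ℂ) :=
    (by fun_prop : Continuous fun θ : ℝ => Complex.exp (k * θ * Complex.I)).mul hc
  rw [← intervalIntegral.integral_add_adjacent_intervals (b := Real.pi)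
    (hc2.intervalIntegrable _ _) (hc2.intervalIntegrable _ _)]
  have e : ∫ θ in Real.pi..2 * Real.pi,
      Complex.exp (-(k * θ * Complex.I)) * G ((c + h * Real.cos θ : ℝ) : ℂ) =
      ∫ θ in (0 : ℝ)..Real.pi,
        Complex.exp (k * θ * Complex.I) * G ((c + h * Real.cos θ : ℝ) : ℂ) := by
    have := intervalIntegral.integral_comp_sub_left (a := 0) (b := Real.pi) (fun θ : ℝ =>
      Complex.exp (-(k * θ * Complex.I)) * G ((c + h * Real.cos θ : ℝ) : ℂ)) (2 * Real.pi)
    rw [show 2 * Real.pi - Real.pi = Real.pi by ring, sub_zero] at this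
    rw [← this]
    refine intervalIntegral.integral_congr fun θ _ => ?_
    simp only [Real.cos_two_pi_sub]
    congr 1
    have : -(k * ((2 * Real.pi - θ : ℝ) : ℂ) * Complex.I) =
        k * θ * Complex.I - k * (2 * Real.pi * Complex.I) := by push_cast; ring
    rw [this, Complex.exp_sub, Complex.exp_int_mul_two_pi_mul_I, div_one]
  rw [e, ← intervalIntegral.integral_add (hc2.intervalIntegrable _ _) (hc3.intervalIntegrable _ _),
    cosCoeff, smul_smul, show 2 * Real.pi * (1 / Real.pi) = 2 by field_simp,
    ← intervalIntegral.integral_smul]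
  refine intervalIntegral.integral_congr fun θ _ => ?_
  simp only [Complex.ofReal_cos, Complex.cos, Complex.real_smul]
  push_cast
  rw [neg_mul]
  ring

theorem cosCoeff_neg (k : ℤ) : cosCoeff G c h (-k) = cosCoeff G c h k := by
  simp [cosCoeff]

/-- The cosine coefficient is a Laurent coefficient of G composed with the Joukowski map. Moving the
contour from radius 1 to radius ϱ gains the factor ϱ^(-k). -/
theorem norm_cosCoeff_le (hϱ : 1 < ϱ)
    (hd : ∀ w : ℂ, 1 ≤ ‖w‖ → ‖w‖ ≤ ϱ → DifferentiableAt ℂ G (joukowski c h w))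
    (hb : ∀ w : ℂ, 1 ≤ ‖w‖ → ‖w‖ ≤ ϱ → ‖G (joukowski c h w)‖ ≤ M) (k : ℕ) :
    ‖cosCoeff G c h k‖ ≤ M * (ϱ⁻¹) ^ k := by
  have hϱ0 : 0 < ϱ := one_pos.trans hϱ
  set f : ℂ → ℂ := fun z => (z ^ k)⁻¹ * G (joukowski c h z) with hf
  have hdiff : ∀ z : ℂ, 1 ≤ ‖z‖ → ‖z‖ ≤ ϱ → DifferentiableAt ℂ f z := by
    intro z h1 h2
    have hz : z ≠ 0 := norm_pos_iff.1 (one_pos.trans_le h1)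
    refine ((differentiableAt_id.pow k).inv (pow_ne_zero _ hz)).mul ?_
    exact (hd z h1 h2).comp z (differentiableAt_joukowski c h hz)
  have key := Complex.circleIntegral_sub_center_inv_smul_eq_of_differentiable_on_annulus_off_countable
    (c := 0) (r := 1) (R := ϱ) one_pos hϱ.le (f := f) countable_empty
    (fun z hz => (hdiff z (by simpa using hz.2) (by simpa using hz.1)).continuousAt.continuousWithinAt)
    (fun z hz => hdiff z (by have := hz.1.2; simp at this; exact this.le)
      (by have := hz.1.1; simp at this; exact this.le))
  have hR : ‖∮ z in C(0, ϱ), (z - 0)⁻¹ • f z‖ ≤ 2 * Real.pi * ϱ * (ϱ⁻¹ * ((ϱ⁻¹) ^ k * M)) := by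
    refine circleIntegral.norm_integral_le_of_norm_le_const hϱ0.le fun z hz => ?_
    have hz' : ‖z‖ = ϱ := by simpa using hz
    rw [norm_smul, norm_inv, sub_zero, hz', hf]
    simp only [norm_mul, norm_inv, norm_pow, hz', inv_pow]
    gcongr
    exact hb z (hz'.symm ▸ hϱ.le) hz'.le
  rw [key, circleIntegral] at hR
  have e : ∫ θ in (0 : ℝ)..2 * Real.pi, deriv (circleMap 0 1) θ •
      ((circleMap 0 1 θ - 0)⁻¹ • f (circleMap 0 1 θ)) =
      Complex.I * ∫ θ in (0 : ℝ)..2 * Real.pi,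
      Complex.exp (-(((k : ℤ) : ℂ) * θ * Complex.I)) * G ((c + h * Real.cos θ : ℝ) : ℂ) := by
    rw [← intervalIntegral.integral_const_mul]
    refine intervalIntegral.integral_congr fun θ _ => ?_
    have hz : circleMap 0 1 θ = Complex.exp (θ * Complex.I) := by simp [circleMap]
    have hne : Complex.exp (θ * Complex.I) ≠ 0 := Complex.exp_ne_zero _
    simp only [deriv_circleMap, sub_zero, hz, hf, smul_eq_mul, joukowski_exp, ← Complex.exp_nat_mul,
      ← Complex.exp_neg]
    rw [show -((k : ℂ) * (θ * Complex.I)) = -(((k : ℤ) : ℂ) * θ * Complex.I) by push_cast; ring,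
      Complex.exp_neg (θ * Complex.I)]
    field_simp
  rw [e, integral_exp_mul_eq hϱ hd, norm_mul, Complex.norm_I, one_mul, norm_smul,
    Real.norm_of_nonneg Real.two_pi_pos.le] at hR
  have : 2 * Real.pi * ϱ * (ϱ⁻¹ * ((ϱ⁻¹) ^ k * M)) = 2 * Real.pi * (M * (ϱ⁻¹) ^ k) := by
    field_simp
  rw [this] at hR
  exact le_of_mul_le_mul_left hR Real.two_pi_pos

/-- Geometric decay makes the Fourier coefficients of θ ↦ G(c + h cos θ) summable, so the Fourier
series converges pointwise to this continuous function. Pairing k with -k produces the factor 2 for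
k ≠ 0. -/
theorem hasSum_cosCoeff (hϱ : 1 < ϱ)
    (hd : ∀ w : ℂ, 1 ≤ ‖w‖ → ‖w‖ ≤ ϱ → DifferentiableAt ℂ G (joukowski c h w))
    (hb : ∀ w : ℂ, 1 ≤ ‖w‖ → ‖w‖ ≤ ϱ → ‖G (joukowski c h w)‖ ≤ M) (θ : ℝ) :
    HasSum (fun k : ℕ => (if k = 0 then 1 else 2) * (Real.cos (k * θ) : ℂ) * cosCoeff G c h k)
      (G ((c + h * Real.cos θ : ℝ) : ℂ)) := by
  have : Fact (0 < 2 * Real.pi) := ⟨Real.two_pi_pos⟩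
  have hϱ0 : 0 < ϱ := one_pos.trans hϱ
  have hf1 : ∀ (n : ℤ) (θ : ℝ), (fourier n (θ : AddCircle (2 * Real.pi)) : ℂ) =
      Complex.exp (n * θ * Complex.I) := by
    intro n θ
    rw [fourier_coe_apply]
    congr 1
    have : (Real.pi : ℂ) ≠ 0 := by exact_mod_cast Real.pi_ne_zero
    push_cast
    field_simp
  let F : C(AddCircle (2 * Real.pi), ℂ) := ⟨fun x => G (joukowski c h (fourier 1 x)), by
    refine continuous_iff_continuousAt.2 fun x => ?_
    have h1 : ‖(fourier 1 x : ℂ)‖ = 1 := Circle.norm_coe _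
    refine ContinuousAt.comp (f := fun x => joukowski c h (fourier 1 x))
      (hd _ h1.ge (h1.le.trans hϱ.le)).continuousAt ?_
    refine ContinuousAt.comp (f := fun x => (fourier 1 x : ℂ))
      (differentiableAt_joukowski c h ?_).continuousAt (ContinuousMap.continuous _).continuousAt
    exact norm_pos_iff.1 (h1 ▸ one_pos)⟩
  have hF : ∀ θ : ℝ, F (θ : AddCircle (2 * Real.pi)) = G ((c + h * Real.cos θ : ℝ) : ℂ) := by
    intro θ
    simp only [F, ContinuousMap.coe_mk, hf1, Int.cast_one, one_mul, joukowski_exp]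
  have hcoef : ∀ n : ℤ, fourierCoeff F n = cosCoeff G c h n := by
    intro n
    rw [fourierCoeff_eq_intervalIntegral F n 0, zero_add]
    have : ∫ x in (0 : ℝ)..2 * Real.pi, (fourier (-n) (x : AddCircle (2 * Real.pi)) : ℂ) • F x =
        (2 * Real.pi : ℝ) • cosCoeff G c h n := by
      rw [← integral_exp_mul_eq hϱ hd]
      refine intervalIntegral.integral_congr fun θ _ => ?_
      simp only [hf1, hF, smul_eq_mul]
      congr 2
      push_cast
      ring
    rw [this, smul_smul, one_div, inv_mul_cancel₀ Real.two_pi_pos.ne', one_smul]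
  have hsN : Summable fun k : ℕ => cosCoeff G c h k :=
    Summable.of_norm_bounded ((summable_geometric_of_lt_one (inv_nonneg.2 hϱ0.le)
      (inv_lt_one_of_one_lt₀ hϱ)).mul_left M) (norm_cosCoeff_le hϱ hd hb)
  have hs : Summable (fourierCoeff F) := by
    rw [show fourierCoeff F = fun n => cosCoeff G c h n from funext hcoef]
    exact Summable.of_nat_of_neg hsN (by simpa [cosCoeff_neg] using hsN)
  have h1 := (has_pointwise_sum_fourier_series_of_summable hs (θ : AddCircle (2 * Real.pi)))
  simp only [hcoef, hF, smul_eq_mul] at h1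
  have h2 := h1.nat_add_neg
  -- Pairing n with -n has counted the index zero twice; one copy is removed.
  have h3 := h2.sub (hasSum_ite_eq (0 : ℕ)
    (cosCoeff G c h 0 * (fourier 0 (θ : AddCircle (2 * Real.pi)) : ℂ)))
  simp only [add_sub_cancel_right] at h3
  refine h3.congr_fun ?_
  intro k
  rcases eq_or_ne k 0 with rfl | hk
  · simp
  · simp only [hk, if_false, sub_zero, cosCoeff_neg, hf1, Complex.ofReal_cos, Complex.cos]
    push_cast
    rw [show -(k : ℂ) * θ * Complex.I = -((k : ℂ) * θ) * Complex.I by ring]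
    ring

end ChebyshevScalar

end

noncomputable section

/-! ### Chebyshev expansion of vector-valued functions -/

section ChebyshevVector

/-- Points of the confocal ellipse of parameter `ϱ` are within `h (ϱ - ϱ⁻¹) / 2` of the focal
segment. -/
theorem exists_dist_joukowski_le {c h ϱ : ℝ} (hh : 0 < h) {w : ℂ} (h1 : 1 ≤ ‖w‖)
    (h2 : ‖w‖ ≤ ϱ) :
    ∃ x ∈ Icc (c - h) (c + h), ‖joukowski c h w - x‖ ≤ h * (ϱ - ϱ⁻¹) / 2 := by
  have hw : 0 < ‖w‖ := one_pos.trans_le h1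
  set r := ‖w‖
  set u : ℂ := w / r with hu
  have hr : (r : ℂ) ≠ 0 := by exact_mod_cast hw.ne'
  have hun : ‖u‖ = 1 := by
    rw [hu, norm_div, Complex.norm_real, Real.norm_of_nonneg hw.le]
    exact div_self hw.ne'
  have hwu : w = r * u := by rw [hu]; field_simp
  have hui : u⁻¹ = (starRingEnd ℂ) u := Complex.inv_eq_conj hun
  have hre : |u.re| ≤ 1 := hun ▸ Complex.abs_re_le_norm u
  rw [abs_le] at hre
  -- The witness is the image of u = w/|w|, the point of the degenerate ellipse with the same angle
  -- as w.
  refine ⟨c + h * u.re, ⟨by nlinarith, by nlinarith⟩, ?_⟩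
  have e : joukowski c h w - ((c + h * u.re : ℝ) : ℂ) =
      (h / 2 : ℝ) * ((r - 1 : ℝ) * u - (1 - r⁻¹ : ℝ) * u⁻¹) := by
    have hre2 : ((u.re : ℝ) : ℂ) = (u + u⁻¹) / 2 := by rw [hui, Complex.re_eq_add_conj]
    rw [joukowski, hwu, mul_inv]
    push_cast
    rw [hre2]
    ring
  rw [e, norm_mul, Complex.norm_real, Real.norm_of_nonneg (by positivity)]
  have hri : r⁻¹ ≤ 1 := inv_le_one_of_one_le₀ h1
  have hri' : ϱ⁻¹ ≤ r⁻¹ := inv_anti₀ hw h2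
  have : ‖((r - 1 : ℝ) : ℂ) * u - ((1 - r⁻¹ : ℝ) : ℂ) * u⁻¹‖ ≤ (r - 1) + (1 - r⁻¹) := by
    refine (norm_sub_le _ _).trans_eq ?_
    rw [norm_mul, norm_mul, norm_inv, hun, Complex.norm_real, Complex.norm_real,
      Real.norm_of_nonneg (by linarith), Real.norm_of_nonneg (by linarith)]
    ring
  calc h / 2 * _ ≤ h / 2 * (ϱ - ϱ⁻¹) := by gcongr; linarith
    _ = _ := by ring

/-- The modulus is exp(η(Im² - Re²)), with Im² ≤ τ² and Re² ≥ x²/2 - τ². Thus the Gaussian factor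
still decays in a complex neighbourhood of the axis and can offset the growth exp(α|x|). -/
theorem norm_exp_neg_mul_sq_le {η τ x : ℝ} (hη : 0 ≤ η) {z : ℂ} (hz : ‖z - x‖ ≤ τ) :
    ‖Complex.exp (-(η * z ^ 2))‖ ≤ Real.exp (2 * η * τ ^ 2 - η * x ^ 2 / 2) := by
  rw [Complex.norm_exp, Real.exp_le_exp]
  have h1 : |z.re - x| ≤ τ := by
    simpa using (Complex.abs_re_le_norm (z - x)).trans hz
  have h2 : |z.im| ≤ τ := by
    simpa using (Complex.abs_im_le_norm (z - x)).trans hz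
  have h3 : (z.re - x) ^ 2 ≤ τ ^ 2 := sq_le_sq' (by linarith [neg_le_of_abs_le h1]) (le_of_abs_le h1)
  have h4 : z.im ^ 2 ≤ τ ^ 2 := sq_le_sq' (by linarith [neg_le_of_abs_le h2]) (le_of_abs_le h2)
  have e : (-(η * z ^ 2) : ℂ).re = η * (z.im ^ 2 - z.re ^ 2) := by
    simp [sq]
    ring
  rw [e]
  have h5 : z.im ^ 2 - z.re ^ 2 ≤ 2 * τ ^ 2 - x ^ 2 / 2 := by nlinarith [sq_nonneg (2 * z.re - x)]
  calc _ ≤ η * (2 * τ ^ 2 - x ^ 2 / 2) := by gcongr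
    _ = _ := by ring

variable {V : Type*} [NormedAddCommGroup V] [NormedSpace ℝ V] [CompleteSpace V]
  {Γ : Set ℝ} {M α γ : ℝ}

/-- Chebyshev expansion of an analytic function multiplied by a Gaussian. -/
theorem HasAnalyticBound.exists_chebyshev_expansion {g : ℝ → V} (hg : HasAnalyticBound Γ g M α γ)
    (hM : 0 ≤ M) (hα : 0 ≤ α) (hγ : 0 ≤ γ) (hΓ : UniqueDiffOn ℝ Γ) (hΓ' : Γ.OrdConnected)
    {η τ τ' c h ϱ K : ℝ} (hη : 0 ≤ η) (hτ : 0 < τ) (hττ' : τ < τ') (h1 : γ * τ' < 1)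
    (hh : 0 < h) (hsub : Ioo (c - h) (c + h) ⊆ Γ) (hϱ : 1 < ϱ) (hϱτ : h * (ϱ - ϱ⁻¹) / 2 ≤ τ)
    (hK : ∀ x : ℝ, Real.exp (α * |x|) * (1 - γ * τ')⁻¹ *
      Real.exp (2 * η * τ' ^ 2 - η * x ^ 2 / 2) ≤ K) :
    ∃ a : ℕ → V, (∀ k, ‖a k‖ ≤ 2 * M * K * (ϱ⁻¹) ^ k) ∧
      ∀ t ∈ Γ, |t - c| ≤ h →
        HasSum (fun k : ℕ => ((Polynomial.Chebyshev.T ℝ k).eval ((t - c) / h)) • a k)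
          (Real.exp (-(η * t ^ 2)) • g t) := by
  have hϱ0 : 0 < ϱ := one_pos.trans hϱ
  have hτ' : 0 < τ' := hτ.trans hττ'
  have hK0 : 0 ≤ K := le_trans (by have : 0 < 1 - γ * τ' := by linarith
                                   positivity) (hK 0)
  let t : ℝ → ℝ := fun θ => c + h * Real.cos θ
  have htΓ : ∀ θ ∈ Ioo 0 Real.pi, t θ ∈ Γ := by
    intro θ hθ
    have h1 : Real.cos θ < 1 := by
      simpa using Real.cos_lt_cos_of_nonneg_of_le_pi le_rfl hθ.2.le hθ.1
    have h2 : -1 < Real.cos θ := by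
      simpa using Real.cos_lt_cos_of_nonneg_of_le_pi hθ.1.le le_rfl hθ.2
    exact hsub ⟨by simp only [t]; nlinarith, by simp only [t]; nlinarith⟩
  let I : ℕ → ℝ → V := fun k θ =>
    (Real.cos (k * θ) * Real.exp (-(η * t θ ^ 2))) • g (t θ)
  -- Open angles keep away from the endpoints c ± h, which need not belong to Γ.
  have hI : ∀ k, IntegrableOn (I k) (Ioo 0 Real.pi) := by
    intro k
    have hcont : ContinuousOn (I k) (Ioo 0 Real.pi) := by
      refine ContinuousOn.smul (by fun_prop) ?_
      exact hg.contDiffOn.continuousOn.comp (by fun_prop) htΓ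
    refine IntegrableOn.of_bound (by simp) (hcont.aestronglyMeasurable measurableSet_Ioo)
      (M * Real.exp (α * (|c| + h))) ?_
    refine (ae_restrict_iff' measurableSet_Ioo).2 (.of_forall fun θ hθ => ?_)
    simp only [I, norm_smul, norm_mul, Real.norm_eq_abs, Real.abs_exp]
    have e1 := Real.abs_cos_le_one (k * θ)
    have e2 : Real.exp (-(η * t θ ^ 2)) ≤ 1 := Real.exp_le_one_iff.2 (by
      have := mul_nonneg hη (sq_nonneg (t θ)); linarith)
    have e3 : |t θ| ≤ |c| + h := by
      refine (abs_add_le _ _).trans ?_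
      rw [abs_mul, abs_of_pos hh]
      have := mul_le_mul_of_nonneg_left (Real.abs_cos_le_one θ) hh.le
      linarith
    calc |Real.cos (k * θ)| * Real.exp (-(η * t θ ^ 2)) * ‖g (t θ)‖
        ≤ 1 * 1 * (M * Real.exp (α * |t θ|)) := by
          gcongr
          exact hg.norm_apply_le (htΓ θ hθ)
      _ ≤ _ := by rw [one_mul, one_mul]; gcongr
  let a : ℕ → V := fun k => ((if k = 0 then 1 else 2) * (1 / Real.pi) : ℝ) •
    ∫ θ in Ioo 0 Real.pi, I k θ
  -- Complex analysis is applied only to the scalar functions φ ∘ g, which avoids complexifying V.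
  -- Bounds linear in ‖φ‖ return to V by duality, and functionals separate points for the value of
  -- the sum.
  have main : ∀ φ : StrongDual ℝ V, ∃ G : ℂ → ℂ,
      (∀ x ∈ Γ, G x = ((Real.exp (-(η * x ^ 2)) * φ (g x) : ℝ) : ℂ)) ∧
      (∀ w : ℂ, 1 ≤ ‖w‖ → ‖w‖ ≤ ϱ → DifferentiableAt ℂ G (joukowski c h w)) ∧
      (∀ w : ℂ, 1 ≤ ‖w‖ → ‖w‖ ≤ ϱ → ‖G (joukowski c h w)‖ ≤ ‖φ‖ * M * K) ∧
      ∀ k : ℕ, ((φ (a k) : ℝ) : ℂ) = (if k = 0 then 1 else 2) * cosCoeff G c h k := by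
    intro φ
    have hL : ‖Complex.ofRealCLM.comp φ‖ ≤ ‖φ‖ := by
      refine (ContinuousLinearMap.opNorm_comp_le _ _).trans ?_
      rw [Complex.ofRealCLM_norm, one_mul]
    obtain ⟨G0, hG0, hG0'⟩ := (hg.comp_clm hΓ (Complex.ofRealCLM.comp φ)).exists_extension
      (by positivity) hα hγ hΓ hΓ' hτ' h1
    let G : ℂ → ℂ := fun z => Complex.exp (-(η * z ^ 2)) * G0 z
    have hGΓ : ∀ x ∈ Γ, G x = ((Real.exp (-(η * x ^ 2)) * φ (g x) : ℝ) : ℂ) := by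
      intro x hx
      simp only [G, hG0 x hx]
      push_cast
      rfl
    have hnear : ∀ w : ℂ, 1 ≤ ‖w‖ → ‖w‖ ≤ ϱ → ∃ x ∈ Γ,
        joukowski c h w ∈ Metric.ball (x : ℂ) τ' := by
      intro w hw1 hw2
      obtain ⟨x0, hx0, hd⟩ := exists_dist_joukowski_le (c := c) hh hw1 hw2
      -- The nearest focal point may be an endpoint outside Γ; moving it inwards by less than τ' - τ
      -- is why the neighbourhood was taken larger than τ.
      rw [← closure_Ioo (by linarith : c - h ≠ c + h)] at hx0
      obtain ⟨x, hx, hxx⟩ := Metric.mem_closure_iff.1 hx0 (τ' - τ) (by linarith)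
      refine ⟨x, hsub hx, ?_⟩
      rw [Metric.mem_ball]
      have h3 := dist_triangle (joukowski c h w) (x0 : ℂ) x
      rw [dist_eq_norm (joukowski c h w) (x0 : ℂ), Complex.isometry_ofReal.dist_eq] at h3
      linarith
    refine ⟨G, hGΓ, fun w hw1 hw2 => ?_, fun w hw1 hw2 => ?_, fun k => ?_⟩
    · obtain ⟨x, hx, hw⟩ := hnear w hw1 hw2
      refine DifferentiableAt.mul (by fun_prop) ?_
      exact (hG0' x hx).1.differentiableAt (Metric.isOpen_ball.mem_nhds hw)
    · obtain ⟨x, hx, hw⟩ := hnear w hw1 hw2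
      have e1 := (hG0' x hx).2 _ hw
      have e2 := norm_exp_neg_mul_sq_le (τ := τ') hη (mem_ball_iff_norm.1 hw).le
      have h1' : 0 < 1 - γ * τ' := by linarith
      rw [norm_mul]
      calc _ ≤ Real.exp (2 * η * τ' ^ 2 - η * x ^ 2 / 2) *
            (‖φ‖ * M * Real.exp (α * |x|) * (1 - γ * τ')⁻¹) := by
            refine mul_le_mul e2 (e1.trans ?_) (norm_nonneg _) (Real.exp_pos _).le
            gcongr
        _ = ‖φ‖ * M * (Real.exp (α * |x|) * (1 - γ * τ')⁻¹ *
            Real.exp (2 * η * τ' ^ 2 - η * x ^ 2 / 2)) := by ring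
        _ ≤ _ := by gcongr; exact hK x
    · simp only [a, map_smul]
      rw [← ContinuousLinearMap.integral_comp_comm _ (hI k), cosCoeff,
        intervalIntegral.integral_of_le Real.pi_pos.le, integral_Ioc_eq_integral_Ioo]
      have : ∫ θ in Ioo 0 Real.pi, (Real.cos ((k : ℤ) * θ) : ℂ) * G ((c + h * Real.cos θ : ℝ) : ℂ) =
          ((∫ θ in Ioo 0 Real.pi, φ (I k θ) : ℝ) : ℂ) := by
        rw [← integral_complex_ofReal]
        refine setIntegral_congr_fun measurableSet_Ioo fun θ hθ => ?_
        have e := hGΓ _ (htΓ θ hθ)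
        simp only [t] at e
        simp only [e, I, t, map_smul, smul_eq_mul]
        push_cast
        ring
      rw [this, Complex.real_smul, smul_eq_mul]
      push_cast
      rcases eq_or_ne k 0 with rfl | hk
      · simp
      · simp [hk]; ring
  have ha : ∀ k, ‖a k‖ ≤ 2 * M * K * (ϱ⁻¹) ^ k := by
    intro k
    refine NormedSpace.norm_le_dual_bound ℝ (a k) (by positivity) fun φ => ?_
    obtain ⟨G, -, hd, hb, hk⟩ := main φ
    have e := norm_cosCoeff_le hϱ hd hb k
    rw [← Complex.norm_real, hk, norm_mul]
    have : ‖(if k = 0 then 1 else 2 : ℂ)‖ ≤ 2 := by split_ifs <;> simp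
    calc _ ≤ 2 * (‖φ‖ * M * K * (ϱ⁻¹) ^ k) := by gcongr
      _ = _ := by ring
  refine ⟨a, ha, fun s hs hsc => ?_⟩
  have hx : |(s - c) / h| ≤ 1 := by rwa [abs_div, abs_of_pos hh, div_le_one hh]
  obtain ⟨hx1, hx2⟩ := abs_le.1 hx
  set θ := Real.arccos ((s - c) / h)
  have hθ : Real.cos θ = (s - c) / h := Real.cos_arccos hx1 hx2
  have hsθ : c + h * Real.cos θ = s := by rw [hθ]; field_simp; ring
  have hT : ∀ k : ℕ, (Polynomial.Chebyshev.T ℝ k).eval ((s - c) / h) = Real.cos (k * θ) := by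
    intro k; rw [← hθ, Polynomial.Chebyshev.T_real_cos]; simp
  simp only [hT]
  have hsum : Summable fun k : ℕ => Real.cos (k * θ) • a k := by
    refine Summable.of_norm_bounded ((summable_geometric_of_lt_one (inv_nonneg.2 hϱ0.le)
      (inv_lt_one_of_one_lt₀ hϱ)).mul_left (2 * M * K)) fun k => ?_
    rw [norm_smul, Real.norm_eq_abs]
    have := mul_le_mul (Real.abs_cos_le_one (k * θ)) (ha k) (norm_nonneg _) zero_le_one
    linarith
  have hval : ∑' k : ℕ, Real.cos (k * θ) • a k = Real.exp (-(η * s ^ 2)) • g s := by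
    refine (SeparatingDual.eq_iff_forall_dual_eq (R := ℝ)).2 fun φ => ?_
    obtain ⟨G, hG, hd, hb, hk⟩ := main φ
    have e1 := hsum.hasSum.mapL φ
    have e2 := hasSum_cosCoeff hϱ hd hb θ
    rw [hsθ, hG s hs] at e2
    have e3 : HasSum (fun k : ℕ => ((Real.cos (k * θ) * φ (a k) : ℝ) : ℂ))
        ((Real.exp (-(η * s ^ 2)) * φ (g s) : ℝ) : ℂ) := by
      refine e2.congr_fun fun k => ?_
      rw [Complex.ofReal_mul, hk]
      ring
    rw [map_smul, smul_eq_mul]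
    refine e1.unique ?_
    simpa using Complex.hasSum_ofReal.1 e3
  rw [← hval]
  exact hsum.hasSum

end ChebyshevVector

end

noncomputable section

/-! ### Polynomials with vector coefficients -/

section PolynomialMaps

variable {V : Type*} [NormedAddCommGroup V] [NormedSpace ℝ V]

/-- `P` is a polynomial of degree at most `p` with coefficients in `V`. -/
def IsPolynomialMap (p : ℕ) (P : ℝ → V) : Prop :=
  ∃ (n : ℕ) (Q : ℕ → Polynomial ℝ) (a : ℕ → V), (∀ i < n, (Q i).natDegree ≤ p) ∧
    ∀ t, P t = ∑ i ∈ Finset.range n, (Q i).eval t • a i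

theorem isPolynomialMap_zero (p : ℕ) : IsPolynomialMap p (fun _ => (0 : V)) :=
  ⟨0, 0, 0, by simp, by simp⟩

/-- Lagrange interpolation reproduces polynomials. -/
theorem IsPolynomialMap.sum_lagrange_basis {p : ℕ} {P : ℝ → V} (hP : IsPolynomialMap p P)
    {x : Fin (p + 1) → ℝ} (hx : Function.Injective x) (t : ℝ) :
    ∑ j, (Lagrange.basis Finset.univ x j).eval t • P (x j) = P t := by
  obtain ⟨n, Q, a, hQ, h⟩ := hP
  simp only [h, Finset.smul_sum]
  rw [Finset.sum_comm]
  refine Finset.sum_congr rfl fun i hi => ?_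
  simp only [smul_smul]
  rw [← Finset.sum_smul]
  congr 1
  have hd : (Q i).degree < ((Finset.univ : Finset (Fin (p + 1))).card : WithBot ℕ) := by
    rw [Finset.card_univ, Fintype.card_fin]
    refine Polynomial.degree_le_natDegree.trans_lt ?_
    exact_mod_cast Nat.lt_succ_of_le (hQ i (Finset.mem_range.1 hi))
  have := congrArg (Polynomial.eval t) (Lagrange.eq_interpolate (hx.injOn) hd)
  rw [Lagrange.interpolate_apply, Polynomial.eval_finsetSum] at this
  rw [this]
  refine Finset.sum_congr rfl fun j _ => ?_
  rw [Polynomial.eval_mul, Polynomial.eval_C, mul_comm]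

/-- The `n`-th partial sum of a Chebyshev series on `[c - h, c + h]` times a polynomial. -/
theorem isPolynomialMap_chebyshev {p n m : ℕ} (hnm : m + n ≤ p) (c h : ℝ) (a : ℕ → V)
    {Q : Polynomial ℝ} (hQ : Q.natDegree ≤ m) :
    IsPolynomialMap p (fun t => Q.eval t • ∑ k ∈ Finset.range (n + 1),
      (Polynomial.Chebyshev.T ℝ k).eval ((t - c) / h) • a k) := by
  refine ⟨n + 1, fun k => Q * (Polynomial.Chebyshev.T ℝ k).comp
    (Polynomial.C h⁻¹ * Polynomial.X + Polynomial.C (-(c / h))), a, fun k hk => ?_, fun t => ?_⟩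
  · refine Polynomial.natDegree_mul_le.trans ?_
    rw [Polynomial.natDegree_comp, Polynomial.Chebyshev.natDegree_T]
    have : (Polynomial.C h⁻¹ * Polynomial.X + Polynomial.C (-(c / h))).natDegree ≤ 1 :=
      Polynomial.natDegree_linear_le
    have h2 := Nat.mul_le_mul_left k this
    simp only [Int.natAbs_natCast] at *
    omega
  · simp only [Finset.smul_sum]
    refine Finset.sum_congr rfl fun k _ => ?_
    rw [smul_smul, Polynomial.eval_mul, Polynomial.eval_comp]
    congr 4
    simp
    ring

end PolynomialMaps

/-! ### Scalar inequalities and the choice of the working interval -/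

section ScalarEstimates

/-- From cosh u ≥ 1 + u²/2; the quotient u / (1 + u²/2)² peaks at u² = 2/3 with value about 0.4593.
It matters that 0.46/0.94 stays below 1/2. -/
theorem le_mul_cosh_sq {u : ℝ} (hu : 0 ≤ u) : u ≤ 0.46 * Real.cosh u ^ 2 := by
  have h1 : u / 2 ≤ Real.sinh (u / 2) := Real.self_le_sinh_iff.2 (by linarith)
  have h2 : Real.cosh u = 2 * Real.sinh (u / 2) ^ 2 + 1 := by
    have := Real.cosh_two_mul (u / 2)
    rw [show 2 * (u / 2) = u by ring, Real.cosh_sq] at this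
    linarith
  have h3 : 1 + u ^ 2 / 2 ≤ Real.cosh u := by
    rw [h2]; nlinarith
  have h4 : (1 + u ^ 2 / 2) ^ 2 ≤ Real.cosh u ^ 2 := by gcongr
  nlinarith [sq_nonneg (u ^ 2 - 2 / 3), sq_nonneg (u - 0.8165)]

/-- Outside [-1, 1] write |x| = cosh u, so that |T_k(x)| = cosh(ku) ≤ exp(pu), and compare u with
cosh² u. Growth outside the working interval is thus measured in the same Gaussian scale as the
weight. -/
theorem abs_eval_chebyshev_le {k p : ℕ} (hk : k ≤ p) (x : ℝ) :
    |(Polynomial.Chebyshev.T ℝ k).eval x| ≤ Real.exp (0.46 * p * x ^ 2) := by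
  rcases le_total |x| 1 with hx | hx
  · exact (Polynomial.Chebyshev.abs_eval_T_real_le_one k hx).trans (Real.one_le_exp (by positivity))
  have key : ∀ y : ℝ, 1 ≤ y →
      |(Polynomial.Chebyshev.T ℝ k).eval y| ≤ Real.exp (0.46 * p * y ^ 2) := by
    intro y hy
    have hu := Real.arcosh_nonneg hy
    have h1 := le_mul_cosh_sq hu
    conv_lhs => rw [← Real.cosh_arcosh hy]
    rw [Polynomial.Chebyshev.T_real_cosh, abs_of_pos (Real.cosh_pos _)]
    rw [Real.cosh_arcosh hy] at h1
    have hku : 0 ≤ (k : ℝ) * Real.arcosh y := mul_nonneg (Nat.cast_nonneg k) hu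
    have hcosh : Real.cosh (k * Real.arcosh y) ≤ Real.exp (k * Real.arcosh y) := by
      rw [Real.cosh_eq]
      have : Real.exp (-(k * Real.arcosh y)) ≤ Real.exp (k * Real.arcosh y) :=
        Real.exp_le_exp.2 (by linarith)
      linarith
    rw [Int.cast_natCast]
    refine hcosh.trans ?_
    rw [Real.exp_le_exp]
    have hk' : (k : ℝ) ≤ p := by exact_mod_cast hk
    calc (k : ℝ) * Real.arcosh y ≤ p * (0.46 * y ^ 2) := by gcongr
      _ = _ := by ring
  rcases le_abs.1 hx with h | h
  · exact key x h
  · have := key (-x) h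
    rw [Polynomial.Chebyshev.T_eval_neg, abs_mul, neg_sq] at this
    rcases Int.units_eq_one_or (Int.negOnePow k) with h | h <;> simpa [h] using this

/-- In the tail, s^k = 2^(-k) (2s)^k ≤ 2^(-n) (2s)^k. -/
theorem exp_sub_sum_le {s : ℝ} (hs : 0 ≤ s) (n : ℕ) :
    Real.exp s - ∑ k ∈ Finset.range n, s ^ k / (k.factorial : ℝ) ≤
      (2⁻¹) ^ n * Real.exp (2 * s) := by
  have hsum : ∀ y : ℝ, HasSum (fun n : ℕ => y ^ n / (n.factorial : ℝ)) (Real.exp y) := fun y => by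
    rw [Real.exp_eq_exp_ℝ]; exact NormedSpace.expSeries_div_hasSum_exp y
  have h1 := (hsum s).summable.sum_add_tsum_nat_add n
  rw [(hsum s).tsum_eq] at h1
  have h2 := (hsum (2 * s)).summable.sum_add_tsum_nat_add n
  rw [(hsum (2 * s)).tsum_eq] at h2
  have h3 : 0 ≤ ∑ k ∈ Finset.range n, (2 * s) ^ k / (k.factorial : ℝ) :=
    Finset.sum_nonneg fun k _ => by positivity
  have h4 : ∑' i : ℕ, s ^ (i + n) / ((i + n).factorial : ℝ) ≤
      ∑' i : ℕ, (2⁻¹) ^ n * ((2 * s) ^ (i + n) / ((i + n).factorial : ℝ)) := by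
    refine Summable.tsum_le_tsum (fun i => ?_)
      ((summable_nat_add_iff n (f := fun i : ℕ => s ^ i / (i.factorial : ℝ))).2 (hsum s).summable)
      (((summable_nat_add_iff n (f := fun i : ℕ => (2 * s) ^ i / (i.factorial : ℝ))).2
        (hsum (2 * s)).summable).mul_left _)
    rw [mul_div_assoc', mul_pow, ← mul_assoc, pow_add 2 i n]
    have : (2⁻¹ : ℝ) ^ n * (2 ^ i * 2 ^ n) = 2 ^ i := by
      rw [inv_pow]; field_simp
    rw [this]
    gcongr
    exact le_mul_of_one_le_left (by positivity) (one_le_pow₀ one_le_two)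
  rw [tsum_mul_left] at h4
  have h5 : ∑' i : ℕ, (2 * s) ^ (i + n) / ((i + n).factorial : ℝ) ≤ Real.exp (2 * s) := by linarith
  have h6 := mul_le_mul_of_nonneg_left h5 (by positivity : (0 : ℝ) ≤ (2⁻¹) ^ n)
  linarith

/-- Half of the Gaussian absorbs the polynomial and the other half the linear exponent. Taken at x =
√p, this turns (p + 1) exp(-ap) into a multiple of exp(-b√p). -/
theorem exists_sq_add_one_mul_exp_le {a : ℝ} (ha : 0 < a) (b : ℝ) :
    ∃ C : ℝ, 0 < C ∧ ∀ x : ℝ, (x ^ 2 + 1) * Real.exp (-(a * x ^ 2) + b * x) ≤ C := by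
  refine ⟨(2 / a + 1) * Real.exp (b ^ 2 / (2 * a)), by positivity, fun x => ?_⟩
  have h1 : x ^ 2 + 1 ≤ (2 / a + 1) * Real.exp (a / 2 * x ^ 2) := by
    have h2 := Real.add_one_le_exp (a / 2 * x ^ 2)
    have h3 : 1 ≤ Real.exp (a / 2 * x ^ 2) := Real.one_le_exp (by positivity)
    have h4 : 2 / a * (a / 2 * x ^ 2) ≤ 2 / a * Real.exp (a / 2 * x ^ 2) := by gcongr; linarith
    have h5 : 2 / a * (a / 2 * x ^ 2) = x ^ 2 := by field_simp
    linarith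
  calc _ ≤ (2 / a + 1) * Real.exp (a / 2 * x ^ 2) * Real.exp (-(a * x ^ 2) + b * x) := by gcongr
    _ = (2 / a + 1) * Real.exp (a / 2 * x ^ 2 + (-(a * x ^ 2) + b * x)) := by
      rw [mul_assoc, ← Real.exp_add]
    _ ≤ _ := by
      gcongr
      have : b ^ 2 / (2 * a) - (a / 2 * x ^ 2 + (-(a * x ^ 2) + b * x)) =
        (a * x - b) ^ 2 / (2 * a) := by field_simp; ring
      have h7 : 0 ≤ (a * x - b) ^ 2 / (2 * a) := by positivity
      linarith

theorem mul_sub_sq_le {a : ℝ} (ha : 0 < a) (α x : ℝ) :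
    α * x - a * x ^ 2 ≤ α ^ 2 / (4 * a) := by
  have : α ^ 2 / (4 * a) - (α * x - a * x ^ 2) = (2 * a * x - α) ^ 2 / (4 * a) := by
    field_simp; ring
  have h7 : 0 ≤ (2 * a * x - α) ^ 2 / (4 * a) := by positivity
  linarith

/-- From log(1 + a) ≥ a - a²/2. In the application a = τ/R is of order p^(-1/2), so the quadratic
correction stays bounded. -/
theorem inv_one_add_pow_le {a : ℝ} (ha : 0 ≤ a) (n : ℕ) :
    ((1 + a)⁻¹) ^ n ≤ Real.exp (-(n * a) + n * a ^ 2 / 2) := by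
  have h1 := Real.le_log_one_add_of_nonneg ha
  have h2 : a - a ^ 2 / 2 ≤ 2 * a / (a + 2) := by
    rw [le_div_iff₀ (by linarith)]
    nlinarith [pow_nonneg ha 3]
  have h3 : ((1 + a)⁻¹) ^ n = Real.exp (-(n * Real.log (1 + a))) := by
    rw [Real.exp_neg, mul_comm, Real.exp_mul, Real.exp_log (by linarith), Real.rpow_natCast,
      inv_pow]
  rw [h3, Real.exp_le_exp]
  have := mul_le_mul_of_nonneg_left (h2.trans h1) (Nat.cast_nonneg (α := ℝ) n)
  linarith

/-- The interval is anchored at the finite endpoint of a half-line, or centred at 0 on the line. The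
alternative |t - c| ≤ |t| lets Chebyshev growth about c be paid for by the weight centred at 0. -/
theorem exists_interval_of_not_isBounded {Γ : Set ℝ} (hΓ : Γ.OrdConnected) (hne : Γ.Nonempty)
    (hub : ¬ Bornology.IsBounded Γ) :
    ∃ R₀ : ℝ, ∀ R, R₀ ≤ R → ∃ c : ℝ, Ioo (c - R) (c + R) ⊆ Γ ∧ |c| ≤ 2 * R ∧
      ∀ t ∈ Γ, |t - c| ≤ R ∨ |t - c| ≤ |t| := by
  rw [isBounded_iff_bddBelow_bddAbove, not_and_or] at hub
  by_cases hb : BddBelow Γ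
  · have ha : ¬ BddAbove Γ := by tauto
    refine ⟨|sInf Γ|, fun R hR => ⟨sInf Γ + R, fun t ht => ?_, ?_, fun t ht => ?_⟩⟩
    · obtain ⟨y, hy, hyt⟩ := exists_lt_of_csInf_lt hne (by linarith [ht.1] : sInf Γ < t)
      obtain ⟨z, hz, htz⟩ := not_bddAbove_iff.1 ha t
      exact hΓ.out hy hz ⟨hyt.le, htz.le⟩
    · have := abs_nonneg (sInf Γ)
      exact (abs_add_le _ _).trans (by rw [abs_of_nonneg (a := R) (by linarith)]; linarith)
    · have h1 := csInf_le hb ht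
      have h2 := neg_abs_le (sInf Γ)
      rcases le_total (t - (sInf Γ + R)) R with h | h
      · exact .inl (abs_le.2 ⟨by linarith, h⟩)
      · refine .inr ?_
        have := abs_nonneg (sInf Γ)
        rw [abs_of_nonneg (by linarith)]
        exact le_trans (by linarith) (le_abs_self t)
  by_cases ha : BddAbove Γ
  · refine ⟨|sSup Γ|, fun R hR => ⟨sSup Γ - R, fun t ht => ?_, ?_, fun t ht => ?_⟩⟩
    · obtain ⟨y, hy, hyt⟩ := exists_lt_of_lt_csSup hne (by linarith [ht.2] : t < sSup Γ)
      obtain ⟨z, hz, htz⟩ := not_bddBelow_iff.1 hb t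
      exact hΓ.out hz hy ⟨htz.le, hyt.le⟩
    · have := abs_nonneg (sSup Γ)
      exact (abs_sub _ _).trans (by rw [abs_of_nonneg (a := R) (by linarith)]; linarith)
    · have h1 := le_csSup ha ht
      have h2 := le_abs_self (sSup Γ)
      rcases le_total (-R) (t - (sSup Γ - R)) with h | h
      · exact .inl (abs_le.2 ⟨h, by linarith⟩)
      · refine .inr ?_
        have := abs_nonneg (sSup Γ)
        rw [abs_of_nonpos (by linarith)]
        exact le_trans (by linarith) (neg_le_abs t)
  · refine ⟨0, fun R hR => ⟨0, fun t _ => ?_, by simpa using hR, fun t _ => .inr (by simp)⟩⟩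
    obtain ⟨y, hy, hyt⟩ := not_bddBelow_iff.1 hb t
    obtain ⟨z, hz, htz⟩ := not_bddAbove_iff.1 ha t
    exact hΓ.out hy hz ⟨hyt.le, htz.le⟩

end ScalarEstimates

end

noncomputable section

/-! ### Polynomial approximation on bounded and unbounded intervals -/

section Approximation

variable {V : Type*} [NormedAddCommGroup V] [NormedSpace ℝ V] [CompleteSpace V]
  {Γ : Set ℝ} {α γ τ : ℝ}

theorem exists_gt_mul_lt_one (hγ : 0 ≤ γ) (h : γ * τ < 1) : ∃ τ', τ < τ' ∧ γ * τ' < 1 := by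
  have h1 : 0 < 1 - γ * τ := by linarith
  refine ⟨τ + (1 - γ * τ) / (γ + 1), ?_, ?_⟩
  · have : 0 < (1 - γ * τ) / (γ + 1) := by positivity
    linarith
  · have : γ * ((1 - γ * τ) / (γ + 1)) < 1 - γ * τ := by
      rw [mul_div_assoc', div_lt_iff₀ (by linarith)]
      linarith
    linarith

variable (V) in
/-- Polynomial approximation on a bounded interval, with the rate given by the largest confocal
ellipse in the domain of analyticity. -/
theorem exists_polynomial_approx_of_subset_Icc (hΓ : UniqueDiffOn ℝ Γ) (hΓ' : Γ.OrdConnected)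
    (hγ : 0 ≤ γ) (hτ : 0 < τ) (h1 : γ * τ < 1) {c h ϱ : ℝ} (hh : 0 < h)
    (hsub : Ioo (c - h) (c + h) ⊆ Γ) (hsup : Γ ⊆ Icc (c - h) (c + h)) (hϱ : 1 < ϱ)
    (hϱτ : h * (ϱ - ϱ⁻¹) / 2 ≤ τ) :
    ∃ C : ℝ, 0 < C ∧ ∀ (p : ℕ) (g : ℝ → V) (M : ℝ), 0 ≤ M → HasAnalyticBound Γ g M 0 γ →
      ∃ P : ℝ → V, IsPolynomialMap p P ∧ ∀ t ∈ Γ, ‖g t - P t‖ ≤ C * M * (ϱ⁻¹) ^ p := by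
  obtain ⟨τ', hττ', h1'⟩ := exists_gt_mul_lt_one hγ h1
  have hϱ0 : 0 < ϱ := one_pos.trans hϱ
  have hϱi : ϱ⁻¹ < 1 := inv_lt_one_of_one_lt₀ hϱ
  have hd : 0 < 1 - ϱ⁻¹ := by linarith
  have hK0 : 0 < (1 - γ * τ')⁻¹ := inv_pos.2 (by linarith)
  refine ⟨2 * (1 - γ * τ')⁻¹ * ϱ⁻¹ / (1 - ϱ⁻¹), by positivity, fun p g M hM hg => ?_⟩
  -- Here η = 0 and α = 0: on a bounded interval no damping is needed.
  obtain ⟨a, ha, hs⟩ := hg.exists_chebyshev_expansion hM le_rfl hγ hΓ hΓ' le_rfl hτ hττ' h1' hh hsub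
    hϱ hϱτ (K := (1 - γ * τ')⁻¹) (fun x => by simp)
  refine ⟨_, isPolynomialMap_chebyshev (p := p) (m := 0) (n := p) (by simp) c h a (Q := 1)
    (by simp), fun t ht => ?_⟩
  have htc : |t - c| ≤ h := abs_le.2 ⟨by linarith [(hsup ht).1], by linarith [(hsup ht).2]⟩
  have := norm_sub_le_of_geometric_bound_of_hasSum hϱi (C := 2 * M * (1 - γ * τ')⁻¹) (fun k => ?_)
    (hs t ht htc) (p + 1)
  · rw [norm_sub_rev] at this
    simp only [zero_mul, neg_zero, Real.exp_zero, one_smul, Polynomial.eval_one] at this ⊢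
    refine this.trans_eq ?_
    rw [pow_succ]
    ring
  · rw [norm_smul, Real.norm_eq_abs]
    have hx : |(t - c) / h| ≤ 1 := by rwa [abs_div, abs_of_pos hh, div_le_one hh]
    have := mul_le_mul (Polynomial.Chebyshev.abs_eval_T_real_le_one k hx) (ha k) (norm_nonneg _)
      zero_le_one
    linarith

theorem sqrt_mul_div_pos {δ : ℝ} (hδ : 0 < δ) {p : ℕ} (hp : 0 < p) :
    0 < √(0.94 * p) / δ := by positivity

/-- This Taylor section in ηt² undoes the Gaussian damping by a polynomial; its nonnegative
coefficients keep it between 0 and the exponential on the whole line. -/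
theorem exists_exp_mul_sq_taylor {η : ℝ} (hη : 0 ≤ η) (q : ℕ) :
    ∃ Q : Polynomial ℝ, Q.natDegree ≤ 2 * q ∧ ∀ t : ℝ, 0 ≤ Q.eval t ∧
      Q.eval t ≤ Real.exp (η * t ^ 2) ∧
      Real.exp (η * t ^ 2) - Q.eval t ≤ (2⁻¹) ^ (q + 1) * Real.exp (2 * (η * t ^ 2)) := by
  let Q : Polynomial ℝ := ∑ k ∈ Finset.range (q + 1),
    Polynomial.C (η ^ k / (k.factorial : ℝ)) * Polynomial.X ^ (2 * k)
  have hQe : ∀ t, Q.eval t = ∑ k ∈ Finset.range (q + 1), (η * t ^ 2) ^ k / (k.factorial : ℝ) := by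
    intro t
    simp only [Q, Polynomial.eval_finsetSum, Polynomial.eval_mul, Polynomial.eval_C,
      Polynomial.eval_pow, Polynomial.eval_X]
    refine Finset.sum_congr rfl fun k _ => ?_
    rw [mul_pow, pow_mul]
    ring
  refine ⟨Q, ?_, fun t => ?_⟩
  · refine Polynomial.natDegree_sum_le_of_forall_le _ _ fun k hk => ?_
    refine (Polynomial.natDegree_C_mul_X_pow_le _ _).trans ?_
    have := Finset.mem_range.1 hk
    omega
  · have hs0 : 0 ≤ η * t ^ 2 := by positivity
    rw [hQe]
    exact ⟨Finset.sum_nonneg fun k _ => div_nonneg (pow_nonneg hs0 _) (by positivity),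
      Real.sum_le_exp_of_nonneg hs0 _, exp_sub_sum_le hs0 _⟩

/-- The main exponent is nτ/R ≥ (0.99/0.97) τδ√p, and 0.99/0.97 > 1.02. The excess 0.02 later
absorbs the factor √p; the second-order term is at most τ²δ². -/
theorem inv_one_add_pow_le_exp_sqrt {δ R x : ℝ} {p n : ℕ} (hτ : 0 < τ) (hδ : 0 < δ) (hR0 : 0 < R)
    (hx0 : 0 < x) (hx2 : x ^ 2 = p) (hR2 : (δ * R) ^ 2 = 0.94 * p) (hRx : δ * R ≤ 0.97 * x)
    (hnp : 0.99 * (p : ℝ) ≤ n) (hnp' : n ≤ p) :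
    ((1 + τ / R)⁻¹) ^ n ≤ Real.exp (τ ^ 2 * δ ^ 2) * Real.exp (-(1.02 * τ * δ * x)) := by
  have ha0 : 0 < τ / R := by positivity
  refine (inv_one_add_pow_le ha0.le n).trans ?_
  rw [← Real.exp_add, Real.exp_le_exp]
  have hnp'' : (n : ℝ) ≤ p := by exact_mod_cast hnp'
  have hRinv : δ * x / 0.97 ≤ p / R := by
    rw [le_div_iff₀ hR0, ← hx2]
    calc δ * x / 0.97 * R = (δ * R) * (x / 0.97) := by ring
      _ ≤ (0.97 * x) * (x / 0.97) := by gcongr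
      _ = x ^ 2 := by ring
  have f1 : 1.02 * τ * δ * x ≤ n * (τ / R) := by
    calc 1.02 * τ * δ * x = 1.02 * (τ * (δ * x)) := by ring
      _ ≤ 0.99 / 0.97 * (τ * (δ * x)) := by gcongr; norm_num
      _ = 0.99 * τ * (δ * x / 0.97) := by ring
      _ ≤ 0.99 * τ * (p / R) := by gcongr
      _ = 0.99 * p * (τ / R) := by ring
      _ ≤ _ := by gcongr
  have f2 : n * (τ / R) ^ 2 / 2 ≤ τ ^ 2 * δ ^ 2 := by
    have : (n : ℝ) * (τ / R) ^ 2 / 2 ≤ p * (τ / R) ^ 2 / 2 := by gcongr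
    refine this.trans ?_
    rw [div_pow, mul_div_assoc', div_div, div_le_iff₀ (by positivity)]
    have : τ ^ 2 * δ ^ 2 * (R ^ 2 * 2) = τ ^ 2 * 2 * (δ * R) ^ 2 := by ring
    rw [this, hR2]
    have : 0 ≤ τ ^ 2 * (p : ℝ) := by positivity
    linarith
  linarith

/-- Arithmetic of the Taylor degree: 2^(-(q+1)) contributes -0.69p/200 = -0.00345p, while the
exponential costs at most 0.0002 · 9 · 0.94p < 0.0017p. -/
theorem inv_two_pow_mul_exp_le {δ R t : ℝ} {p q : ℕ} (hR2 : (δ * R) ^ 2 = 0.94 * p)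
    (ht3 : |t| ≤ 3 * R) (hq' : p ≤ 200 * (q + 1)) :
    (2⁻¹ : ℝ) ^ (q + 1) * Real.exp (2 * (0.0001 * (δ * t) ^ 2)) ≤ Real.exp (-(0.0017 * p)) := by
  have : ((2 : ℝ)⁻¹) ^ (q + 1) = Real.exp (-((q + 1 : ℕ) * Real.log 2)) := by
    rw [Real.exp_neg, mul_comm, Real.exp_mul, Real.exp_log two_pos, Real.rpow_natCast, inv_pow]
  rw [this, ← Real.exp_add, Real.exp_le_exp]
  have hl := Real.log_two_gt_d9
  have hq'' : (p : ℝ) ≤ 200 * (q + 1 : ℕ) := by exact_mod_cast hq'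
  have ht4 : (δ * t) ^ 2 ≤ 9 * (0.94 * p) := by
    rw [← hR2]
    have : t ^ 2 ≤ (3 * R) ^ 2 := sq_le_sq' (neg_le_of_abs_le ht3) (le_of_abs_le ht3)
    nlinarith [sq_nonneg δ]
  have f3 : (p : ℝ) / 200 * 0.69 ≤ (q + 1 : ℕ) * Real.log 2 :=
    mul_le_mul (by linarith) (by linarith) (by norm_num) (by positivity)
  linarith

set_option maxHeartbeats 1000000 in
/-- Intermediate form of the weighted approximation on an unbounded interval: for large degrees, the
error is bounded in terms of `x = √p`. -/
theorem HasAnalyticBound.exists_polynomial_approx_aux {δ K C₂ τ' : ℝ} (hΓ : UniqueDiffOn ℝ Γ)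
    (hΓ' : Γ.OrdConnected) (hα : 0 ≤ α) (hγ : 0 ≤ γ) (hτ : 0 < τ) (hδ : 0 < δ) (hττ' : τ < τ')
    (h1 : γ * τ' < 1)
    (hK : ∀ x : ℝ, Real.exp (α * |x|) * (1 - γ * τ')⁻¹ *
      Real.exp (2 * (0.0001 * δ ^ 2) * τ' ^ 2 - 0.0001 * δ ^ 2 * x ^ 2 / 2) ≤ K)
    (hC₂ : ∀ x : ℝ, Real.exp (α * |x|) ≤ C₂ * Real.exp (0.4895 * (δ * x) ^ 2))
    {p : ℕ} (hp : 0 < p) {c R : ℝ} (hR : R = √(0.94 * p) / δ)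
    (hsub : Ioo (c - R) (c + R) ⊆ Γ) (hc : |c| ≤ 2 * R)
    (hcase : ∀ t ∈ Γ, |t - c| ≤ R ∨ |t - c| ≤ |t|)
    {g : ℝ → V} {M : ℝ} (hM : 0 ≤ M) (hg : HasAnalyticBound Γ g M α γ) :
    ∃ P : ℝ → V, IsPolynomialMap p P ∧ ∀ t ∈ Γ, ‖g t - P t‖ ≤
      M * Real.exp (0.495 * (δ * t) ^ 2) *
        (2 * K * (√p / (δ * τ) * Real.exp (τ ^ 2 * δ ^ 2)) * Real.exp (-(1.02 * τ * δ * √p)) +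
          (4 * K + C₂) * (p + 1) * Real.exp (-(0.0017 * p))) := by
  have hx0 : 0 < √(p : ℝ) := by positivity
  have hx2 : √(p : ℝ) ^ 2 = p := Real.sq_sqrt (by positivity)
  have hp1 : (1 : ℝ) ≤ p := by exact_mod_cast hp
  set x := √(p : ℝ) with hx
  have hR0 : 0 < R := hR ▸ sqrt_mul_div_pos hδ hp
  have hR2 : (δ * R) ^ 2 = 0.94 * p := by
    rw [hR, mul_div_cancel₀ _ hδ.ne', Real.sq_sqrt (by positivity)]
  have hRx : δ * R ≤ 0.97 * x := by
    refine abs_le_of_sq_le_sq' ?_ (by positivity) |>.2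
    rw [hR2, mul_pow, hx2]
    nlinarith
  have hK0 : 0 ≤ K := le_trans (by have : 0 < 1 - γ * τ' := by linarith
                                   positivity) (hK 0)
  have hC0 : 0 ≤ C₂ := by
    have := hC₂ 0
    simp at this
    linarith
  -- Damping makes the bound on the ellipse independent of R despite the growth exp(α|t|), which
  -- alone would cost exp(αR) with R of order √p. The value is small enough for 0.4894 + 0.0001 to
  -- stay below 0.495.
  set η : ℝ := 0.0001 * δ ^ 2 with hη
  have hη0 : 0 ≤ η := by positivity
  -- Since ϱ⁻¹ ≥ 1 - τ/R, the semi-minor axis R(ϱ - ϱ⁻¹)/2 is at most τ.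
  set ϱ := 1 + τ / R with hϱdef
  have ha0 : 0 < τ / R := by positivity
  have hϱ : 1 < ϱ := by linarith
  have hϱ0 : 0 < ϱ := one_pos.trans hϱ
  have hϱτ : R * (ϱ - ϱ⁻¹) / 2 ≤ τ := by
    have h2 : 1 - τ / R ≤ ϱ⁻¹ := by
      rw [inv_eq_one_div, le_div_iff₀ hϱ0, hϱdef]
      nlinarith [sq_nonneg (τ / R)]
    have h3 : R * (τ / R) = τ := by field_simp
    nlinarith
  obtain ⟨a, ha, hs⟩ := hg.exists_chebyshev_expansion hM hα hγ hΓ hΓ' hη0 hτ hττ' h1 hR0 hsub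
    hϱ hϱτ hK
  -- At most one percent of the degree goes to the Taylor factor, leaving n ≥ 0.99p for the
  -- Chebyshev sum.
  set q := p / 200
  set n := p - 2 * q
  have hq : 200 * q ≤ p := Nat.mul_div_le p 200
  have hq' : p < 200 * (q + 1) := by omega
  obtain ⟨Q, hQd, hQ⟩ := exists_exp_mul_sq_taylor hη0 q
  set S : ℝ → V := fun t => ∑ k ∈ Finset.range (n + 1),
    (Polynomial.Chebyshev.T ℝ k).eval ((t - c) / R) • a k
  have hn : (n : ℝ) + 1 ≤ p + 1 := by
    have : n ≤ p := Nat.sub_le _ _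
    exact_mod_cast Nat.succ_le_succ this
  have hϱi : ϱ⁻¹ < 1 := inv_lt_one_of_one_lt₀ hϱ
  have hak : ∀ k, ‖a k‖ ≤ 2 * M * K := fun k => (ha k).trans
    (mul_le_of_le_one_right (by positivity) (pow_le_one₀ (inv_nonneg.2 hϱ0.le) hϱi.le))
  have hS : ∀ t B, (∀ k ∈ Finset.range (n + 1),
      |(Polynomial.Chebyshev.T ℝ k).eval ((t - c) / R)| ≤ B) → 0 ≤ B →
      ‖S t‖ ≤ (p + 1) * (2 * M * K) * B := by
    intro t B hB hB0
    refine (norm_sum_le_of_le (n := fun _ => B * (2 * M * K)) (Finset.range (n + 1))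
      fun k hk => ?_).trans ?_
    · rw [norm_smul, Real.norm_eq_abs]
      exact mul_le_mul (hB k hk) (hak k) (norm_nonneg _) hB0
    · rw [Finset.sum_const, Finset.card_range, nsmul_eq_mul]
      push_cast
      calc ((n : ℝ) + 1) * (B * (2 * M * K)) ≤ (p + 1) * (B * (2 * M * K)) := by gcongr
        _ = _ := by ring
  refine ⟨_, isPolynomialMap_chebyshev (p := p) (m := 2 * q) (n := n) (by omega) c R a hQd,
    fun t ht => ?_⟩
  change ‖g t - Q.eval t • S t‖ ≤ _
  have hηt : η * t ^ 2 = 0.0001 * (δ * t) ^ 2 := by rw [hη]; ring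
  set E := Real.exp (0.495 * (δ * t) ^ 2)
  have hE1 : 1 ≤ E := Real.one_le_exp (by positivity)
  have hEη : Real.exp (η * t ^ 2) ≤ E := by
    refine Real.exp_le_exp.2 ?_
    rw [hηt]; gcongr; norm_num
  by_cases htc : |t - c| ≤ R
  · have hxt : |(t - c) / R| ≤ 1 := by rwa [abs_div, abs_of_pos hR0, div_le_one hR0]
    have e1 : ‖Real.exp (-(η * t ^ 2)) • g t - S t‖ ≤
        2 * M * K * (x / (δ * τ)) * (Real.exp (τ ^ 2 * δ ^ 2) * Real.exp (-(1.02 * τ * δ * x))) := by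
      have := norm_sub_le_of_geometric_bound_of_hasSum hϱi (C := 2 * M * K) (fun k => ?_)
        (hs t ht htc) (n + 1)
      · rw [norm_sub_rev] at this
        refine this.trans ?_
        have e2 : 2 * M * K * ϱ⁻¹ ^ (n + 1) / (1 - ϱ⁻¹) = 2 * M * K * (R / τ) * ϱ⁻¹ ^ n := by
          have : (1 - ϱ⁻¹) = (τ / R) * ϱ⁻¹ := by
            rw [hϱdef]; field_simp; ring
          rw [this, pow_succ]
          field_simp
        rw [e2]
        have e3 : R / τ ≤ x / (δ * τ) := by
          rw [div_le_div_iff₀ hτ (by positivity)]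
          have := mul_le_mul_of_nonneg_right hRx hτ.le
          have := mul_pos hx0 hτ
          linarith
        have e4 : ϱ⁻¹ ^ n ≤ Real.exp (τ ^ 2 * δ ^ 2) * Real.exp (-(1.02 * τ * δ * x)) := by
          have hnp : 0.99 * (p : ℝ) ≤ n := by
            have : 99 * p ≤ 100 * n := by omega
            have : (99 : ℝ) * p ≤ 100 * n := by exact_mod_cast this
            linarith
          exact inv_one_add_pow_le_exp_sqrt hτ hδ hR0 hx0 hx2 hR2 hRx hnp (Nat.sub_le _ _)
        gcongr
      · rw [norm_smul, Real.norm_eq_abs]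
        have := mul_le_mul (Polynomial.Chebyshev.abs_eval_T_real_le_one k hxt) (ha k)
          (norm_nonneg _) zero_le_one
        linarith
    have e5 : ‖S t‖ ≤ (p + 1) * (2 * M * K) * 1 :=
      hS t 1 (fun k _ => Polynomial.Chebyshev.abs_eval_T_real_le_one k hxt) zero_le_one
    have e6 : Real.exp (η * t ^ 2) - Q.eval t ≤ Real.exp (-(0.0017 * p)) := by
      have ht3 : |t| ≤ 3 * R := by
        have := abs_add_le (t - c) c
        rw [sub_add_cancel] at this
        linarith
      have := (hQ t).2.2
      rw [hηt] at this ⊢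
      exact this.trans (inv_two_pow_mul_exp_le hR2 ht3 hq'.le)
    -- Inside the interval the error splits into the truncation of the Chebyshev series and that of
    -- the Taylor series.
    have e7 : g t - Q.eval t • S t = Real.exp (η * t ^ 2) •
        (Real.exp (-(η * t ^ 2)) • g t - S t) + (Real.exp (η * t ^ 2) - Q.eval t) • S t := by
      rw [smul_sub, smul_smul, ← Real.exp_add, add_neg_cancel, Real.exp_zero, one_smul, sub_smul]
      abel
    rw [e7]
    refine (norm_add_le _ _).trans ?_
    rw [norm_smul, norm_smul, Real.norm_of_nonneg (Real.exp_pos _).le,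
      Real.norm_of_nonneg (sub_nonneg.2 (hQ t).2.1)]
    calc _ ≤ E * (2 * M * K * (x / (δ * τ)) *
            (Real.exp (τ ^ 2 * δ ^ 2) * Real.exp (-(1.02 * τ * δ * x)))) +
          Real.exp (-(0.0017 * p)) * ((p + 1) * (2 * M * K) * 1) := by gcongr
      _ ≤ E * (2 * M * K * (x / (δ * τ)) *
            (Real.exp (τ ^ 2 * δ ^ 2) * Real.exp (-(1.02 * τ * δ * x)))) +
          E * (M * ((4 * K + C₂) * (p + 1) * Real.exp (-(0.0017 * p)))) := by
        refine add_le_add le_rfl ?_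
        have : Real.exp (-(0.0017 * p)) * ((p + 1) * (2 * M * K) * 1) ≤
            M * ((4 * K + C₂) * (p + 1) * Real.exp (-(0.0017 * p))) := by
          have f : 2 * K ≤ 4 * K + C₂ := by linarith
          calc _ = M * (2 * K * (p + 1) * Real.exp (-(0.0017 * p))) := by ring
            _ ≤ _ := by gcongr
        exact this.trans (le_mul_of_one_le_left (by positivity) hE1)
      _ = _ := by ring
  -- Outside, g and its approximant are bounded separately by exp(0.4895 (δt)²). As (δt)² ≥ 0.94p
  -- there, the gap between 0.4895 and 0.495 already yields exp(-0.0017p).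
  · have htt : |t - c| ≤ |t| := (hcase t ht).resolve_left htc
    have hRt : R ≤ |t| := (not_le.1 htc).le.trans htt
    have e0 : 0.94 * (p : ℝ) ≤ (δ * t) ^ 2 := by
      rw [← hR2, mul_pow, mul_pow, ← sq_abs t]
      gcongr
    have e1 : ‖S t‖ ≤ (p + 1) * (2 * M * K) * Real.exp (0.4894 * (δ * t) ^ 2) := by
      refine hS t _ (fun k hk => ?_) (Real.exp_pos _).le
      have hkp : k ≤ p := by have := Finset.mem_range.1 hk; omega
      refine (abs_eval_chebyshev_le hkp _).trans (Real.exp_le_exp.2 ?_)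
      have f1 : (p : ℝ) = δ ^ 2 * R ^ 2 / 0.94 := by rw [← mul_pow, hR2]; ring
      have f2 : (t - c) ^ 2 ≤ t ^ 2 := sq_le_sq.2 htt
      rw [f1, div_pow]
      have : 0.46 * (δ ^ 2 * R ^ 2 / 0.94) * ((t - c) ^ 2 / R ^ 2) =
        0.46 / 0.94 * (δ ^ 2 * (t - c) ^ 2) := by field_simp
      rw [this, mul_pow]
      have : 0.46 / 0.94 ≤ (0.4894 : ℝ) := by norm_num
      gcongr
    have e2 : ‖g t‖ ≤ M * (C₂ * Real.exp (0.4895 * (δ * t) ^ 2)) :=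
      (hg.norm_apply_le ht).trans (by gcongr; exact hC₂ t)
    have e3 : ‖Q.eval t • S t‖ ≤
        (p + 1) * (2 * M * K) * Real.exp (0.4895 * (δ * t) ^ 2) := by
      rw [norm_smul, Real.norm_of_nonneg (hQ t).1]
      calc _ ≤ Real.exp (η * t ^ 2) *
            ((p + 1) * (2 * M * K) * Real.exp (0.4894 * (δ * t) ^ 2)) := by
            gcongr
            exact (hQ t).2.1
        _ = (p + 1) * (2 * M * K) * (Real.exp (η * t ^ 2) * Real.exp (0.4894 * (δ * t) ^ 2)) := by
            ring
        _ = _ := by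
            rw [← Real.exp_add, hηt]
            congr 2
            ring
    have e4 : Real.exp (0.4895 * (δ * t) ^ 2) ≤ E * Real.exp (-(0.0017 * p)) := by
      rw [← Real.exp_add, Real.exp_le_exp]
      linarith
    refine (norm_sub_le _ _).trans ?_
    have hp0 : (0 : ℝ) ≤ p := by positivity
    calc ‖g t‖ + ‖Q.eval t • S t‖ ≤ M * (C₂ * Real.exp (0.4895 * (δ * t) ^ 2)) +
          (p + 1) * (2 * M * K) * Real.exp (0.4895 * (δ * t) ^ 2) := add_le_add e2 e3
      _ = M * (C₂ + (p + 1) * (2 * K)) * Real.exp (0.4895 * (δ * t) ^ 2) := by ring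
      _ ≤ M * ((4 * K + C₂) * (p + 1)) * (E * Real.exp (-(0.0017 * p))) := by
        gcongr
        have := mul_nonneg hC0 hp0
        have := mul_nonneg hK0 hp0
        linarith
      _ = M * E * ((4 * K + C₂) * (p + 1) * Real.exp (-(0.0017 * p))) := by ring
      _ ≤ _ := mul_le_mul_of_nonneg_left (le_add_of_nonneg_left (by positivity)) (by positivity)

variable (V) in
/-- Weighted polynomial approximation on an unbounded interval. -/
theorem exists_polynomial_approx_of_not_isBounded {δ : ℝ} (hΓ : UniqueDiffOn ℝ Γ)
    (hΓ' : Γ.OrdConnected) (hne : Γ.Nonempty) (hub : ¬ Bornology.IsBounded Γ)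
    (hα : 0 ≤ α) (hγ : 0 ≤ γ) (hτ : 0 < τ) (hδ : 0 < δ) (h1 : γ * τ < 1) :
    ∃ C : ℝ, 0 < C ∧ ∀ (p : ℕ) (g : ℝ → V) (M : ℝ), 0 ≤ M → HasAnalyticBound Γ g M α γ →
      ∃ P : ℝ → V, IsPolynomialMap p P ∧ ∀ t ∈ Γ, ‖g t - P t‖ ≤
        C * M * Real.exp (-(τ * δ * √p)) * Real.exp (0.495 * (δ * t) ^ 2) := by
  obtain ⟨τ', hττ', h1'⟩ := exists_gt_mul_lt_one hγ h1
  obtain ⟨R₀, hR₀⟩ := exists_interval_of_not_isBounded hΓ' hne hub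
  have h1'' : 0 < 1 - γ * τ' := by linarith
  have hη : 0 < 0.0001 * δ ^ 2 := by positivity
  -- Completing the square in α|x| - ηx²/2 gives a bound independent of p.
  set K := Real.exp (α ^ 2 / (4 * (0.0001 * δ ^ 2 / 2)) + 2 * (0.0001 * δ ^ 2) * τ' ^ 2) *
    (1 - γ * τ')⁻¹ with hKdef
  have hK : ∀ x : ℝ, Real.exp (α * |x|) * (1 - γ * τ')⁻¹ *
      Real.exp (2 * (0.0001 * δ ^ 2) * τ' ^ 2 - 0.0001 * δ ^ 2 * x ^ 2 / 2) ≤ K := by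
    intro x
    rw [mul_right_comm, ← Real.exp_add, hKdef]
    refine mul_le_mul_of_nonneg_right (Real.exp_le_exp.2 ?_) (inv_pos.2 h1'').le
    have := mul_sub_sq_le (half_pos hη) α |x|
    rw [sq_abs] at this
    linarith
  have hK0 : 0 < K := by positivity
  set C₂ := Real.exp (α ^ 2 / (4 * (0.4895 * δ ^ 2))) with hC2def
  have hC₂ : ∀ x : ℝ, Real.exp (α * |x|) ≤ C₂ * Real.exp (0.4895 * (δ * x) ^ 2) := by
    intro x
    rw [hC2def, ← Real.exp_add, Real.exp_le_exp]
    have := mul_sub_sq_le (by positivity : 0 < 0.4895 * δ ^ 2) α |x|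
    rw [sq_abs] at this
    linarith
  obtain ⟨Cb, hCb0, hCb⟩ := exists_sq_add_one_mul_exp_le (a := 0.0017) (by norm_num) (τ * δ)
  set Ca := 2 * K * (1 / (0.02 * τ * δ) / (δ * τ) * Real.exp (τ ^ 2 * δ ^ 2)) with hCa
  have hCa0 : 0 < Ca := by positivity
  -- Below p₀ the working interval may be too short; the zero polynomial serves these finitely many
  -- degrees, at the cost of `Cs`.
  set p₀ := ⌈(R₀ * δ) ^ 2 / 0.94⌉₊ + 1 with hp₀
  set Cs := C₂ * Real.exp (τ * δ * √p₀)
  refine ⟨Ca + (4 * K + C₂) * Cb + Cs, by positivity, fun p g M hM hg => ?_⟩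
  rcases lt_or_ge p p₀ with hp | hp
  · refine ⟨_, isPolynomialMap_zero p, fun t ht => ?_⟩
    rw [sub_zero]
    have e1 : C₂ ≤ Cs * Real.exp (-(τ * δ * √p)) := by
      rw [mul_assoc, ← Real.exp_add]
      refine le_mul_of_one_le_right (by positivity) (Real.one_le_exp ?_)
      have : √(p : ℝ) ≤ √(p₀ : ℝ) := Real.sqrt_le_sqrt (by exact_mod_cast hp.le)
      have := mul_le_mul_of_nonneg_left this (by positivity : 0 ≤ τ * δ)
      linarith
    calc ‖g t‖ ≤ M * Real.exp (α * |t|) := hg.norm_apply_le ht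
      _ ≤ M * (C₂ * Real.exp (0.4895 * (δ * t) ^ 2)) := by gcongr; exact hC₂ t
      _ ≤ M * ((Cs * Real.exp (-(τ * δ * √p))) * Real.exp (0.495 * (δ * t) ^ 2)) := by
        gcongr
        norm_num
      _ = Cs * M * Real.exp (-(τ * δ * √p)) * Real.exp (0.495 * (δ * t) ^ 2) := by ring
      _ ≤ _ := by
        gcongr
        exact le_add_of_nonneg_left (by positivity)
  · have hp0 : 0 < p := by omega
    obtain ⟨c, hsub, hc, hcase⟩ := hR₀ (√(0.94 * p) / δ) (by
      rw [le_div_iff₀ hδ]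
      refine (le_abs_self _).trans (Real.abs_le_sqrt ?_)
      have e1 : (p₀ : ℝ) ≤ p := by exact_mod_cast hp
      have e2 := Nat.le_ceil ((R₀ * δ) ^ 2 / 0.94)
      rw [div_le_iff₀ (by norm_num)] at e2
      have e3 : (p₀ : ℝ) = ⌈(R₀ * δ) ^ 2 / 0.94⌉₊ + 1 := by rw [hp₀]; push_cast; rfl
      linarith)
    obtain ⟨P, hP, hPt⟩ := hg.exists_polynomial_approx_aux hΓ hΓ' hα hγ hτ hδ hττ' h1' hK hC₂ hp0 rfl
      hsub hc hcase hM
    refine ⟨P, hP, fun t ht => (hPt t ht).trans ?_⟩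
    set x := √(p : ℝ)
    have hx2 : x ^ 2 = p := Real.sq_sqrt (by positivity)
    have hx0 : 0 ≤ x := Real.sqrt_nonneg _
    have e1 : 2 * K * (x / (δ * τ) * Real.exp (τ ^ 2 * δ ^ 2)) * Real.exp (-(1.02 * τ * δ * x)) ≤
        Ca * Real.exp (-(τ * δ * x)) := by
      have f1 : Real.exp (-(1.02 * τ * δ * x)) =
          Real.exp (-(0.02 * τ * δ * x)) * Real.exp (-(τ * δ * x)) := by
        rw [← Real.exp_add]; congr 1; ring
      have f2 : x * Real.exp (-(0.02 * τ * δ * x)) ≤ 1 / (0.02 * τ * δ) := by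
        rw [Real.exp_neg, ← div_eq_mul_inv, div_le_div_iff₀ (Real.exp_pos _) (by positivity)]
        have := Real.add_one_le_exp (0.02 * τ * δ * x)
        linarith
      calc _ = 2 * K * ((x * Real.exp (-(0.02 * τ * δ * x))) / (δ * τ) *
            Real.exp (τ ^ 2 * δ ^ 2)) * Real.exp (-(τ * δ * x)) := by rw [f1]; ring
        _ ≤ _ := by rw [hCa]; gcongr
    have e2 : (4 * K + C₂) * (p + 1) * Real.exp (-(0.0017 * p)) ≤
        (4 * K + C₂) * Cb * Real.exp (-(τ * δ * x)) := by
      have f1 := hCb x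
      rw [Real.exp_add, hx2] at f1
      have f2 : ((p : ℝ) + 1) * Real.exp (-(0.0017 * p)) ≤ Cb * Real.exp (-(τ * δ * x)) := by
        rw [Real.exp_neg (τ * δ * x), ← div_eq_mul_inv, le_div_iff₀ (Real.exp_pos _)]
        linarith
      rw [mul_assoc, mul_assoc]
      gcongr
    have hCs : 0 ≤ Cs * Real.exp (-(τ * δ * x)) := by positivity
    calc _ ≤ M * Real.exp (0.495 * (δ * t) ^ 2) * (Ca * Real.exp (-(τ * δ * x)) +
          (4 * K + C₂) * Cb * Real.exp (-(τ * δ * x)) + Cs * Real.exp (-(τ * δ * x))) := by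
          refine mul_le_mul_of_nonneg_left ?_ (by positivity)
          linarith
      _ = _ := by ring

end Approximation

end

noncomputable section

/-! ### Sign of the Hermite interpolation remainder of even powers -/

section HermiteSign

open Polynomial

theorem iterate_derivative_monic {q : ℝ[X]} {n : ℕ} (hq : q.Monic) (hn : q.natDegree = n) :
    derivative^[n] q = C (n.factorial : ℝ) := by
  have h1 : (q - X ^ n).degree < (n : WithBot ℕ) := by
    have h2 : q.degree = (X ^ n : ℝ[X]).degree := by
      rw [degree_X_pow, degree_eq_natDegree hq.ne_zero, hn]
    refine (degree_sub_lt_left h2 hq.ne_zero (by rw [hq.leadingCoeff, leadingCoeff_X_pow])).trans_eq ?_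
    rw [h2, degree_X_pow]
  have h3 : derivative^[n] (q - X ^ n) = 0 := by
    rcases eq_or_ne (q - X ^ n) 0 with h | h
    · rw [h, iterate_derivative_zero]
    · exact iterate_derivative_eq_zero ((natDegree_lt_iff_degree_lt h).2 h1)
  rw [iterate_derivative_sub, sub_eq_zero] at h3
  rw [h3, iterate_derivative_X_pow_eq_smul, Nat.descFactorial_self]
  simp [Algebra.smul_def]

theorem card_roots_le_iterate_derivative (f : ℝ[X]) (n : ℕ) :
    f.roots.card ≤ (derivative^[n] f).roots.card + n := by
  induction n with
  | zero => simp
  | succ n ih =>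
    rw [Function.iterate_succ_apply']
    have := card_roots_le_derivative (derivative^[n] f)
    omega

/-- If `q` has only real roots, the quotient of an even power of `X` by `q²` is nonnegative. -/
theorem eval_X_pow_divByMonic_sq_nonneg {q : ℝ[X]} (hq : q.Monic)
    (hroots : q.roots.card = q.natDegree) (k : ℕ) (t : ℝ) :
    0 ≤ ((X ^ (2 * k) : ℝ[X]) /ₘ (q ^ 2)).eval t := by
  set n := q.natDegree
  have hq2 : (q ^ 2).Monic := hq.pow 2
  have hq2d : (q ^ 2).natDegree = 2 * n := natDegree_pow q 2
  set K := (X ^ (2 * k) : ℝ[X]) /ₘ (q ^ 2) with hK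
  set H := (X ^ (2 * k) : ℝ[X]) %ₘ (q ^ 2) with hH
  have hdiv : H + q ^ 2 * K = X ^ (2 * k) := modByMonic_add_div _ _
  have hHd : derivative^[2 * n] H = 0 := by
    rcases eq_or_ne H 0 with h | h
    · rw [h, iterate_derivative_zero]
    · refine iterate_derivative_eq_zero ?_
      rw [← hq2d]
      exact natDegree_lt_natDegree h (degree_modByMonic_lt _ hq2)
  -- If φ ≠ 0, it has at least 2n + 1 real zeros with multiplicity, so Rolle gives a zero ξ of its
  -- 2n-th derivative. There K(t) (2n)! equals a falling factorial times an even power of ξ. This is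
  -- the error formula for Hermite interpolation.
  set φ := q ^ 2 * (K - C (K.eval t)) with hφ
  have hφ' : φ = X ^ (2 * k) - H - C (K.eval t) * q ^ 2 := by
    rw [hφ, ← hdiv]; ring
  have hd : derivative^[2 * n] φ = C (((2 * k).descFactorial (2 * n) : ℕ) : ℝ) * X ^ (2 * k - 2 * n) -
      C (K.eval t * ((2 * n).factorial : ℝ)) := by
    rw [hφ', iterate_derivative_sub, iterate_derivative_sub, hHd, sub_zero, iterate_derivative_C_mul,
      iterate_derivative_monic hq2 hq2d, iterate_derivative_X_pow_eq_smul, C_mul]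
    simp [Algebra.smul_def]
  have hex : ∃ ξ, (derivative^[2 * n] φ).eval ξ = 0 := by
    rcases eq_or_ne φ 0 with h | h
    · exact ⟨0, by rw [h, iterate_derivative_zero, eval_zero]⟩
    · have h1 : φ.roots.card = 2 * n + (K - C (K.eval t)).roots.card := by
        rw [hφ, roots_mul (hφ ▸ h), Multiset.card_add, roots_pow, Multiset.card_nsmul, hroots]
      have hne : K - C (K.eval t) ≠ 0 := right_ne_zero_of_mul (hφ ▸ h)
      have h2 : 0 < (K - C (K.eval t)).roots.card :=
        Multiset.card_pos_iff_exists_mem.2 ⟨t, (mem_roots hne).2 (by simp)⟩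
      have h3 := card_roots_le_iterate_derivative φ (2 * n)
      have h4 : 0 < (derivative^[2 * n] φ).roots.card := by omega
      obtain ⟨ξ, hξ⟩ := Multiset.card_pos_iff_exists_mem.1 h4
      exact ⟨ξ, isRoot_of_mem_roots hξ⟩
  obtain ⟨ξ, hξ⟩ := hex
  rw [hd] at hξ
  simp only [eval_sub, eval_mul, eval_C, eval_pow, eval_X] at hξ
  -- Truncated subtraction keeps the exponent even when k < n, where the falling factorial vanishes
  -- anyway.
  have hev : 0 ≤ ξ ^ (2 * k - 2 * n) := by
    rw [← Nat.mul_sub]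
    exact (even_two_mul _).pow_nonneg ξ
  have h5 : 0 ≤ (((2 * k).descFactorial (2 * n) : ℕ) : ℝ) * ξ ^ (2 * k - 2 * n) := by positivity
  have h6 : (0 : ℝ) < ((2 * n).factorial : ℝ) := by positivity
  have h7 : 0 ≤ K.eval t * ((2 * n).factorial : ℝ) := by linarith
  exact nonneg_of_mul_nonneg_left h7 h6

end HermiteSign

/-! ### Gauss quadrature at the collocation points -/

section GaussQuadrature

open Polynomial

variable {S : Set ℝ} {w : ℝ → ℝ} {p : ℕ} {x : Fin (p + 1) → ℝ}

/-- The weights of the quadrature formula at the points `x`. -/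
def gaussWeight (S : Set ℝ) (w : ℝ → ℝ) (x : Fin (p + 1) → ℝ) (j : Fin (p + 1)) : ℝ :=
  ∫ t in S, (Lagrange.basis Finset.univ x j).eval t ^ 2 * w t

/-- A monic polynomial of degree p + 1 with p + 1 distinct prescribed roots is the nodal polynomial,
which therefore inherits the orthogonality. -/
theorem IsOrthogonalZeros.integral_nodal_mul (h : IsOrthogonalZeros S w p x) {g : ℝ[X]}
    (hg : g.natDegree ≤ p) :
    ∫ t in S, (Lagrange.nodal Finset.univ x * g).eval t * w t = 0 := by
  obtain ⟨hx, q, hq, hqd, horth, hroot⟩ := h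
  have : q = Lagrange.nodal Finset.univ x := by
    refine eq_of_degree_sub_lt_of_eval_index_eq Finset.univ hx.injOn ?_ fun j hj => ?_
    · have h1 : q.degree = (Lagrange.nodal Finset.univ x).degree := by
        rw [Lagrange.degree_nodal, degree_eq_natDegree hq.ne_zero, hqd]
        simp
      refine (degree_sub_lt_left h1 hq.ne_zero
        (by rw [hq.leadingCoeff, Lagrange.nodal_monic.leadingCoeff])).trans_eq ?_
      rw [h1, Lagrange.degree_nodal]
    · rw [Lagrange.eval_nodal_at_node hj]
      exact hroot j
  rw [← this]
  simpa only [eval_mul] using horth g hg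

/-- The zeros of an orthogonal polynomial lie in the interval. -/
theorem IsOrthogonalZeros.mem (h : IsOrthogonalZeros S w p x) (hS : S.OrdConnected)
    (hSm : MeasurableSet S) (hS0 : volume S ≠ 0) (hw : ∀ t ∈ S, 0 < w t)
    (hint : ∀ Q : ℝ[X], IntegrableOn (fun t => Q.eval t * w t) S) (i : Fin (p + 1)) : x i ∈ S := by
  by_contra hi
  set g := Lagrange.nodal (Finset.univ.erase i) x with hg
  have hgd : g.natDegree ≤ p := by simp [hg, Lagrange.natDegree_nodal]
  have hgne : g ≠ 0 := Lagrange.nodal_ne_zero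
  -- If the node were outside the interval, this product would have constant sign there, although
  -- orthogonality makes its integral zero.
  have hfac : Lagrange.nodal Finset.univ x * g = (X - C (x i)) * g ^ 2 := by
    rw [Lagrange.nodal_eq_mul_nodal_erase (Finset.mem_univ i)]; ring
  have h0 := h.integral_nodal_mul hgd
  rw [hfac] at h0
  have key : ∀ s : ℝ, s ≠ 0 → (∀ t ∈ S, 0 < s * (t - x i)) → False := by
    intro s hs hpos
    have h1 : ∫ t in S, s * (((X - C (x i)) * g ^ 2).eval t * w t) = 0 := by
      rw [integral_const_mul, h0, mul_zero]
    rw [setIntegral_eq_zero_iff_of_nonneg_ae ?_ ((hint _).const_mul s)] at h1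
    · have h2 : ∀ᵐ t ∂volume.restrict S, g.IsRoot t := by
        filter_upwards [h1, ae_restrict_mem hSm] with t ht htS
        simp only [eval_mul, eval_sub, eval_X, eval_C, eval_pow, Pi.zero_apply] at ht
        have h3 : (s * (t - x i) * w t) * g.eval t ^ 2 = 0 := by linarith
        rcases mul_eq_zero.1 h3 with h4 | h4
        · exact absurd h4 (mul_pos (hpos t htS) (hw t htS)).ne'
        · exact pow_eq_zero_iff two_ne_zero |>.1 h4
      have h3 : volume.restrict S {t | g.IsRoot t} = 0 :=
        measure_mono_null subset_rfl (((finite_setOfPred_isRoot hgne).countable.measure_zero _))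
      have h4 : volume.restrict S univ = 0 := by
        refine measure_mono_null (fun t _ => ?_) (measure_union_null h3 (ae_iff.1 h2))
        by_cases ht : g.IsRoot t
        · exact .inl ht
        · exact .inr ht
      rw [Measure.restrict_apply_univ] at h4
      exact hS0 h4
    · filter_upwards [ae_restrict_mem hSm] with t htS
      simp only [eval_mul, eval_sub, eval_X, eval_C, eval_pow, Pi.zero_apply]
      have := mul_nonneg (mul_pos (hpos t htS) (hw t htS)).le (sq_nonneg (g.eval t))
      linarith
  by_cases hlt : ∃ a ∈ S, a < x i
  · obtain ⟨a, ha, hai⟩ := hlt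
    refine key (-1) (by norm_num) fun t ht => ?_
    have : t < x i := by
      by_contra hc
      exact hi (hS.out ha ht ⟨hai.le, not_lt.1 hc⟩)
    linarith
  · push Not at hlt
    refine key 1 one_ne_zero fun t ht => ?_
    have : t ≠ x i := fun h => hi (h ▸ ht)
    have := lt_of_le_of_ne (hlt t ht) this.symm
    linarith

/-- Exactness of the quadrature formula up to degree `2 p + 1`, in the form needed for polynomials
vanishing at the nodes. -/
theorem IsOrthogonalZeros.integral_eq_zero (h : IsOrthogonalZeros S w p x) {Q : ℝ[X]}
    (hQ : Q.natDegree ≤ 2 * p + 1) (hQx : ∀ j, Q.eval (x j) = 0) :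
    ∫ t in S, Q.eval t * w t = 0 := by
  set q := Lagrange.nodal Finset.univ x with hq
  have hqm : q.Monic := Lagrange.nodal_monic
  have hqd : q.natDegree = p + 1 := by simp [hq, Lagrange.natDegree_nodal]
  have hr : Q %ₘ q = 0 := by
    refine eq_zero_of_degree_lt_of_eval_index_eq_zero Finset.univ h.1.injOn ?_ fun j hj => ?_
    · refine (degree_modByMonic_lt Q hqm).trans_eq ?_
      rw [hq, Lagrange.degree_nodal]
    · have := congrArg (eval (x j)) (modByMonic_add_div Q q)
      rw [eval_add, eval_mul, hQx, hq, Lagrange.eval_nodal_at_node hj] at this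
      simpa using this
  have hQq : q * (Q /ₘ q) = Q := by
    have := modByMonic_add_div Q q
    rwa [hr, zero_add] at this
  rw [← hQq]
  refine h.integral_nodal_mul ?_
  rw [natDegree_divByMonic _ hqm, hqd]
  omega

theorem natDegree_lagrange_basis (hx : Function.Injective x) (j : Fin (p + 1)) :
    (Lagrange.basis Finset.univ x j).natDegree = p := by
  rw [Lagrange.natDegree_basis hx.injOn (Finset.mem_univ j)]
  simp

theorem eval_lagrange_basis (hx : Function.Injective x) (i j : Fin (p + 1)) :
    (Lagrange.basis Finset.univ x i).eval (x j) = if i = j then 1 else 0 := by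
  split_ifs with hij
  · subst hij
    exact Lagrange.eval_basis_self hx.injOn (Finset.mem_univ i)
  · exact Lagrange.eval_basis_of_ne hij (Finset.mem_univ j)

/-- The combination ∑ Q(x_j) ℓ_j² has degree at most 2p and agrees with Q at the nodes, so the two
have the same integral. Using squares of the Lagrange basis makes the weights visibly nonnegative.
-/
theorem IsOrthogonalZeros.integral_eq_sum (h : IsOrthogonalZeros S w p x)
    (hint : ∀ Q : ℝ[X], IntegrableOn (fun t => Q.eval t * w t) S) {Q : ℝ[X]}
    (hQ : Q.natDegree ≤ 2 * p + 1) :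
    ∫ t in S, Q.eval t * w t = ∑ j, Q.eval (x j) * gaussWeight S w x j := by
  set L : ℝ[X] := ∑ j, C (Q.eval (x j)) * Lagrange.basis Finset.univ x j ^ 2 with hL
  have hLd : L.natDegree ≤ 2 * p + 1 := by
    refine natDegree_sum_le_of_forall_le _ _ fun j _ => ?_
    refine (natDegree_C_mul_le _ _).trans (natDegree_pow_le.trans ?_)
    rw [natDegree_lagrange_basis h.1]
    omega
  have h0 := h.integral_eq_zero (Q := Q - L) ((natDegree_sub_le _ _).trans (max_le hQ hLd))
    (fun j => by
      rw [eval_sub, hL, eval_finsetSum]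
      simp [eval_lagrange_basis h.1])
  simp only [eval_sub, sub_mul] at h0
  rw [integral_sub (hint Q) (hint L), sub_eq_zero] at h0
  rw [h0, hL]
  simp only [eval_finsetSum, Finset.sum_mul, eval_mul, eval_C, eval_pow, gaussWeight,
    ← integral_const_mul]
  rw [integral_finsetSum]
  · simp only [mul_assoc]
  · intro j _
    have := (hint (Lagrange.basis Finset.univ x j ^ 2)).const_mul (Q.eval (x j))
    simpa only [eval_pow, mul_assoc] using this

/-- Divide an even power by the squared nodal polynomial: the remainder is integrated exactly and
the quotient is nonnegative, so quadrature underestimates the moment. The exponential is a limit of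
nonnegative combinations of even powers, which gives a bound uniform in p. -/
theorem IsOrthogonalZeros.sum_gaussWeight_mul_exp_le (h : IsOrthogonalZeros S w p x)
    (hSm : MeasurableSet S) (hw : ∀ t ∈ S, 0 < w t)
    (hint : ∀ Q : ℝ[X], IntegrableOn (fun t => Q.eval t * w t) S) {c : ℝ} (hc : 0 ≤ c)
    (hexp : IntegrableOn (fun t => Real.exp (c * t ^ 2) * w t) S) :
    ∑ j, gaussWeight S w x j * Real.exp (c * x j ^ 2) ≤
      ∫ t in S, Real.exp (c * t ^ 2) * w t := by
  have hpow : ∀ k : ℕ, ∑ j, gaussWeight S w x j * x j ^ (2 * k) ≤ ∫ t in S, t ^ (2 * k) * w t := by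
    intro k
    set q := Lagrange.nodal Finset.univ x with hq
    have hqm : q.Monic := Lagrange.nodal_monic
    have hqd : q.natDegree = p + 1 := by simp [hq, Lagrange.natDegree_nodal]
    have hroots : q.roots.card = q.natDegree := by
      have : q = ((Finset.univ.val.map x).map fun a => X - C a).prod := by
        rw [hq, Lagrange.nodal, Multiset.map_map]; rfl
      rw [hqd]
      conv_lhs => rw [this, roots_multiset_prod_X_sub_C]
      simp
    set K := (X ^ (2 * k) : ℝ[X]) /ₘ (q ^ 2)
    set H := (X ^ (2 * k) : ℝ[X]) %ₘ (q ^ 2)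
    have hdiv : H + q ^ 2 * K = X ^ (2 * k) := modByMonic_add_div _ _
    have hHd : H.natDegree ≤ 2 * p + 1 := by
      rcases eq_or_ne H 0 with h0 | h0
      · simp [h0]
      · have := natDegree_lt_natDegree h0 (degree_modByMonic_lt (X ^ (2 * k)) (hqm.pow 2))
        rw [natDegree_pow, hqd] at this
        omega
    have hHx : ∀ j, H.eval (x j) = x j ^ (2 * k) := by
      intro j
      have := congrArg (eval (x j)) hdiv
      rw [eval_add, eval_mul, eval_pow, hq, Lagrange.eval_nodal_at_node (Finset.mem_univ j)] at this
      simpa using this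
    have h1 := h.integral_eq_sum hint hHd
    simp only [hHx] at h1
    have h2 : ∑ j, gaussWeight S w x j * x j ^ (2 * k) = ∫ t in S, H.eval t * w t := by
      rw [h1]; exact Finset.sum_congr rfl fun j _ => mul_comm _ _
    rw [h2]
    have h3 := hint (X ^ (2 * k))
    simp only [eval_pow, eval_X] at h3
    refine setIntegral_mono_on (hint H) h3 hSm fun t ht => ?_
    refine mul_le_mul_of_nonneg_right ?_ (hw t ht).le
    have := congrArg (eval t) hdiv
    simp only [eval_add, eval_mul, eval_pow, eval_X] at this
    rw [← this]
    have h4 := eval_X_pow_divByMonic_sq_nonneg hqm hroots k t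
    exact le_add_of_nonneg_right (mul_nonneg (sq_nonneg _) h4)
  have hsum : ∀ y : ℝ, HasSum (fun n : ℕ => y ^ n / (n.factorial : ℝ)) (Real.exp y) := fun y => by
    rw [Real.exp_eq_exp_ℝ]; exact NormedSpace.expSeries_div_hasSum_exp y
  have hlim : Filter.Tendsto (fun n => ∑ j, gaussWeight S w x j *
      ∑ k ∈ Finset.range n, (c * x j ^ 2) ^ k / (k.factorial : ℝ)) Filter.atTop
      (nhds (∑ j, gaussWeight S w x j * Real.exp (c * x j ^ 2))) :=
    tendsto_finsetSum _ fun j _ => (hsum _).tendsto_sum_nat.const_mul _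
  refine le_of_tendsto' hlim fun n => ?_
  have hint2 : ∀ k : ℕ, IntegrableOn (fun t => c ^ k / (k.factorial : ℝ) * (t ^ (2 * k) * w t)) S := by
    intro k
    have h1 := hint (X ^ (2 * k))
    simp only [eval_pow, eval_X] at h1
    exact h1.const_mul (c ^ k / (k.factorial : ℝ))
  calc ∑ j, gaussWeight S w x j * ∑ k ∈ Finset.range n, (c * x j ^ 2) ^ k / (k.factorial : ℝ)
      = ∑ k ∈ Finset.range n, c ^ k / (k.factorial : ℝ) *
          ∑ j, gaussWeight S w x j * x j ^ (2 * k) := by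
        simp only [Finset.mul_sum]
        rw [Finset.sum_comm]
        refine Finset.sum_congr rfl fun k _ => Finset.sum_congr rfl fun j _ => ?_
        rw [mul_pow, ← pow_mul]
        ring
    _ ≤ ∑ k ∈ Finset.range n, c ^ k / (k.factorial : ℝ) * ∫ t in S, t ^ (2 * k) * w t := by
        gcongr with k _
        exact hpow k
    _ = ∫ t in S, ∑ k ∈ Finset.range n, c ^ k / (k.factorial : ℝ) * (t ^ (2 * k) * w t) := by
        rw [integral_finsetSum _ fun k _ => hint2 k]
        simp only [integral_const_mul]
    _ ≤ _ := by
        refine setIntegral_mono_on (integrable_finsetSum _ fun k _ => hint2 k) hexp hSm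
          fun t ht => ?_
        have := Real.sum_le_exp_of_nonneg (by positivity : 0 ≤ c * t ^ 2) n
        refine le_trans (le_of_eq ?_) (mul_le_mul_of_nonneg_right this (hw t ht).le)
        rw [Finset.sum_mul]
        refine Finset.sum_congr rfl fun k _ => ?_
        rw [mul_pow, ← pow_mul]
        ring

variable {V : Type*} [NormedAddCommGroup V] [InnerProductSpace ℝ V]

theorem norm_sum_smul_sq {n : ℕ} (c : Fin n → ℝ) (a : Fin n → V) :
    ‖∑ j, c j • a j‖ ^ 2 = ∑ i, ∑ j, inner ℝ (a i) (a j) * (c i * c j) := by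
  rw [← real_inner_self_eq_norm_sq, sum_inner]
  refine Finset.sum_congr rfl fun i _ => ?_
  rw [inner_sum]
  refine Finset.sum_congr rfl fun j _ => ?_
  rw [real_inner_smul_left, real_inner_smul_right]
  ring

theorem IsOrthogonalZeros.integrableOn_norm_sq
    (hint : ∀ Q : ℝ[X], IntegrableOn (fun t => Q.eval t * w t) S) (a : Fin (p + 1) → V) :
    IntegrableOn (fun t => ‖∑ j, (Lagrange.basis Finset.univ x j).eval t • a j‖ ^ 2 * w t) S := by
  simp only [norm_sum_smul_sq, Finset.sum_mul]
  refine integrable_finsetSum _ fun i _ => integrable_finsetSum _ fun j _ => ?_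
  have := (hint (Lagrange.basis Finset.univ x i * Lagrange.basis Finset.univ x j)).const_mul
    (inner ℝ (a i) (a j))
  simpa only [eval_mul, mul_assoc] using this

/-- The Lagrange basis at the zeros of an orthogonal polynomial is orthogonal. -/
theorem IsOrthogonalZeros.integral_norm_sq (h : IsOrthogonalZeros S w p x)
    (hint : ∀ Q : ℝ[X], IntegrableOn (fun t => Q.eval t * w t) S) (a : Fin (p + 1) → V) :
    ∫ t in S, ‖∑ j, (Lagrange.basis Finset.univ x j).eval t • a j‖ ^ 2 * w t =
      ∑ j, gaussWeight S w x j * ‖a j‖ ^ 2 := by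
  set Q : ℝ[X] := ∑ i, ∑ j, C (inner ℝ (a i) (a j)) *
    (Lagrange.basis Finset.univ x i * Lagrange.basis Finset.univ x j) with hQ
  have hQe : ∀ t, Q.eval t = ‖∑ j, (Lagrange.basis Finset.univ x j).eval t • a j‖ ^ 2 := by
    intro t
    rw [norm_sum_smul_sq, hQ]
    simp only [eval_finsetSum, eval_mul, eval_C]
  have hQd : Q.natDegree ≤ 2 * p + 1 := by
    refine natDegree_sum_le_of_forall_le _ _ fun i _ =>
      natDegree_sum_le_of_forall_le _ _ fun j _ => ?_
    refine (natDegree_C_mul_le _ _).trans (natDegree_mul_le.trans ?_)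
    rw [natDegree_lagrange_basis h.1, natDegree_lagrange_basis h.1]
    omega
  have := h.integral_eq_sum hint hQd
  simp only [hQe] at this
  rw [this]
  refine Finset.sum_congr rfl fun j _ => ?_
  simp [eval_lagrange_basis h.1, mul_comm]

theorem gaussWeight_nonneg (hSm : MeasurableSet S) (hw : ∀ t ∈ S, 0 < w t) (j : Fin (p + 1)) :
    0 ≤ gaussWeight S w x j :=
  setIntegral_nonneg hSm fun t ht => mul_nonneg (sq_nonneg _) (hw t ht).le

end GaussQuadrature

end

noncomputable section

/-! ### Interpolation error in one variable -/

section OneDimensional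

/-- The measure `exp (-(δ t)²) dt` on `Γ`. -/
def gaussianOn (Γ : Set ℝ) (δ : ℝ) : Measure ℝ :=
  (volume.restrict Γ).withDensity fun t => ENNReal.ofReal (Real.exp (-(δ * t) ^ 2))

open Classical in
/-- The exponent of `p` in the convergence rate. -/
def rateExponent (Γ : Set ℝ) : ℝ := if Bornology.IsBounded Γ then 1 else 1 / 2

open Classical in
/-- The constant in the convergence rate. -/
def rateConstant (Γ : Set ℝ) (τ δ : ℝ) : ℝ :=
  if Bornology.IsBounded Γ then
    Real.log (2 * τ / (volume Γ).toReal *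
      (1 + Real.sqrt (1 + (volume Γ).toReal ^ 2 / (4 * τ ^ 2))))
  else τ * δ

/-- The factor `exp (-b p ^ θ)`. -/
def rate (Γ : Set ℝ) (τ δ : ℝ) (p : ℕ) : ℝ :=
  Real.exp (-(rateConstant Γ τ δ * (p : ℝ) ^ rateExponent Γ))

variable {Γ : Set ℝ} {δ α γ τ : ℝ}

theorem exists_lt_of_volume_ne_zero (hΓ0 : volume Γ ≠ 0) : ∃ a ∈ Γ, ∃ b ∈ Γ, a < b := by
  by_contra! hc
  refine hΓ0 (Set.Subsingleton.measure_zero (fun a ha b hb => ?_) volume)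
  exact le_antisymm (hc b hb a ha) (hc a ha b hb)

theorem uniqueDiffOn_of_ordConnected (hΓ : Γ.OrdConnected) (hΓ0 : volume Γ ≠ 0) :
    UniqueDiffOn ℝ Γ := by
  obtain ⟨a, ha, b, hb, hab⟩ := exists_lt_of_volume_ne_zero hΓ0
  refine uniqueDiffOn_convex hΓ.convex ⟨(a + b) / 2, ?_⟩
  exact mem_interior.2 ⟨Ioo a b, Ioo_subset_Icc_self.trans (hΓ.out ha hb), isOpen_Ioo,
    ⟨by linarith, by linarith⟩⟩

theorem exists_endpoints (hΓ : Γ.OrdConnected) (hΓ0 : volume Γ ≠ 0) (hb : Bornology.IsBounded Γ) :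
    ∃ c h : ℝ, 0 < h ∧ Ioo (c - h) (c + h) ⊆ Γ ∧ Γ ⊆ Icc (c - h) (c + h) ∧
      (volume Γ).toReal = 2 * h := by
  obtain ⟨a, ha, b, hb', hab⟩ := exists_lt_of_volume_ne_zero hΓ0
  obtain ⟨h1, h2⟩ := isBounded_iff_bddBelow_bddAbove.1 hb
  have hlt : sInf Γ < sSup Γ := (csInf_le h1 ha).trans_lt (hab.trans_le (le_csSup h2 hb'))
  have e1 : (sInf Γ + sSup Γ) / 2 - (sSup Γ - sInf Γ) / 2 = sInf Γ := by ring
  have e2 : (sInf Γ + sSup Γ) / 2 + (sSup Γ - sInf Γ) / 2 = sSup Γ := by ring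
  have hsub : Ioo (sInf Γ) (sSup Γ) ⊆ Γ := by
    intro t ht
    obtain ⟨y, hy, hyt⟩ := exists_lt_of_csInf_lt ⟨a, ha⟩ ht.1
    obtain ⟨z, hz, htz⟩ := exists_lt_of_lt_csSup ⟨a, ha⟩ ht.2
    exact hΓ.out hy hz ⟨hyt.le, htz.le⟩
  have hsup : Γ ⊆ Icc (sInf Γ) (sSup Γ) := fun t ht => ⟨csInf_le h1 ht, le_csSup h2 ht⟩
  refine ⟨(sInf Γ + sSup Γ) / 2, (sSup Γ - sInf Γ) / 2, by linarith, ?_⟩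
  rw [e1, e2]
  refine ⟨hsub, hsup, ?_⟩
  have : volume Γ = ENNReal.ofReal (sSup Γ - sInf Γ) := by
    refine le_antisymm ?_ ?_
    · rw [← Real.volume_Icc]; exact measure_mono hsup
    · rw [← Real.volume_Ioo]; exact measure_mono hsub
  rw [this, ENNReal.toReal_ofReal (by linarith)]
  ring

/-- The expression is τ/h + √(1 + τ²/h²), the root above 1 of ϱ - ϱ⁻¹ = 2τ/h; its inverse has s - 1
in place of 1 + s. -/
theorem ellipse_parameter {h : ℝ} (hh : 0 < h) (hτ : 0 < τ) :
    1 < 2 * τ / (2 * h) * (1 + √(1 + (2 * h) ^ 2 / (4 * τ ^ 2))) ∧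
    h * (2 * τ / (2 * h) * (1 + √(1 + (2 * h) ^ 2 / (4 * τ ^ 2))) -
      (2 * τ / (2 * h) * (1 + √(1 + (2 * h) ^ 2 / (4 * τ ^ 2))))⁻¹) / 2 = τ := by
  set s := √(1 + (2 * h) ^ 2 / (4 * τ ^ 2)) with hs
  have hs2 : s ^ 2 = 1 + (2 * h) ^ 2 / (4 * τ ^ 2) := Real.sq_sqrt (by positivity)
  have hs0 : 0 ≤ s := Real.sqrt_nonneg _
  set ϱ := 2 * τ / (2 * h) * (1 + s) with hϱ
  have hϱ0 : 0 < ϱ := by positivity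
  have hinv : ϱ⁻¹ = 2 * τ / (2 * h) * (s - 1) := by
    refine inv_eq_of_mul_eq_one_right ?_
    have : ϱ * (2 * τ / (2 * h) * (s - 1)) = (2 * τ / (2 * h)) ^ 2 * (s ^ 2 - 1) := by rw [hϱ]; ring
    rw [this, hs2]
    field_simp
    ring
  have hsub : ϱ - ϱ⁻¹ = 2 * (τ / h) := by
    rw [hinv, hϱ]; field_simp; ring
  constructor
  · by_contra hc
    have : 1 ≤ ϱ⁻¹ := (one_le_inv₀ hϱ0).2 (not_lt.1 hc)
    have : 0 < τ / h := by positivity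
    linarith
  · rw [hsub]; field_simp

theorem rateConstant_pos (hΓ : Γ.OrdConnected) (hΓ0 : volume Γ ≠ 0) (hτ : 0 < τ)
    (hδu : ¬ Bornology.IsBounded Γ → 0 < δ) : 0 < rateConstant Γ τ δ := by
  unfold rateConstant
  split_ifs with hb
  · obtain ⟨c, h, hh, -, -, hv⟩ := exists_endpoints hΓ hΓ0 hb
    rw [hv]
    exact Real.log_pos (ellipse_parameter hh hτ).1
  · have := hδu hb
    positivity

variable (V : Type*) [NormedAddCommGroup V] [InnerProductSpace ℝ V] [CompleteSpace V]

/-- Both kinds of interval in one form: on a bounded one δ = 0, the Gaussian factor is 1 and the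
rate is ϱ^(-p). -/
theorem exists_polynomial_approx (hΓ : Γ.OrdConnected) (hΓ0 : volume Γ ≠ 0)
    (hδb : Bornology.IsBounded Γ → δ = 0) (hδu : ¬ Bornology.IsBounded Γ → 0 < δ)
    (hα : 0 ≤ α) (hαb : Bornology.IsBounded Γ → α = 0) (hγ : 0 ≤ γ) (hτ : 0 < τ)
    (h1 : τ * γ < 1) :
    ∃ C : ℝ, 0 < C ∧ ∀ (p : ℕ) (g : ℝ → V) (M : ℝ), 0 ≤ M → HasAnalyticBound Γ g M α γ →
      ∃ P : ℝ → V, IsPolynomialMap p P ∧ ∀ t ∈ Γ, ‖g t - P t‖ ≤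
        C * M * rate Γ τ δ p * Real.exp (0.495 * (δ * t) ^ 2) := by
  have hΓu := uniqueDiffOn_of_ordConnected hΓ hΓ0
  rw [mul_comm] at h1
  by_cases hb : Bornology.IsBounded Γ
  · obtain ⟨c, h, hh, hsub, hsup, hv⟩ := exists_endpoints hΓ hΓ0 hb
    obtain ⟨hϱ1, hϱ2⟩ := ellipse_parameter hh hτ
    obtain ⟨C, hC, hP⟩ := exists_polynomial_approx_of_subset_Icc V hΓu hΓ hγ hτ h1 hh hsub hsup hϱ1
      hϱ2.le
    refine ⟨C, hC, fun p g M hM hg => ?_⟩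
    rw [hαb hb] at hg
    obtain ⟨P, hP1, hP2⟩ := hP p g M hM hg
    refine ⟨P, hP1, fun t ht => (hP2 t ht).trans_eq ?_⟩
    simp only [rate, rateConstant, rateExponent, if_pos hb, hv, hδb hb]
    rw [Real.rpow_one, Real.exp_neg, Real.exp_mul, Real.exp_log (one_pos.trans hϱ1),
      Real.rpow_natCast, inv_pow]
    simp
  · obtain ⟨a, ha, -⟩ := exists_lt_of_volume_ne_zero hΓ0
    obtain ⟨C, hC, hP⟩ := exists_polynomial_approx_of_not_isBounded V hΓu hΓ ⟨a, ha⟩ hb hα hγ hτ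
      (hδu hb) h1
    refine ⟨C, hC, fun p g M hM hg => ?_⟩
    obtain ⟨P, hP1, hP2⟩ := hP p g M hM hg
    refine ⟨P, hP1, fun t ht => (hP2 t ht).trans_eq ?_⟩
    simp only [rate, rateConstant, rateExponent, if_neg hb]
    rw [← Real.sqrt_eq_rpow]

theorem integrableOn_eval_mul_exp
    (hδu : ¬ Bornology.IsBounded Γ → 0 < δ) (Q : Polynomial ℝ) :
    IntegrableOn (fun t => Q.eval t * Real.exp (-(0.01 * (δ * t) ^ 2))) Γ := by
  by_cases hb : Bornology.IsBounded Γ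
  · obtain ⟨R, hR⟩ := hb.subset_closedBall 0
    exact (((by fun_prop : Continuous fun t => Q.eval t * Real.exp (-(0.01 * (δ * t) ^ 2)))
      ).continuousOn.integrableOn_compact (isCompact_closedBall 0 R)).mono_set hR
  · have hδ := hδu hb
    refine Integrable.integrableOn ?_
    induction Q using Polynomial.induction_on' with
    | add P Q hP hQ =>
      simp only [Polynomial.eval_add, add_mul]
      exact hP.add hQ
    | monomial n a =>
      have h1 := (integrable_rpow_mul_exp_neg_mul_sq (b := 0.01 * δ ^ 2) (by positivity)
        (s := (n : ℝ)) (by have : (0 : ℝ) ≤ n := n.cast_nonneg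
                           linarith)).const_mul a
      refine h1.congr (.of_forall fun t => ?_)
      simp only [Polynomial.eval_monomial, Real.rpow_natCast]
      rw [mul_assoc]
      congr 3
      ring

theorem exists_exp_abs_le (hαb : Bornology.IsBounded Γ → α = 0)
    (hδu : ¬ Bornology.IsBounded Γ → 0 < δ) :
    ∃ C : ℝ, 0 < C ∧ ∀ t : ℝ, Real.exp (2 * α * |t|) ≤ C * Real.exp (0.99 * (δ * t) ^ 2) := by
  by_cases hb : Bornology.IsBounded Γ
  · refine ⟨1, one_pos, fun t => ?_⟩
    rw [hαb hb, one_mul, mul_zero, zero_mul, Real.exp_zero]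
    exact Real.one_le_exp (by positivity)
  · have hδ := hδu hb
    refine ⟨Real.exp ((2 * α) ^ 2 / (4 * (0.99 * δ ^ 2))), Real.exp_pos _, fun t => ?_⟩
    rw [← Real.exp_add, Real.exp_le_exp]
    have := mul_sub_sq_le (by positivity : 0 < 0.99 * δ ^ 2) (2 * α) |t|
    rw [sq_abs] at this
    linarith

/-- Only an upper bound is asserted, so F need not be measurable. -/
theorem lintegral_gaussianOn_le (hΓm : MeasurableSet Γ) {F : ℝ → ENNReal} {G : ℝ → ℝ}
    (hFG : ∀ t ∈ Γ, ENNReal.ofReal (Real.exp (-(δ * t) ^ 2)) * F t ≤ ENNReal.ofReal (G t))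
    (hG : IntegrableOn G Γ) (hG0 : ∀ t ∈ Γ, 0 ≤ G t) :
    ∫⁻ t, F t ∂gaussianOn Γ δ ≤ ENNReal.ofReal (∫ t in Γ, G t) := by
  rw [ofReal_integral_eq_lintegral_ofReal hG
    ((ae_restrict_iff' hΓm).2 (.of_forall fun t ht => hG0 t ht))]
  refine (lintegral_withDensity_le_lintegral_mul _ (by fun_prop) _).trans ?_
  exact setLIntegral_mono' hΓm fun t ht => hFG t ht

/-- One-dimensional interpolation at the zeros of an orthogonal polynomial: position of the nodes,
stability of the interpolation operator, and the interpolation error. -/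
theorem exists_interpolation_error (hΓ : Γ.OrdConnected) (hΓ0 : volume Γ ≠ 0)
    (hδb : Bornology.IsBounded Γ → δ = 0) (hδu : ¬ Bornology.IsBounded Γ → 0 < δ)
    {w : ℝ → ℝ} (hwm : AEMeasurable w (volume.restrict Γ)) {c c' : ℝ} (hc : 0 < c)
    (hw : ∀ t ∈ Γ, c * Real.exp (-(δ * t) ^ 2) ≤ w t ∧ w t ≤ c' * Real.exp (-(δ * t) ^ 2))
    (hα : 0 ≤ α) (hαb : Bornology.IsBounded Γ → α = 0) (hγ : 0 ≤ γ) (hτ : 0 < τ)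
    (h1 : τ * γ < 1) :
    ∃ C : ℝ, 0 < C ∧
      ∫⁻ t, ENNReal.ofReal (Real.exp (2 * α * |t|)) ∂gaussianOn Γ δ ≤ ENNReal.ofReal C ∧
      ∀ (p : ℕ) (x : Fin (p + 1) → ℝ), IsOrthogonalZeros Γ w p x →
        (∀ j, x j ∈ Γ) ∧ ∃ lam : Fin (p + 1) → ℝ, (∀ j, 0 ≤ lam j) ∧
          ∑ j, lam j * Real.exp (2 * α * |x j|) ≤ C ∧
          (∀ a : Fin (p + 1) → V, ∫⁻ t, ENNReal.ofReal
              (‖∑ j, (Lagrange.basis Finset.univ x j).eval t • a j‖ ^ 2) ∂gaussianOn Γ δ ≤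
            ENNReal.ofReal (∑ j, lam j * ‖a j‖ ^ 2)) ∧
          ∀ (g : ℝ → V) (M : ℝ), 0 ≤ M → HasAnalyticBound Γ g M α γ →
            ∫⁻ t, ENNReal.ofReal (‖g t - ∑ j, (Lagrange.basis Finset.univ x j).eval t • g (x j)‖ ^ 2)
              ∂gaussianOn Γ δ ≤ ENNReal.ofReal (C * (M * rate Γ τ δ p) ^ 2) := by
  have hΓm : MeasurableSet Γ := hΓ.measurableSet
  have hwpos : ∀ t ∈ Γ, 0 < w t := fun t ht => (mul_pos hc (Real.exp_pos _)).trans_le (hw t ht).1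
  obtain ⟨a₀, ha₀, -⟩ := exists_lt_of_volume_ne_zero hΓ0
  have hc' : 0 < c' := by
    have := (hwpos a₀ ha₀).trans_le (hw a₀ ha₀).2
    exact pos_of_mul_pos_left this (Real.exp_pos _).le
  have hI := integrableOn_eval_mul_exp hδu
  have hint : ∀ Q : Polynomial ℝ, IntegrableOn (fun t => Q.eval t * w t) Γ := by
    intro Q
    refine ((hI Q).norm.const_mul c').mono' ?_ ?_
    · exact (Q.continuous.aestronglyMeasurable).mul hwm.aestronglyMeasurable
    · refine (ae_restrict_iff' hΓm).2 (.of_forall fun t ht => ?_)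
      have e1 : Real.exp (-(δ * t) ^ 2) ≤ Real.exp (-(0.01 * (δ * t) ^ 2)) :=
        Real.exp_le_exp.2 (by nlinarith [sq_nonneg (δ * t)])
      rw [norm_mul, norm_mul, Real.norm_of_nonneg (hwpos t ht).le,
        Real.norm_of_nonneg (Real.exp_pos _).le]
      calc ‖Q.eval t‖ * w t ≤ ‖Q.eval t‖ * (c' * Real.exp (-(0.01 * (δ * t) ^ 2))) := by
            gcongr
            exact (hw t ht).2.trans (by gcongr)
        _ = _ := by ring
  have hE : IntegrableOn (fun t => Real.exp (-(0.01 * (δ * t) ^ 2))) Γ := by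
    simpa using hI 1
  have hexpeq : ∀ t, Real.exp (0.99 * (δ * t) ^ 2) * Real.exp (-(δ * t) ^ 2) =
      Real.exp (-(0.01 * (δ * t) ^ 2)) := fun t => by
    rw [← Real.exp_add]; congr 1; ring
  have hexp : IntegrableOn (fun t => Real.exp (0.99 * δ ^ 2 * t ^ 2) * w t) Γ := by
    refine (hE.const_mul c').mono' ?_ ?_
    · exact ((by fun_prop : Continuous fun t : ℝ => Real.exp (0.99 * δ ^ 2 * t ^ 2)
        ).aestronglyMeasurable).mul hwm.aestronglyMeasurable
    · refine (ae_restrict_iff' hΓm).2 (.of_forall fun t ht => ?_)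
      rw [norm_mul, Real.norm_of_nonneg (hwpos t ht).le, Real.norm_of_nonneg (Real.exp_pos _).le,
        ← hexpeq, show 0.99 * δ ^ 2 * t ^ 2 = 0.99 * (δ * t) ^ 2 by ring]
      calc _ ≤ Real.exp (0.99 * (δ * t) ^ 2) * (c' * Real.exp (-(δ * t) ^ 2)) := by
            gcongr; exact (hw t ht).2
        _ = _ := by ring
  obtain ⟨C₂, hC₂, hC₂'⟩ := exists_exp_abs_le hαb hδu
  obtain ⟨C₁, hC₁, happ⟩ := exists_polynomial_approx V hΓ hΓ0 hδb hδu hα hαb hγ hτ h1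
  set J := ∫ t in Γ, Real.exp (-(0.01 * (δ * t) ^ 2)) with hJ
  have hJ0 : 0 ≤ J := setIntegral_nonneg hΓm fun t _ => (Real.exp_pos _).le
  set W := ∫ t in Γ, Real.exp (0.99 * δ ^ 2 * t ^ 2) * w t with hW
  have hW0 : 0 ≤ W := setIntegral_nonneg hΓm fun t ht =>
    mul_nonneg (Real.exp_pos _).le (hwpos t ht).le
  have hJE : ∀ B : ℝ, 0 ≤ B → ∀ F : ℝ → ENNReal,
      (∀ t ∈ Γ, F t ≤ ENNReal.ofReal (B * Real.exp (0.99 * (δ * t) ^ 2))) →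
      ∫⁻ t, F t ∂gaussianOn Γ δ ≤ ENNReal.ofReal (B * J) := by
    intro B hB F hF
    have := lintegral_gaussianOn_le (δ := δ) hΓm (F := F)
      (G := fun t => B * Real.exp (-(0.01 * (δ * t) ^ 2))) (fun t ht => ?_) (hE.const_mul B)
      (fun t _ => by positivity)
    · rwa [integral_const_mul] at this
    · rw [← hexpeq]
      calc _ ≤ ENNReal.ofReal (Real.exp (-(δ * t) ^ 2)) *
            ENNReal.ofReal (B * Real.exp (0.99 * (δ * t) ^ 2)) := by gcongr; exact hF t ht
        _ = _ := by rw [← ENNReal.ofReal_mul (Real.exp_pos _).le]; congr 1; ring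
  -- The terms are, in order, the exponential moment, its Gauss sum, the approximation error, and
  -- the interpolant of that error.
  refine ⟨C₂ * J + C₂ * (c⁻¹ * W) + 2 * C₁ ^ 2 * J + 2 * C₁ ^ 2 * (c⁻¹ * W) + 1, by positivity,
    ?_, fun p x hx => ?_⟩
  · refine (hJE C₂ hC₂.le _ fun t _ => ENNReal.ofReal_le_ofReal (hC₂' t)).trans
      (ENNReal.ofReal_le_ofReal ?_)
    have : 0 ≤ C₂ * (c⁻¹ * W) + 2 * C₁ ^ 2 * J + 2 * C₁ ^ 2 * (c⁻¹ * W) := by positivity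
    linarith
  have hmem := hx.mem hΓ hΓm hΓ0 hwpos hint
  have hlam0 : ∀ j, 0 ≤ c⁻¹ * gaussWeight Γ w x j := fun j =>
    mul_nonneg (inv_nonneg.2 hc.le) (gaussWeight_nonneg hΓm hwpos j)
  have hlamW : ∑ j, c⁻¹ * gaussWeight Γ w x j * Real.exp (0.99 * (δ * x j) ^ 2) ≤ c⁻¹ * W := by
    have := hx.sum_gaussWeight_mul_exp_le hΓm hwpos hint (c := 0.99 * δ ^ 2) (by positivity) hexp
    simp only [mul_assoc c⁻¹, ← Finset.mul_sum]
    refine mul_le_mul_of_nonneg_left (le_trans (le_of_eq ?_) this) (inv_nonneg.2 hc.le)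
    refine Finset.sum_congr rfl fun j _ => ?_
    congr 2
    ring
  have hstab : ∀ a : Fin (p + 1) → V, ∫⁻ t, ENNReal.ofReal
      (‖∑ j, (Lagrange.basis Finset.univ x j).eval t • a j‖ ^ 2) ∂gaussianOn Γ δ ≤
      ENNReal.ofReal (∑ j, c⁻¹ * gaussWeight Γ w x j * ‖a j‖ ^ 2) := by
    intro a
    have := lintegral_gaussianOn_le (δ := δ) hΓm (F := fun t => ENNReal.ofReal
      (‖∑ j, (Lagrange.basis Finset.univ x j).eval t • a j‖ ^ 2))
      (G := fun t => c⁻¹ * (‖∑ j, (Lagrange.basis Finset.univ x j).eval t • a j‖ ^ 2 * w t))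
      (fun t ht => ?_) ((IsOrthogonalZeros.integrableOn_norm_sq hint a).const_mul _)
      (fun t ht => mul_nonneg (inv_nonneg.2 hc.le)
        (mul_nonneg (sq_nonneg _) (hwpos t ht).le))
    · rw [integral_const_mul, hx.integral_norm_sq hint] at this
      simpa only [Finset.mul_sum, mul_assoc] using this
    · rw [← ENNReal.ofReal_mul (Real.exp_pos _).le]
      refine ENNReal.ofReal_le_ofReal ?_
      have : Real.exp (-(δ * t) ^ 2) ≤ c⁻¹ * w t := by
        rw [← div_eq_inv_mul, le_div_iff₀ hc, mul_comm]; exact (hw t ht).1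
      calc _ ≤ c⁻¹ * w t * ‖∑ j, (Lagrange.basis Finset.univ x j).eval t • a j‖ ^ 2 := by gcongr
        _ = _ := by ring
  refine ⟨hmem, fun j => c⁻¹ * gaussWeight Γ w x j, hlam0, ?_, hstab, fun g M hM hg => ?_⟩
  · calc _ ≤ ∑ j, c⁻¹ * gaussWeight Γ w x j * (C₂ * Real.exp (0.99 * (δ * x j) ^ 2)) :=
          Finset.sum_le_sum fun j _ => mul_le_mul_of_nonneg_left (hC₂' _) (hlam0 j)
      _ = C₂ * ∑ j, c⁻¹ * gaussWeight Γ w x j * Real.exp (0.99 * (δ * x j) ^ 2) := by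
          rw [Finset.mul_sum]; exact Finset.sum_congr rfl fun j _ => by ring
      _ ≤ C₂ * (c⁻¹ * W) := by gcongr
      _ ≤ _ := by
        have : 0 ≤ C₂ * J + 2 * C₁ ^ 2 * J + 2 * C₁ ^ 2 * (c⁻¹ * W) := by positivity
        linarith
  obtain ⟨P, hP, hPt⟩ := happ p g M hM hg
  set e := M * rate Γ τ δ p with he
  have hsq : ∀ t ∈ Γ, ‖g t - P t‖ ^ 2 ≤ (C₁ * e) ^ 2 * Real.exp (0.99 * (δ * t) ^ 2) := by
    intro t ht
    have e1 : Real.exp (0.99 * (δ * t) ^ 2) = Real.exp (0.495 * (δ * t) ^ 2) ^ 2 := by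
      rw [← Real.exp_nat_mul]; congr 1; push_cast; ring
    rw [e1, ← mul_pow]
    refine pow_le_pow_left₀ (norm_nonneg _) ((hPt t ht).trans_eq ?_) 2
    rw [he]; ring
  have hsplit : ∀ t, ENNReal.ofReal
      (‖g t - ∑ j, (Lagrange.basis Finset.univ x j).eval t • g (x j)‖ ^ 2) ≤
      ENNReal.ofReal (2 * ‖g t - P t‖ ^ 2) + 2 * ENNReal.ofReal
        (‖∑ j, (Lagrange.basis Finset.univ x j).eval t • (g (x j) - P (x j))‖ ^ 2) := by
    intro t
    rw [← ENNReal.ofReal_ofNat, ← ENNReal.ofReal_mul zero_le_two,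
      ← ENNReal.ofReal_add (by positivity) (by positivity)]
    refine ENNReal.ofReal_le_ofReal ?_
    -- Interpolation reproduces P, so only g - P is ever interpolated.
    have e1 : g t - ∑ j, (Lagrange.basis Finset.univ x j).eval t • g (x j) = (g t - P t) -
        ∑ j, (Lagrange.basis Finset.univ x j).eval t • (g (x j) - P (x j)) := by
      simp only [smul_sub, Finset.sum_sub_distrib, hP.sum_lagrange_basis hx.1]
      abel
    rw [e1]
    have e2 := norm_sub_le (g t - P t)
      (∑ j, (Lagrange.basis Finset.univ x j).eval t • (g (x j) - P (x j)))
    have e3 := pow_le_pow_left₀ (norm_nonneg _) e2 2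
    nlinarith [sq_nonneg (‖g t - P t‖ -
      ‖∑ j, (Lagrange.basis Finset.univ x j).eval t • (g (x j) - P (x j))‖)]
  have hmeas : Measurable fun t => ENNReal.ofReal
      (‖∑ j, (Lagrange.basis Finset.univ x j).eval t • (g (x j) - P (x j))‖ ^ 2) :=
    (by fun_prop : Continuous fun t => ‖∑ j, (Lagrange.basis Finset.univ x j).eval t •
      (g (x j) - P (x j))‖ ^ 2).measurable.ennreal_ofReal
  calc _ ≤ ∫⁻ t, (ENNReal.ofReal (2 * ‖g t - P t‖ ^ 2) + 2 * ENNReal.ofReal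
        (‖∑ j, (Lagrange.basis Finset.univ x j).eval t • (g (x j) - P (x j))‖ ^ 2))
          ∂gaussianOn Γ δ := lintegral_mono hsplit
    _ = ∫⁻ t, ENNReal.ofReal (2 * ‖g t - P t‖ ^ 2) ∂gaussianOn Γ δ + 2 * ∫⁻ t, ENNReal.ofReal
        (‖∑ j, (Lagrange.basis Finset.univ x j).eval t • (g (x j) - P (x j))‖ ^ 2)
          ∂gaussianOn Γ δ := by
        rw [lintegral_add_right _ (hmeas.const_mul 2), lintegral_const_mul _ hmeas]
    _ ≤ ENNReal.ofReal (2 * (C₁ * e) ^ 2 * J) +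
        2 * ENNReal.ofReal ((C₁ * e) ^ 2 * (c⁻¹ * W)) := by
        gcongr
        · refine hJE _ (by positivity) _ fun t ht => ENNReal.ofReal_le_ofReal ?_
          have := hsq t ht
          linarith
        · refine (hstab _).trans (ENNReal.ofReal_le_ofReal ?_)
          calc _ ≤ ∑ j, c⁻¹ * gaussWeight Γ w x j *
                ((C₁ * e) ^ 2 * Real.exp (0.99 * (δ * x j) ^ 2)) :=
                Finset.sum_le_sum fun j _ =>
                  mul_le_mul_of_nonneg_left (hsq _ (hmem j)) (hlam0 j)
            _ = (C₁ * e) ^ 2 * ∑ j, c⁻¹ * gaussWeight Γ w x j *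
                Real.exp (0.99 * (δ * x j) ^ 2) := by
                rw [Finset.mul_sum]; exact Finset.sum_congr rfl fun j _ => by ring
            _ ≤ _ := by gcongr
    _ ≤ _ := by
        rw [← ENNReal.ofReal_ofNat, ← ENNReal.ofReal_mul zero_le_two,
          ← ENNReal.ofReal_add (by positivity) (by positivity)]
        refine ENNReal.ofReal_le_ofReal ?_
        have : 0 ≤ (C₂ * J + C₂ * (c⁻¹ * W) + 1) * e ^ 2 := by positivity
        linarith

end OneDimensional

end

noncomputable section

/-! ### Tensor product interpolation, one variable at a time -/

section Tensor

variable {r : ℕ} {V : Type*} [NormedAddCommGroup V] [InnerProductSpace ℝ V]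

/-- Lagrange interpolation in the variables belonging to `s`. -/
def partialInterp (p : Fin r → ℕ) (x : ∀ n, Fin (p n + 1) → ℝ) (s : Finset (Fin r))
    (v : (Fin r → ℝ) → V) (y : Fin r → ℝ) : V :=
  ∑ j : (∀ n, Fin (p n + 1)),
    (∏ n, (Lagrange.basis Finset.univ (x n) (j n)).eval (y n)) •
      v (fun n => if n ∈ s then x n (j n) else y n)

variable {p : Fin r → ℕ} {x : ∀ n, Fin (p n + 1) → ℝ}

theorem partialInterp_univ (v : (Fin r → ℝ) → V) (y : Fin r → ℝ) :
    partialInterp p x Finset.univ v y = tensorInterp p x v y := by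
  simp [partialInterp, tensorInterp]

/-- The Lagrange functions of each untouched variable sum to one, so keeping them in the product is
harmless. -/
theorem partialInterp_empty (hx : ∀ n, Function.Injective (x n)) (v : (Fin r → ℝ) → V)
    (y : Fin r → ℝ) : partialInterp p x ∅ v y = v y := by
  simp only [partialInterp, Finset.notMem_empty, if_false]
  rw [← Finset.sum_smul, ← Fintype.piFinset_univ, ← Finset.prod_univ_sum
    (f := fun n i => (Lagrange.basis Finset.univ (x n) i).eval (y n))]
  have : ∀ n, ∑ i, (Lagrange.basis Finset.univ (x n) i).eval (y n) = 1 := by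
    intro n
    rw [← Polynomial.eval_finsetSum, Lagrange.sum_basis (hx n).injOn Finset.univ_nonempty,
      Polynomial.eval_one]
  simp [this]

/-- At a node the i-th Lagrange factor is a Kronecker delta, which collapses the extra sum over k.
-/
theorem partialInterp_insert (hx : ∀ n, Function.Injective (x n)) {s : Finset (Fin r)} {i : Fin r}
    (hi : i ∉ s) (v : (Fin r → ℝ) → V) (y : Fin r → ℝ) :
    partialInterp p x (insert i s) v y = ∑ k, (Lagrange.basis Finset.univ (x i) k).eval (y i) •
      partialInterp p x s v (Function.update y i (x i k)) := by
  simp only [partialInterp, Finset.smul_sum]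
  rw [Finset.sum_comm]
  refine Finset.sum_congr rfl fun j _ => ?_
  rw [Finset.sum_eq_single (j i)]
  · rw [smul_smul]
    congr 1
    · rw [← Finset.mul_prod_erase _ _ (Finset.mem_univ i),
        ← Finset.mul_prod_erase Finset.univ (fun n => (Lagrange.basis Finset.univ (x n) (j n)).eval
          (Function.update y i (x i (j i)) n)) (Finset.mem_univ i)]
      rw [Function.update_self, eval_lagrange_basis (hx i), if_pos rfl, one_mul]
      congr 1
      refine Finset.prod_congr rfl fun n hn => ?_
      rw [Function.update_of_ne (Finset.ne_of_mem_erase hn)]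
    · congr 1
      funext n
      rcases eq_or_ne n i with rfl | hn
      · simp [hi]
      · simp [hn]
  · intro k _ hk
    have : ∏ n, (Lagrange.basis Finset.univ (x n) (j n)).eval
        (Function.update y i (x i k) n) = 0 := by
      refine Finset.prod_eq_zero (Finset.mem_univ i) ?_
      rw [Function.update_self, eval_lagrange_basis (hx i), if_neg hk.symm]
    rw [this, zero_smul, smul_zero]
  · intro h
    exact absurd (Finset.mem_univ _) h

theorem stronglyMeasurable_partialInterp {v : (Fin r → ℝ) → V} (hv : StronglyMeasurable v)
    (s : Finset (Fin r)) : StronglyMeasurable (partialInterp p x s v) := by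
  unfold partialInterp
  refine Finset.stronglyMeasurable_fun_sum _ fun j _ => StronglyMeasurable.smul ?_ ?_
  · refine Continuous.stronglyMeasurable ?_
    fun_prop
  · refine hv.comp_measurable (measurable_pi_lambda _ fun n => ?_)
    split_ifs
    · exact measurable_const
    · exact measurable_pi_apply n

variable {μ : Fin r → Measure ℝ} [∀ n, SigmaFinite (μ n)]

/-- Tonelli for products. The set u is generalised because, in the induction, the new variable
counts as frozen while the others are integrated. -/
theorem lmarginal_prod {E : Fin r → ℝ → ENNReal} (hE : ∀ n, Measurable (E n))
    (s : Finset (Fin r)) : ∀ u : Finset (Fin r), Disjoint s u → ∀ y,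
      (∫⋯∫⁻_s, (fun y => ∏ k ∈ s ∪ u, E k (y k)) ∂μ) y =
        (∏ k ∈ s, ∫⁻ t, E k t ∂μ k) * ∏ k ∈ u, E k (y k) := by
  have hm : ∀ t : Finset (Fin r), Measurable fun y : Fin r → ℝ => ∏ k ∈ t, E k (y k) := fun t =>
    Finset.measurable_prod _ fun k _ => (hE k).comp (measurable_pi_apply k)
  induction s using Finset.induction_on with
  | empty => intro u _ y; simp
  | insert i s hi ih =>
    intro u hu y
    rw [Finset.disjoint_insert_left] at hu
    rw [lmarginal_insert _ (hm _) hi, Finset.prod_insert hi]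
    have hU : insert i s ∪ u = s ∪ insert i u := by
      rw [Finset.insert_union, Finset.union_insert]
    have hd : Disjoint s (insert i u) := Finset.disjoint_insert_right.2 ⟨hi, hu.2⟩
    calc _ = ∫⁻ t, (∏ k ∈ s, ∫⁻ t, E k t ∂μ k) * ((∏ k ∈ u, E k (y k)) * E i t) ∂μ i := by
          refine lintegral_congr fun t => ?_
          rw [hU, ih (insert i u) hd (Function.update y i t), Finset.prod_insert hu.1,
            Function.update_self, mul_comm (E i t)]
          congr 2
          refine Finset.prod_congr rfl fun k hk => ?_
          rw [Function.update_of_ne]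
          rintro rfl
          exact hu.1 hk
      _ = (∏ k ∈ s, ∫⁻ t, E k t ∂μ k) * ((∏ k ∈ u, E k (y k)) * ∫⁻ t, E i t ∂μ i) := by
          rw [lintegral_const_mul _ ((hE i).const_mul _), lintegral_const_mul _ (hE i)]
      _ = _ := by ring

theorem lmarginal_prod_le {E : Fin r → ℝ → ENNReal} (hE : ∀ n, Measurable (E n)) {K : ENNReal}
    (hK : ∀ n, ∫⁻ t, E n t ∂μ n ≤ K) {s u : Finset (Fin r)} (hsu : Disjoint s u)
    (y : Fin r → ℝ) :
    (∫⋯∫⁻_s, (fun y => ∏ k ∈ s ∪ u, E k (y k)) ∂μ) y ≤ K ^ s.card * ∏ k ∈ u, E k (y k) := by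
  rw [lmarginal_prod hE s u hsu y]
  exact mul_le_mul_left (Finset.prod_le_pow_card _ _ _ fun k _ => hK k) _

theorem lintegral_pi_prod {E : Fin r → ℝ → ENNReal} (hE : ∀ n, Measurable (E n)) :
    ∫⁻ y, ∏ k, E k (y k) ∂Measure.pi μ = ∏ k, ∫⁻ t, E k t ∂μ k := by
  have h := lmarginal_prod (μ := μ) hE Finset.univ ∅ (Finset.disjoint_empty_right _) 0
  rwa [Finset.union_empty, Finset.prod_empty, mul_one, lmarginal_univ] at h

theorem pi_withDensity {E : Fin r → ℝ → ENNReal} (hE : ∀ n, Measurable (E n))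
    [∀ n, SigmaFinite ((μ n).withDensity (E n))] :
    Measure.pi (fun n => (μ n).withDensity (E n)) =
      (Measure.pi μ).withDensity fun y => ∏ k, E k (y k) := by
  refine (Measure.pi_eq fun s hs => ?_)
  rw [withDensity_apply _ (MeasurableSet.univ_pi hs), Measure.restrict_pi_pi, lintegral_pi_prod hE]
  exact Finset.prod_congr rfl fun k _ => (withDensity_apply _ (hs k)).symm

/-- The error of tensor product interpolation, in terms of the errors of one-dimensional
interpolation. -/
theorem lmarginal_partialInterp_le {E : Fin r → ℝ → ENNReal} (hE : ∀ n, Measurable (E n))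
    {K : ENNReal} (hK : ∀ n, ∫⁻ t, E n t ∂μ n ≤ K) (hx : ∀ n, Function.Injective (x n))
    {lam : ∀ n, Fin (p n + 1) → ENNReal} (hlam : ∀ n, ∑ j, lam n j * E n (x n j) ≤ K)
    (hstab : ∀ n, ∀ a : Fin (p n + 1) → V, ∫⁻ t, ENNReal.ofReal
      (‖∑ j, (Lagrange.basis Finset.univ (x n) j).eval t • a j‖ ^ 2) ∂μ n ≤
        ∑ j, lam n j * ENNReal.ofReal (‖a j‖ ^ 2))
    {v : (Fin r → ℝ) → V} (hv : StronglyMeasurable v) {ε : Fin r → ENNReal}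
    (herr : ∀ n y, ∫⁻ t, ENNReal.ofReal (‖v (Function.update y n t) -
      ∑ j, (Lagrange.basis Finset.univ (x n) j).eval t • v (Function.update y n (x n j))‖ ^ 2)
        ∂μ n ≤ ε n * ∏ k ∈ Finset.univ.erase n, E k (y k)) (s : Finset (Fin r)) :
    ∀ y, (∫⋯∫⁻_s, (fun y => ENNReal.ofReal (‖v y - partialInterp p x s v y‖ ^ 2)) ∂μ) y ≤
      (2 * (K + 1)) ^ s.card * (∑ n ∈ s, ε n) * ∏ k ∈ sᶜ, E k (y k) := by
  have hFm : ∀ s, StronglyMeasurable fun y => v y - partialInterp p x s v y := fun s =>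
    hv.sub (stronglyMeasurable_partialInterp hv s)
  have hF : ∀ s, Measurable fun y => ENNReal.ofReal (‖v y - partialInterp p x s v y‖ ^ 2) :=
    fun s => ((hFm s).norm.measurable.pow_const 2).ennreal_ofReal
  induction s using Finset.induction_on with
  | empty => intro y; simp [partialInterp_empty hx]
  | insert i s hi ih =>
    intro y
    have hpt : ∀ y, ∫⁻ t, ENNReal.ofReal (‖v (Function.update y i t) -
        partialInterp p x (insert i s) v (Function.update y i t)‖ ^ 2) ∂μ i ≤
        2 * (ε i * ∏ k ∈ Finset.univ.erase i, E k (y k)) +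
        ∑ j, 2 * lam i j * ENNReal.ofReal (‖v (Function.update y i (x i j)) -
          partialInterp p x s v (Function.update y i (x i j))‖ ^ 2) := by
      intro y
      set a : Fin (p i + 1) → V := fun j => v (Function.update y i (x i j)) -
          partialInterp p x s v (Function.update y i (x i j)) with ha
      have hsplit : ∀ t, ENNReal.ofReal (‖v (Function.update y i t) -
          partialInterp p x (insert i s) v (Function.update y i t)‖ ^ 2) ≤
          2 * ENNReal.ofReal (‖v (Function.update y i t) - ∑ j,
            (Lagrange.basis Finset.univ (x i) j).eval t • v (Function.update y i (x i j))‖ ^ 2) +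
          2 * ENNReal.ofReal (‖∑ j, (Lagrange.basis Finset.univ (x i) j).eval t • a j‖ ^ 2) := by
        intro t
        rw [← ENNReal.ofReal_ofNat, ← ENNReal.ofReal_mul zero_le_two,
          ← ENNReal.ofReal_mul zero_le_two, ← ENNReal.ofReal_add (by positivity) (by positivity)]
        refine ENNReal.ofReal_le_ofReal ?_
        -- The one-variable error of v, plus the one-variable interpolant of the error already
        -- accumulated; stability controls the latter.
        have e1 : v (Function.update y i t) -
            partialInterp p x (insert i s) v (Function.update y i t) =
            (v (Function.update y i t) - ∑ j, (Lagrange.basis Finset.univ (x i) j).eval t •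
              v (Function.update y i (x i j))) +
            ∑ j, (Lagrange.basis Finset.univ (x i) j).eval t • a j := by
          rw [partialInterp_insert hx hi]
          simp only [Function.update_self, Function.update_idem, ha, smul_sub,
            Finset.sum_sub_distrib]
          abel
        rw [e1]
        set A := v (Function.update y i t) - ∑ j, (Lagrange.basis Finset.univ (x i) j).eval t •
              v (Function.update y i (x i j))
        set B := ∑ j, (Lagrange.basis Finset.univ (x i) j).eval t • a j
        have e3 := pow_le_pow_left₀ (norm_nonneg _) (norm_add_le A B) 2
        nlinarith [sq_nonneg (‖A‖ - ‖B‖)]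
      have hmeas : Measurable fun t => ENNReal.ofReal
          (‖∑ j, (Lagrange.basis Finset.univ (x i) j).eval t • a j‖ ^ 2) :=
        (by fun_prop : Continuous fun t => ‖∑ j, (Lagrange.basis Finset.univ (x i) j).eval t •
          a j‖ ^ 2).measurable.ennreal_ofReal
      refine (lintegral_mono hsplit).trans ?_
      rw [lintegral_add_right _ (hmeas.const_mul 2), lintegral_const_mul _ hmeas,
        lintegral_const_mul' _ _ ENNReal.ofNat_ne_top]
      refine add_le_add (mul_le_mul_right (herr i y) 2) ?_
      refine (mul_le_mul_right (hstab i a) 2).trans_eq ?_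
      rw [Finset.mul_sum]
      exact Finset.sum_congr rfl fun j _ => by rw [mul_assoc]
    have hEm : ∀ t : Finset (Fin r), Measurable fun y : Fin r → ℝ => ∏ k ∈ t, E k (y k) := fun t =>
      Finset.measurable_prod _ fun k _ => (hE k).comp (measurable_pi_apply k)
    have hcompl : Finset.univ.erase i = s ∪ (insert i s)ᶜ := by
      ext k
      by_cases hk : k ∈ s
      · have : k ≠ i := by
          rintro rfl
          exact hi hk
        simp [hk, this]
      · simp [hk]
    have hcompl2 : sᶜ = insert i (insert i s)ᶜ := by
      ext k
      by_cases hk : k = i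
      · simp [hk, hi]
      · simp [hk]
    have hd : Disjoint s (insert i s)ᶜ := by
      rw [Finset.disjoint_left]
      intro k hk
      simp [hk]
    have hEi : ∀ j, ∏ k ∈ sᶜ, E k (Function.update y i (x i j) k) =
        E i (x i j) * ∏ k ∈ (insert i s)ᶜ, E k (y k) := by
      intro j
      rw [hcompl2, Finset.prod_insert (by simp), Function.update_self]
      congr 1
      refine Finset.prod_congr rfl fun k hk => ?_
      rw [Function.update_of_ne]
      rintro rfl
      simp at hk
    -- The variable y_i is integrated innermost, so the one-dimensional bound holds pointwise in the
    -- others.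
    rw [lmarginal_insert' _ (hF _) hi]
    set R := ∏ k ∈ (insert i s)ᶜ, E k (y k)
    have hFu : ∀ j, Measurable fun y => ENNReal.ofReal (‖v (Function.update y i (x i j)) -
          partialInterp p x s v (Function.update y i (x i j))‖ ^ 2) := fun j =>
      (hF s).comp measurable_update_left
    calc _ ≤ (∫⋯∫⁻_s, (fun y => 2 * (ε i * ∏ k ∈ Finset.univ.erase i, E k (y k)) +
          ∑ j, 2 * lam i j * ENNReal.ofReal (‖v (Function.update y i (x i j)) -
            partialInterp p x s v (Function.update y i (x i j))‖ ^ 2)) ∂μ) y :=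
          lmarginal_mono (fun y => hpt y) y
      _ = 2 * ε i * (∫⋯∫⁻_s, (fun y => ∏ k ∈ s ∪ (insert i s)ᶜ, E k (y k)) ∂μ) y +
          ∑ j, 2 * lam i j * (∫⋯∫⁻_s, (fun y => ENNReal.ofReal
            (‖v y - partialInterp p x s v y‖ ^ 2)) ∂μ) (Function.update y i (x i j)) := by
          simp only [lmarginal_update_of_notMem (hF s) hi]
          simp only [lmarginal, hcompl, ← mul_assoc, Function.comp_apply]
          have hu : Measurable fun z : (k : s) → ℝ => Function.updateFinset y s z :=
            measurable_updateFinset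
          have m1 : Measurable fun z : (k : s) → ℝ => ∏ k ∈ s ∪ (insert i s)ᶜ,
              E k (Function.updateFinset y s z k) := (hEm (s ∪ (insert i s)ᶜ)).comp hu
          have m2 : ∀ j, Measurable fun z : (k : s) → ℝ => ENNReal.ofReal
              (‖v (Function.update (Function.updateFinset y s z) i (x i j)) -
                partialInterp p x s v
                  (Function.update (Function.updateFinset y s z) i (x i j))‖ ^ 2) :=
            fun j => (hFu j).comp hu
          rw [lintegral_add_left (m1.const_mul _), lintegral_finsetSum _
            (fun j _ => (m2 j).const_mul _)]
          congr 1
          · exact lintegral_const_mul _ m1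
          · exact Finset.sum_congr rfl fun j _ => lintegral_const_mul _ (m2 j)
      _ ≤ 2 * ε i * (K ^ s.card * R) + ∑ j, 2 * lam i j *
          ((2 * (K + 1)) ^ s.card * (∑ n ∈ s, ε n) * (E i (x i j) * R)) := by
          refine add_le_add (mul_le_mul_right (lmarginal_prod_le hE hK hd y) _)
            (Finset.sum_le_sum fun j _ => mul_le_mul_right ?_ _)
          rw [← hEi]
          exact ih _
      _ = 2 * K ^ s.card * ε i * R + 2 * (∑ j, lam i j * E i (x i j)) *
          (2 * (K + 1)) ^ s.card * (∑ n ∈ s, ε n) * R := by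
          generalize ∑ n ∈ s, ε n = e
          simp only [Finset.mul_sum, Finset.sum_mul]
          congr 1
          · ring
          · refine Finset.sum_congr rfl fun j _ => ?_
            ring
      _ ≤ 2 * (K + 1) * (2 * (K + 1)) ^ s.card * ε i * R + 2 * (K + 1) *
          (2 * (K + 1)) ^ s.card * (∑ n ∈ s, ε n) * R := by
          -- Using K + 1 rather than K makes the base at least one, so both contributions fit one
          -- power.
          have h1 : 2 * K ^ s.card ≤ 2 * (K + 1) * (2 * (K + 1)) ^ s.card := by
            have h2 : K ≤ 2 * (K + 1) := le_self_add.trans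
              (le_mul_of_one_le_left (zero_le) one_le_two)
            have h3 : (1 : ENNReal) ≤ K + 1 := le_add_self
            calc 2 * K ^ s.card = 2 * 1 * K ^ s.card := by ring
              _ ≤ _ := by gcongr
          have h2 : ∑ j, lam i j * E i (x i j) ≤ K + 1 := (hlam i).trans le_self_add
          gcongr
      _ = _ := by
          rw [Finset.card_insert_of_notMem hi, Finset.sum_insert hi, pow_succ]
          ring

end Tensor

end

/-! ### Comparison with the product Gaussian measure and the multivariate estimate -/

noncomputable section

instance sigmaFinite_gaussianOn (Γ : Set ℝ) (δ : ℝ) : SigmaFinite (gaussianOn Γ δ) := by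
  unfold gaussianOn
  exact SigmaFinite.withDensity_ofReal _

theorem ae_gaussianOn_mem {Γ : Set ℝ} (hΓm : MeasurableSet Γ) (δ : ℝ) :
    ∀ᵐ t ∂gaussianOn Γ δ, t ∈ Γ :=
  (withDensity_absolutelyContinuous _ _).ae_le (ae_restrict_mem hΓm)

variable {r : ℕ} {Γ : Fin r → Set ℝ} {δ : Fin r → ℝ}

/-- The density ρ need not factorise; it is replaced at once by a product measure, for which
variables can be integrated separately. -/
theorem densityMeasure_le (hΓm : ∀ n, MeasurableSet (Γ n)) {ρ : (Fin r → ℝ) → ℝ} {CM : ℝ}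
    (hCM : 0 ≤ CM)
    (hρ : ∀ y ∈ Set.pi univ Γ, ρ y ≤ CM * Real.exp (-∑ n, (δ n * y n) ^ 2)) :
    densityMeasure Γ ρ ≤ ENNReal.ofReal CM • Measure.pi fun n => gaussianOn (Γ n) (δ n) := by
  have hE : ∀ n, Measurable fun t => ENNReal.ofReal (Real.exp (-(δ n * t) ^ 2)) := fun n => by
    fun_prop
  have e : Measure.pi (fun n => gaussianOn (Γ n) (δ n)) = (volume.restrict (Set.pi univ Γ)
      ).withDensity fun y => ∏ n, ENNReal.ofReal (Real.exp (-(δ n * y n) ^ 2)) := by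
    rw [volume_pi, Measure.restrict_pi_pi]
    have : ∀ n, SigmaFinite ((volume.restrict (Γ n)).withDensity fun t => ENNReal.ofReal
      (Real.exp (-(δ n * t) ^ 2))) := fun n => sigmaFinite_gaussianOn _ _
    exact pi_withDensity hE
  rw [e, ← withDensity_smul' _ _ ENNReal.ofReal_ne_top]
  refine withDensity_mono ((ae_restrict_iff' (MeasurableSet.univ_pi hΓm)).2
    (.of_forall fun y hy => ?_))
  rw [Pi.smul_apply, smul_eq_mul, ← ENNReal.ofReal_prod_of_nonneg fun n _ => (Real.exp_pos _).le,
    ← Real.exp_sum, Finset.sum_neg_distrib, ← ENNReal.ofReal_mul hCM]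
  exact ENNReal.ofReal_le_ofReal (hρ y hy)

theorem stronglyMeasurable_indicator_of_continuousOn {X V : Type*} [TopologicalSpace X]
    [SecondCountableTopology X] [MeasurableSpace X] [BorelSpace X] [NormedAddCommGroup V]
    {s : Set X} (hs : MeasurableSet s) {v : X → V} (hv : ContinuousOn v s) :
    StronglyMeasurable (s.indicator v) := by
  refine stronglyMeasurable_of_restrict_of_restrict_compl hs ?_ ?_
  · have e : s.domRestrict (s.indicator v) = s.domRestrict v := funext fun y => indicator_of_mem y.2 v
    rw [e]
    exact (continuousOn_iff_continuous_domRestrict.1 hv).stronglyMeasurable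
  · have e : sᶜ.domRestrict (s.indicator v) = fun _ => 0 := funext fun y => indicator_of_notMem y.2 v
    rw [e]
    exact stronglyMeasurable_const

/-- The error of tensor product interpolation at the zeros of orthogonal polynomials. -/
theorem exists_tensorInterp_error (V : Type*) [NormedAddCommGroup V] [InnerProductSpace ℝ V]
    [CompleteSpace V] (hΓ : ∀ n, (Γ n).OrdConnected) (hΓ0 : ∀ n, volume (Γ n) ≠ 0)
    (hδb : ∀ n, Bornology.IsBounded (Γ n) → δ n = 0)
    (hδu : ∀ n, ¬ Bornology.IsBounded (Γ n) → 0 < δ n)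
    {w : Fin r → ℝ → ℝ} (hwm : ∀ n, AEMeasurable (w n) (volume.restrict (Γ n)))
    {c c' : Fin r → ℝ} (hc : ∀ n, 0 < c n)
    (hw : ∀ n, ∀ t ∈ Γ n, c n * Real.exp (-(δ n * t) ^ 2) ≤ w n t ∧
      w n t ≤ c' n * Real.exp (-(δ n * t) ^ 2))
    {α : Fin r → ℝ} (hα : ∀ n, 0 ≤ α n) (hαb : ∀ n, Bornology.IsBounded (Γ n) → α n = 0)
    {γ τ : Fin r → ℝ} (hγ : ∀ n, 0 ≤ γ n) (hτ : ∀ n, 0 < τ n) (h1 : ∀ n, τ n * γ n < 1) :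
    ∃ C : ℝ, 0 < C ∧ ∀ (p : Fin r → ℕ) (x : ∀ n, Fin (p n + 1) → ℝ),
      (∀ n, IsOrthogonalZeros (Γ n) (w n) (p n) (x n)) → (∀ n j, x n j ∈ Γ n) ∧
      ∀ (v : (Fin r → ℝ) → V) (M : ℝ), 0 ≤ M → ContinuousOn v (Set.pi univ Γ) →
        (∀ n, ∀ y ∈ Set.pi univ Γ, HasAnalyticBound (Γ n) (fun t => v (Function.update y n t))
          (M * ∏ k ∈ Finset.univ.erase n, Real.exp (α k * |y k|)) (α n) (γ n)) →
        ∫⁻ y, ENNReal.ofReal (‖v y - tensorInterp p x v y‖ ^ 2)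
            ∂Measure.pi (fun n => gaussianOn (Γ n) (δ n)) ≤
          ENNReal.ofReal ((C * M * ∑ n, rate (Γ n) (τ n) (δ n) (p n)) ^ 2) := by
  choose C hC hCint hCx using fun n => exists_interpolation_error V (hΓ n) (hΓ0 n) (hδb n) (hδu n)
    (hwm n) (hc n) (hw n) (hα n) (hαb n) (hγ n) (hτ n) (h1 n)
  have hΓm : ∀ n, MeasurableSet (Γ n) := fun n => (hΓ n).measurableSet
  set K := ∑ n, C n with hK
  have hK0 : 0 ≤ K := Finset.sum_nonneg fun n _ => (hC n).le
  have hCK : ∀ n, C n ≤ K := fun n =>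
    Finset.single_le_sum (fun n _ => (hC n).le) (Finset.mem_univ n)
  refine ⟨√((2 * (K + 1)) ^ r * (K + 1)), by positivity, fun p x hx => ?_⟩
  have hxΓ : ∀ n j, x n j ∈ Γ n := fun n => (hCx n (p n) (x n) (hx n)).1
  choose lam hlam0 hlam hstab herr using fun n => (hCx n (p n) (x n) (hx n)).2
  refine ⟨hxΓ, fun v M hM hv hva => ?_⟩
  have hPm : MeasurableSet (Set.pi univ Γ) := MeasurableSet.univ_pi hΓm
  have hmem : ∀ n y t, (∀ k, k ≠ n → y k ∈ Γ k) → t ∈ Γ n →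
      Function.update y n t ∈ Set.pi univ Γ := by
    intro n y t hy ht k _
    rcases eq_or_ne k n with rfl | hk
    · simpa using ht
    · simpa [hk] using hy k hk
  have hae : ∀ᵐ y ∂Measure.pi (fun n => gaussianOn (Γ n) (δ n)), y ∈ Set.pi univ Γ := by
    have := fun n => ae_gaussianOn_mem (hΓm n) (δ n)
    filter_upwards [eventually_countable_forall.2 fun n =>
      (Measure.quasiMeasurePreserving_eval (fun n => gaussianOn (Γ n) (δ n)) n).ae (this n)]
      with y hy n _ using hy n
  -- The exponent is doubled because squared norms are integrated.
  set E : Fin r → ℝ → ENNReal := fun n t => ENNReal.ofReal (Real.exp (2 * α n * |t|)) with hE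
  have hEprod : ∀ (s : Finset (Fin r)) (y : Fin r → ℝ), ∏ k ∈ s, E k (y k) =
      ENNReal.ofReal ((∏ k ∈ s, Real.exp (α k * |y k|)) ^ 2) := by
    intro s y
    rw [← Finset.prod_pow, ENNReal.ofReal_prod_of_nonneg fun n _ => by positivity]
    refine Finset.prod_congr rfl fun k _ => ?_
    change ENNReal.ofReal (Real.exp (2 * α k * |y k|)) = _
    rw [pow_two, ← Real.exp_add]
    ring_nf
  have key := lmarginal_partialInterp_le (μ := fun n => gaussianOn (Γ n) (δ n)) (p := p) (x := x)
    (E := E) (K := ENNReal.ofReal K) (lam := fun n j => ENNReal.ofReal (lam n j))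
    (fun n => by fun_prop) (fun n => (hCint n).trans (ENNReal.ofReal_le_ofReal (hCK n)))
    (fun n => (hx n).1)
    (fun n => by
      simp only [hE]
      simp_rw [← ENNReal.ofReal_mul (hlam0 n _)]
      rw [← ENNReal.ofReal_sum_of_nonneg fun j _ => mul_nonneg (hlam0 n j) (Real.exp_pos _).le]
      exact ENNReal.ofReal_le_ofReal ((hlam n).trans (hCK n)))
    (fun n a => by
      refine (hstab n a).trans_eq ?_
      rw [ENNReal.ofReal_sum_of_nonneg fun j _ => mul_nonneg (hlam0 n j) (sq_nonneg _)]
      exact Finset.sum_congr rfl fun j _ => ENNReal.ofReal_mul (hlam0 n j))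
    -- Extending v by zero gives measurability on the whole space. All nodes lie in Γ, so the
    -- interpolant is unchanged.
    (stronglyMeasurable_indicator_of_continuousOn hPm hv)
    (ε := fun n => ENNReal.ofReal (K * (M * rate (Γ n) (τ n) (δ n) (p n)) ^ 2))
    (fun n y => by
      by_cases hy : ∀ k, k ≠ n → y k ∈ Γ k
      -- The coordinate y n may lie outside Γ n. It is irrelevant to the line considered, so any
      -- point of Γ n may replace it.
      · obtain ⟨t₀, ht₀⟩ : (Γ n).Nonempty := nonempty_of_measure_ne_zero (hΓ0 n)
        have h := hva n _ (hmem n y t₀ hy ht₀)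
        simp only [Function.update_idem] at h
        have e : ∏ k ∈ Finset.univ.erase n, Real.exp (α k * |Function.update y n t₀ k|) =
            ∏ k ∈ Finset.univ.erase n, Real.exp (α k * |y k|) := by
          refine Finset.prod_congr rfl fun k hk => ?_
          rw [Function.update_of_ne (Finset.ne_of_mem_erase hk)]
        rw [e] at h
        have hR : 0 ≤ ∏ k ∈ Finset.univ.erase n, Real.exp (α k * |y k|) :=
          Finset.prod_nonneg fun k _ => (Real.exp_pos _).le
        rw [hEprod, ← ENNReal.ofReal_mul (by positivity)]
        refine le_trans (le_of_eq ?_) ((herr n _ _ (mul_nonneg hM hR) h).trans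
          (ENNReal.ofReal_le_ofReal ?_))
        · refine lintegral_congr_ae ?_
          filter_upwards [ae_gaussianOn_mem (hΓm n) (δ n)] with t ht
          rw [indicator_of_mem (hmem n y t hy ht)]
          simp_rw [indicator_of_mem (hmem n y _ hy (hxΓ n _))]
        · refine (mul_le_mul_of_nonneg_right (hCK n) (sq_nonneg _)).trans_eq ?_
          ring
      · have h0 : ∀ t, Function.update y n t ∉ Set.pi univ Γ := by
          intro t ht
          refine hy fun k hk => ?_
          simpa [hk] using ht k (mem_univ k)
        simp [indicator_of_notMem (h0 _)])
    Finset.univ 0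
  rw [lmarginal_univ, Finset.compl_univ, Finset.prod_empty, mul_one, Finset.card_univ,
    Fintype.card_fin] at key
  refine le_trans (le_of_eq ?_) (key.trans ?_)
  · refine lintegral_congr_ae ?_
    filter_upwards [hae] with y hy
    rw [partialInterp_univ, indicator_of_mem hy]
    simp only [tensorInterp]
    have hj : ∀ j : (∀ n, Fin (p n + 1)), (fun n => x n (j n)) ∈ Set.pi univ Γ :=
      fun j n _ => hxΓ n (j n)
    simp_rw [indicator_of_mem (hj _)]
  · have h2 : (2 * (ENNReal.ofReal K + 1)) ^ r = ENNReal.ofReal ((2 * (K + 1)) ^ r) := by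
      rw [ENNReal.ofReal_pow (by positivity), ENNReal.ofReal_mul zero_le_two,
        ENNReal.ofReal_add hK0 zero_le_one]
      simp
    rw [h2, ← ENNReal.ofReal_sum_of_nonneg (fun n _ => by positivity),
      ← ENNReal.ofReal_mul (by positivity)]
    refine ENNReal.ofReal_le_ofReal ?_
    have hr : ∀ n, 0 ≤ rate (Γ n) (τ n) (δ n) (p n) := fun n => (Real.exp_pos _).le
    have h3 : ∑ n, rate (Γ n) (τ n) (δ n) (p n) ^ 2 ≤ (∑ n, rate (Γ n) (τ n) (δ n) (p n)) ^ 2 :=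
      Finset.sum_sq_le_sq_sum_of_nonneg fun n _ => hr n
    rw [mul_pow (√((2 * (K + 1)) ^ r * (K + 1)) * M), mul_pow (√((2 * (K + 1)) ^ r * (K + 1))),
      Real.sq_sqrt (by positivity)]
    have h4 : ∑ n, K * (M * rate (Γ n) (τ n) (δ n) (p n)) ^ 2 =
        K * M ^ 2 * ∑ n, rate (Γ n) (τ n) (δ n) (p n) ^ 2 := by
      rw [Finset.mul_sum]
      exact Finset.sum_congr rfl fun n _ => by ring
    rw [h4]
    calc (2 * (K + 1)) ^ r * (K * M ^ 2 * ∑ n, rate (Γ n) (τ n) (δ n) (p n) ^ 2)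
        ≤ (2 * (K + 1)) ^ r * ((K + 1) * M ^ 2 * (∑ n, rate (Γ n) (τ n) (δ n) (p n)) ^ 2) := by
          gcongr
          linarith
      _ = _ := by ring

end

/-! ### Passage to the L² norm and conclusion -/

noncomputable section

theorem memLp_and_eLpNorm_le_of_lintegral_le {X V : Type*} [MeasurableSpace X]
    [NormedAddCommGroup V] {μ ν : Measure X} {F : X → V} {a B : ℝ}
    (hF : AEStronglyMeasurable F μ) (ha : 0 ≤ a) (hB : 0 ≤ B) (hμν : μ ≤ ENNReal.ofReal a • ν)
    (h : ∫⁻ y, ENNReal.ofReal (‖F y‖ ^ 2) ∂ν ≤ ENNReal.ofReal (B ^ 2)) :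
    MemLp F 2 μ ∧ eLpNorm F 2 μ ≤ ENNReal.ofReal (√a * B) := by
  have h1 : eLpNorm F 2 μ ≤ ENNReal.ofReal (√a * B) := by
    rw [eLpNorm_eq_lintegral_rpow_enorm_toReal two_ne_zero ENNReal.ofNat_ne_top]
    have h2 : ∫⁻ y, ‖F y‖ₑ ^ (2 : ENNReal).toReal ∂μ ≤ ENNReal.ofReal ((√a * B) ^ 2) := by
      rw [mul_pow, Real.sq_sqrt ha, ENNReal.ofReal_mul ha]
      refine (lintegral_mono' hμν le_rfl).trans ?_
      rw [lintegral_smul_measure, smul_eq_mul]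
      refine mul_le_mul_right (le_trans (le_of_eq (lintegral_congr fun y => ?_)) h) _
      rw [ENNReal.toReal_ofNat, ENNReal.rpow_ofNat, ENNReal.ofReal_pow (norm_nonneg _), ofReal_norm]
    refine (ENNReal.rpow_le_rpow h2 (by positivity)).trans_eq ?_
    rw [ENNReal.ofReal_rpow_of_nonneg (by positivity) (by positivity), ENNReal.toReal_ofNat,
      ← Real.sqrt_eq_rpow, Real.sqrt_sq (by positivity)]
  exact ⟨⟨hF, h1.trans_lt ENNReal.ofReal_lt_top⟩, h1⟩

theorem HasAnalyticBound.mono {V : Type*} [NormedAddCommGroup V] [NormedSpace ℝ V] {Γ : Set ℝ}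
    {g : ℝ → V} {M M' α γ : ℝ} (h : HasAnalyticBound Γ g M α γ) (hM : M ≤ M') (hγ : 0 ≤ γ) :
    HasAnalyticBound Γ g M' α γ :=
  ⟨h.contDiffOn, fun t ht j => (h.norm_le t ht j).trans (by gcongr)⟩

end

theorem mainTheorem5
    (D : Set Plane) (hD : IsPolygonalDomain D) (T : ℝ) (hT : 0 < T)
    (r : ℕ) (hr : 0 < r)
    -- the parameter intervals and the joint density
    (Γ : Fin r → Set ℝ) (hΓ : ∀ n, (Γ n).OrdConnected)
    (ρ : (Fin r → ℝ) → ℝ)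
    (hρm : AEMeasurable ρ (volume.restrict (Set.pi univ Γ)))
    (hρ0 : ∀ y ∈ Set.pi univ Γ, 0 ≤ ρ y)
    (hρ1 : ∫ y in Set.pi univ Γ, ρ y = 1)
    (δ : Fin r → ℝ)
    (hδb : ∀ n, Bornology.IsBounded (Γ n) → δ n = 0)
    (hδu : ∀ n, ¬ Bornology.IsBounded (Γ n) → 0 < δ n)
    (CM : ℝ) (hCM : 0 < CM)
    (hρ : ∀ y ∈ Set.pi univ Γ, ρ y ≤ CM * Real.exp (-∑ n, (δ n * y n) ^ 2))
    -- the one-dimensional weights whose orthogonal polynomials give the collocation points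
    (ρh : Fin r → ℝ → ℝ)
    (hρhm : ∀ n, AEMeasurable (ρh n) (volume.restrict (Γ n)))
    (Cmin Cmax : Fin r → ℝ) (hCmin : ∀ n, 0 < Cmin n)
    (hρh : ∀ n, ∀ t ∈ Γ n, Cmin n * Real.exp (-(δ n * t) ^ 2) ≤ ρh n t ∧
      ρh n t ≤ Cmax n * Real.exp (-(δ n * t) ^ 2))
    -- the forcing term
    (α : Fin r → ℝ) (hα : ∀ n, 0 < α n)
    (f : (Fin r → ℝ) → CTL2 D T) (hf : MemCSigma Γ α f)
    (hfsmooth : ∀ n, ∀ y ∈ Set.pi univ Γ,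
      ContDiffOn ℝ ((⊤ : ℕ∞) : WithTop ℕ∞) (fun t => f (Function.update y n t)) (Γ n))
    (γ : Fin r → ℝ) (hγ : ∀ n, 0 ≤ γ n)
    (hOnF : ∀ n, ∀ y ∈ Set.pi univ Γ, ∀ j : ℕ,
      ‖iteratedDerivWithin j (fun t => f (Function.update y n t)) (Γ n) (y n)‖ / (1 + ‖f y‖)
        ≤ γ n ^ j * (j.factorial : ℝ))
    -- `0 < τₙ < 1 / γₙ`, with `1 / 0 = ∞`
    (τ : Fin r → ℝ) (hτ0 : ∀ n, 0 < τ n) (hτ : ∀ n, τ n * γ n < 1) :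
    ∃ (C : ℝ) (b θ : Fin r → ℝ) (β : Fin r → ℕ → ℝ),
      0 < C ∧ (∀ n, 0 < b n) ∧
      (∀ n, Bornology.IsBounded (Γ n) →
        θ n = 1 ∧ (∀ q, β n q = 1) ∧
        b n = Real.log (2 * τ n / (volume (Γ n)).toReal *
          (1 + Real.sqrt (1 + (volume (Γ n)).toReal ^ 2 / (4 * τ n ^ 2))))) ∧
      (∀ n, ¬ Bornology.IsBounded (Γ n) →
        θ n = 1 / 2 ∧
        Asymptotics.IsBigO Filter.atTop (β n) (fun q : ℕ => Real.sqrt (q : ℝ)) ∧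
        b n = τ n * δ n) ∧
      -- every mesh, polynomial degree, number of time steps, reference parameter, POD space
      ∀ (𝒯 : Triangulation D) (s : ℕ), 0 < s → ∀ N : ℕ, 0 < N →
      ∀ y' ∈ Set.pi univ Γ, ∀ (d : ℕ), 0 < d → ∀ (X : Submodule ℝ (L2Pair D)),
        IsPODSpace hT.le N 𝒯 s (f y') d X →
      -- the POD-Galerkin solution
      ∀ u : (Fin r → ℝ) → ℕ → L2Pair D,
        (∀ y ∈ Set.pi univ Γ, IsBackwardEuler hT.le N X (f y) (u y)) →
      -- the collocation points
      ∀ (p : Fin r → ℕ) (x : ∀ n, Fin (p n + 1) → ℝ),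
        (∀ n, IsOrthogonalZeros (Γ n) (ρh n) (p n) (x n)) →
      ∀ m : ℕ, 1 ≤ m → m ≤ N →
        MemLp (fun y => (u y m).1 - tensorInterp p x (fun z => (u z m).1) y) 2
          (densityMeasure Γ ρ) ∧
        eLpNorm (fun y => (u y m).1 - tensorInterp p x (fun z => (u z m).1) y) 2
            (densityMeasure Γ ρ)
          ≤ ENNReal.ofReal
              (C * ∑ n, β n (p n) * Real.exp (-(b n * (p n : ℝ) ^ (θ n)))) := by
  have hΓm : ∀ n, MeasurableSet (Γ n) := fun n => (hΓ n).measurableSet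
  have hPm : MeasurableSet (Set.pi univ Γ) := MeasurableSet.univ_pi hΓm
  -- A probability density cannot live on a null set; hence no interval is degenerate, and
  -- derivatives within Γ n are unique.
  have hΓ0 : ∀ n, volume (Γ n) ≠ 0 := by
    intro n h0
    have hP0 : volume (Set.pi univ Γ) = 0 := by
      rw [volume_pi_pi]
      exact Finset.prod_eq_zero (Finset.mem_univ n) h0
    rw [Measure.restrict_eq_zero.2 hP0, integral_zero_measure] at hρ1
    exact zero_ne_one hρ1
  -- Rate zero on bounded intervals lets a single formula describe both kinds of growth weight.
  obtain ⟨a, ha⟩ : ∃ a : Fin r → ℝ, ∀ n,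
      (Bornology.IsBounded (Γ n) → a n = 0) ∧ (¬ Bornology.IsBounded (Γ n) → a n = α n) := by
    classical
    exact ⟨fun n => if Bornology.IsBounded (Γ n) then 0 else α n, fun n =>
      ⟨fun h => if_pos h, fun h => if_neg h⟩⟩
  have ha0 : ∀ n, 0 ≤ a n := by
    intro n
    by_cases hb : Bornology.IsBounded (Γ n)
    · exact ((ha n).1 hb).ge
    · exact ((ha n).2 hb).symm ▸ (hα n).le
  have hgw : ∀ n t, growthWeight (Γ n) (α n) t = Real.exp (-(a n * |t|)) := by
    intro n t
    unfold growthWeight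
    split_ifs with hb
    · simp [(ha n).1 hb]
    · rw [(ha n).2 hb]
  obtain ⟨hfc, M, hM⟩ := hf
  -- The quantity 1 + ‖f y‖ is the denominator in the derivative hypothesis; its 1 is absorbed
  -- because the product of exponentials is at least 1.
  have hgrow : ∀ y ∈ Set.pi univ Γ,
      1 + ‖f y‖ ≤ (1 + |M|) * ∏ n, Real.exp (a n * |y n|) := by
    intro y hy
    have h1 := (hM y hy).trans (le_abs_self M)
    simp_rw [hgw, Real.exp_neg, Finset.prod_inv_distrib] at h1
    have hP : 1 ≤ ∏ n, Real.exp (a n * |y n|) := by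
      rw [← Real.exp_sum]
      exact Real.one_le_exp (Finset.sum_nonneg fun n _ => mul_nonneg (ha0 n) (abs_nonneg _))
    rw [inv_mul_le_iff₀ (by linarith)] at h1
    linarith
  -- The constant is fixed before any mesh, time step, POD space or polynomial degree is introduced,
  -- which gives the asserted independence.
  obtain ⟨C, hC, hmain⟩ := exists_tensorInterp_error (L2 D) hΓ hΓ0 hδb hδu hρhm hCmin hρh ha0
    (fun n => (ha n).1) hγ hτ0 hτ
  have hM1 : 0 ≤ T * (1 + |M|) := by positivity
  refine ⟨√CM * (C * (T * (1 + |M|))), fun n => rateConstant (Γ n) (τ n) (δ n),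
    fun n => rateExponent (Γ n), fun _ _ => 1, by positivity,
    fun n => rateConstant_pos (hΓ n) (hΓ0 n) (hτ0 n) (hδu n), ?_, ?_, ?_⟩
  · intro n hb
    exact ⟨if_pos hb, fun _ => rfl, if_pos hb⟩
  · intro n hb
    refine ⟨if_neg hb, Asymptotics.IsBigO.of_bound 1 ?_, if_neg hb⟩
    filter_upwards [Filter.eventually_ge_atTop 1] with q hq
    have : (1 : ℝ) ≤ √(q : ℝ) := Real.one_le_sqrt.2 (by exact_mod_cast hq)
    rw [Real.norm_of_nonneg (zero_le_one.trans this)]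
    simpa using this
  intro 𝒯 s _ N hN y' _ d _ X hX u hu p x hx m _ hmN
  have := hX.finiteDimensional
  obtain ⟨S, hS, hSu⟩ := exists_backwardEuler_operator hT hN hX.eq_zero_of_snd_eq_zero hmN
  have hv : ∀ y ∈ Set.pi univ Γ, (u y m).1 = S (f y) := fun y hy => hSu _ _ (hu y hy)
  obtain ⟨hxΓ, hint⟩ := hmain p x hx
  -- The family u is prescribed on Γ only; the interpolants agree because the nodes belong to Γ.
  have hI : ∀ y, tensorInterp p x (fun z => (u z m).1) y = tensorInterp p x (fun z => S (f z)) y :=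
    fun y => Finset.sum_congr rfl fun j _ => 
      congrArg _ (hv _ fun n _ => hxΓ n (j n))
  have hSc : ContinuousOn (fun y => S (f y)) (Set.pi univ Γ) := S.continuous.comp_continuousOn hfc
  have hbound := hint (fun y => S (f y)) (T * (1 + |M|)) hM1 hSc (fun n y hy => by
    have hf' : HasAnalyticBound (Γ n) (fun t => f (Function.update y n t))
        ((1 + |M|) * ∏ k ∈ Finset.univ.erase n, Real.exp (a k * |y k|)) (a n) (γ n) := by
      refine ⟨hfsmooth n y hy, fun t ht j => ?_⟩
      have hyt : Function.update y n t ∈ Set.pi univ Γ := by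
        intro k _
        rcases eq_or_ne k n with rfl | hk
        · simpa using ht
        · simpa [hk] using hy k (mem_univ k)
      have h1 := hOnF n _ hyt j
      simp only [Function.update_idem, Function.update_self] at h1
      rw [div_le_iff₀ (by positivity)] at h1
      have h2 := hgrow _ hyt
      rw [← Finset.mul_prod_erase _ _ (Finset.mem_univ n), Function.update_self] at h2
      have e : ∏ k ∈ Finset.univ.erase n, Real.exp (a k * |Function.update y n t k|) =
          ∏ k ∈ Finset.univ.erase n, Real.exp (a k * |y k|) :=
        Finset.prod_congr rfl fun k hk => by
          rw [Function.update_of_ne (Finset.ne_of_mem_erase hk)]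
      rw [e] at h2
      have h3 : 0 ≤ γ n ^ j * (j.factorial : ℝ) := mul_nonneg (pow_nonneg (hγ n) _) (by positivity)
      refine (h1.trans (mul_le_mul_of_nonneg_left h2 h3)).trans_eq ?_
      ring
    refine (hf'.comp_clm (uniqueDiffOn_of_ordConnected (hΓ n) (hΓ0 n)) S).mono ?_ (hγ n)
    rw [mul_assoc]
    gcongr)
  have hcong : (fun y => (u y m).1 - tensorInterp p x (fun z => (u z m).1) y)
      =ᵐ[densityMeasure Γ ρ] fun y => S (f y) - tensorInterp p x (fun z => S (f z)) y := by
    filter_upwards [(withDensity_absolutelyContinuous _ _).ae_le (ae_restrict_mem hPm)] with y hy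
    rw [hI, hv y hy]
  have hmeas : AEStronglyMeasurable
      (fun y => S (f y) - tensorInterp p x (fun z => S (f z)) y) (densityMeasure Γ ρ) := by
    refine AEStronglyMeasurable.mono_ac (withDensity_absolutelyContinuous _ _)
      ((hSc.aestronglyMeasurable hPm).sub (Continuous.aestronglyMeasurable ?_))
    unfold tensorInterp
    fun_prop
  obtain ⟨k1, k2⟩ := memLp_and_eLpNorm_le_of_lintegral_le hmeas hCM.le
    (mul_nonneg (by positivity) (Finset.sum_nonneg fun n _ => (Real.exp_pos _).le))
    (densityMeasure_le hΓm hCM.le hρ) hbound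
  refine ⟨(memLp_congr_ae hcong).2 k1, (eLpNorm_congr_ae hcong).trans_le (k2.trans_eq ?_)⟩
  simp only [one_mul, ← mul_assoc]
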